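/- Let $M$ be a smooth manifold (finite-dimensional, Hausdorff, second countable, without boundary) and let $n\ge 1$. An N-manifold is a non-negatively graded supermanifold (parity being the degree mod $2$), and an NQ-manifold is an N-manifold with a vector field $Q$ of degree $1$ such that $Q^2=0$; N-maps are the degree-preserving maps, and NQ-maps are the N-maps that intertwine the vector fields $Q$. Let $T[1]M$ be the NQ-manifold whose functions are the differential forms on $M$, with $Q$ the de Rham differential $d$. Let $\mathbb R[n]$ be the additive group with one coordinate, of degree $n$, and $Q=0$; N-maps $S\to\mathbb R[n]$ are the functions of degree $n$ on $S$. A principal $\mathbb R[n]$-bundle over $T[1]M$ in the category of NQ-manifolds is an NQ-map $\pi:X\to T[1]M$ with an action $\mathbb R[n]\times X\to X$ over $T[1]M$ that is an NQ-map, such that over a neighbourhood of each point of $M$ it is isomorphic, as an N-manifold over $T[1]M$ with $\mathbb R[n]$-action, to a product with $\mathbb R[n]$. An isomorphism of such bundles is an equivariant isomorphism of NQ-manifolds over $T[1]M$. An N-trivialization is an equivariant isomorphism of N-manifolds $X\cong T[1]M\times\mathbb R[n]$ over $T[1]M$; it is given by its fibre coordinate $\xi$, a function of degree $n$ on $X$.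 Then: 1. Every principal $\mathbb R[n]$-bundle $X\to T[1]M$ has an N-trivialization. 2. In an N-trivialization with fibre coordinate $\xi$ there is a unique closed form $\eta\in\Omega^{n+1}(M)$ with $Q\xi=\pi^*\eta$, i.e. $Q=d+\eta\,\partial/\partial\xi$; it is called the vertical part of $Q$. 3. If $\xi$ is the fibre coordinate of an N-trivialization of $X$, then the fibre coordinates of the N-trivializations of $X$ are exactly the functions $\xi+\pi^*\alpha$ with $\alpha\in\Omega^n(M)$, where $\alpha$ is unique; this change of N-trivialization replaces $\eta$ by $\eta+d\alpha$. 4. Assigning to $X$ the class $[\eta]$, for any N-trivialization of $X$, gives a well-defined bijection from the set of isomorphism classes of principal $\mathbb R[n]$-bundles over $T[1]M$ in the category of NQ-manifolds onto the de Rham cohomology $H^{n+1}_{DR}(M)$. -/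

import Mathlib

set_option linter.unusedSectionVars false

open scoped Manifold ContDiff
open TopologicalSpace

universe u

noncomputable section

namespace NQ

/-- The model cotangent space `(ℝ^m)^*`. -/
abbrev Cot (m : ℕ) : Type := EuclideanSpace ℝ (Fin m) →L[ℝ] ℝ

/-- The exterior algebra `Λ((ℝ^m)^*)`. -/
abbrev Lam (m : ℕ) : Type := ExteriorAlgebra ℝ (Cot m)

/-- The coordinate basis `e^1, …, e^m` of `(ℝ^m)^*`. -/
def cotBasis (m : ℕ) : Module.Basis (Fin m) ℝ (Cot m) :=
  ((EuclideanSpace.basisFun (Fin m) ℝ).toBasis.dualBasis).map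
    (LinearMap.toContinuousLinearMap : (EuclideanSpace ℝ (Fin m) →ₗ[ℝ] ℝ) ≃ₗ[ℝ] _)

/-- The induced basis `e^{i_1} ∧ ⋯ ∧ e^{i_k}`, `i_1 < ⋯ < i_k`, of `Λ((ℝ^m)^*)`. -/
def lamBasis (m : ℕ) : Module.Basis (Finset (Fin m)) ℝ (Lam m) :=
  (cotBasis m).ExteriorAlgebra

/-- The coefficient functions of a `Λ((ℝ^m)^*)`-valued function. -/
def coeff {m : ℕ} {X : Type*} (h : X → Lam m) (I : Finset (Fin m)) : X → ℝ :=
  fun y => (lamBasis m).repr (h y) I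

/-- The exterior derivative `Σ_I dh_I ∧ e^I` at `y` of a form `h = Σ_I h_I e^I` on `ℝ^m`. -/
def flatD {m : ℕ} (h : EuclideanSpace ℝ (Fin m) → Lam m) (y : EuclideanSpace ℝ (Fin m)) :
    Lam m :=
  ∑ I, ExteriorAlgebra.ι ℝ (fderiv ℝ (coeff h I) y) * lamBasis m I

section flat
variable {m : ℕ}
local notation "E" => EuclideanSpace ℝ (Fin m)

theorem sum_coeff {X : Type*} (h : X → Lam m) (y : X) :
    ∑ I, coeff h I y • lamBasis m I = h y := (lamBasis m).sum_repr (h y)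

theorem cotBasis_apply (i : Fin m) (v : E) : cotBasis m i v = v i := by
  simp [cotBasis]

theorem sum_cot (ℓ : Cot m) :
    ∑ i, ℓ (EuclideanSpace.single i 1) • cotBasis m i = ℓ := by
  refine (EuclideanSpace.basisFun (Fin m) ℝ).toBasis.ext
    (f₁ := ((∑ i, ℓ (EuclideanSpace.single i 1) • cotBasis m i : Cot m) : E →ₗ[ℝ] ℝ))
    (f₂ := (ℓ : E →ₗ[ℝ] ℝ)) ?_ |> fun h => ContinuousLinearMap.coe_injective h
  intro j
  simp [cotBasis_apply, Finset.sum_apply]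

/-- `flatD` may be computed from any expansion with constant frame. -/
theorem flatD_sum {α : Type*} (s : Finset α) (f : α → E → ℝ) (c : α → Lam m) (h : E → Lam m)
    (y : E) (hf : ∀ a ∈ s, DifferentiableAt ℝ (f a) y)
    (hh : h =ᶠ[nhds y] fun z => ∑ a ∈ s, f a z • c a) :
    flatD h y = ∑ a ∈ s, ExteriorAlgebra.ι ℝ (fderiv ℝ (f a) y) * c a := by
  have key : ∀ I, fderiv ℝ (coeff h I) y
      = ∑ a ∈ s, (lamBasis m).repr (c a) I • fderiv ℝ (f a) y := by
    intro I
    have : coeff h I =ᶠ[nhds y] fun z => ∑ a ∈ s, f a z * (lamBasis m).repr (c a) I := by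
      filter_upwards [hh] with z hz
      simp [coeff, hz, map_sum, Finsupp.finsetSum_apply]
    rw [this.fderiv_eq, fderiv_fun_sum (fun a ha => (hf a ha).mul_const _)]
    exact Finset.sum_congr rfl fun a ha => fderiv_mul_const (hf a ha) _
  unfold flatD
  simp only [key, map_sum, map_smul, Finset.sum_mul]
  rw [Finset.sum_comm]
  refine Finset.sum_congr rfl fun a _ => ?_
  conv_rhs => rw [← (lamBasis m).sum_repr (c a), Finset.mul_sum]
  exact Finset.sum_congr rfl fun I _ => by rw [smul_mul_assoc, mul_smul_comm]

/-- Differentiability of all coefficients. -/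
def CoeffDiff (h : E → Lam m) (y : E) : Prop := ∀ I, DifferentiableAt ℝ (coeff h I) y

/-- The grade involution. -/
abbrev inv : Lam m →ₐ[ℝ] Lam m := CliffordAlgebra.involute

theorem ι_mul (v : Cot m) (a : Lam m) :
    ExteriorAlgebra.ι ℝ v * a = inv a * ExteriorAlgebra.ι ℝ v := by
  induction a using ExteriorAlgebra.induction with
  | algebraMap r => simp [Algebra.commutes]
  | ι w =>
    have : inv (ExteriorAlgebra.ι ℝ w) = - ExteriorAlgebra.ι ℝ w :=
      CliffordAlgebra.involute_ι (Q := (0 : QuadraticForm ℝ (Cot m))) w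
    rw [this, neg_mul, eq_neg_iff_add_eq_zero]
    exact ExteriorAlgebra.ι_add_mul_swap v w
  | mul a b ha hb => rw [map_mul, ← mul_assoc, ha, mul_assoc, hb, mul_assoc]
  | add a b ha hb => rw [mul_add, ha, hb, map_add, add_mul]

theorem inv_ι (v : Cot m) : inv (ExteriorAlgebra.ι ℝ v) = - ExteriorAlgebra.ι ℝ v :=
  CliffordAlgebra.involute_ι (Q := (0 : QuadraticForm ℝ (Cot m))) v

theorem inv_of_mem {k : ℕ} {a : Lam m} (ha : a ∈ ⋀[ℝ]^k (Cot m)) : inv a = (-1 : ℝ) ^ k • a := by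
  induction ha using Submodule.pow_induction_on_left' with
  | algebraMap r => simp
  | add x y i hx hy ihx ihy => rw [map_add, ihx, ihy, smul_add]
  | mem_mul x hx i y hy ih =>
    obtain ⟨v, rfl⟩ := hx
    rw [map_mul, inv_ι, ih, pow_succ, mul_smul]
    simp

theorem comm_of_mem {i j : ℕ} {a b : Lam m} (ha : a ∈ ⋀[ℝ]^i (Cot m))
    (hb : b ∈ ⋀[ℝ]^j (Cot m)) : a * b = (-1 : ℝ) ^ (i * j) • (b * a) := by
  induction ha using Submodule.pow_induction_on_left' with
  | algebraMap r => simp [Algebra.commutes]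
  | add x y i hx hy ihx ihy => rw [add_mul, ihx, ihy, mul_add, smul_add]
  | mem_mul x hx i y hy ih =>
    obtain ⟨v, rfl⟩ := hx
    rw [mul_assoc, ih, mul_smul_comm, ← mul_assoc, ι_mul, inv_of_mem hb, smul_mul_assoc,
      smul_mul_assoc, smul_smul, mul_assoc, ← pow_add]
    congr 2
    rw [Nat.succ_mul]

theorem flatD_congr {h k : E → Lam m} {y : E} (hk : h =ᶠ[nhds y] k) : flatD h y = flatD k y := by
  unfold flatD
  refine Finset.sum_congr rfl fun I _ => ?_
  have : coeff h I =ᶠ[nhds y] coeff k I := hk.mono fun z hz => by simp [coeff, hz]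
  rw [this.fderiv_eq]

theorem flatD_add {h k : E → Lam m} {y : E} (hh : CoeffDiff h y) (hk : CoeffDiff k y) :
    flatD (fun z => h z + k z) y = flatD h y + flatD k y := by
  unfold flatD
  rw [← Finset.sum_add_distrib]
  refine Finset.sum_congr rfl fun I _ => ?_
  have : coeff (fun z => h z + k z) I = fun z => coeff h I z + coeff k I z := by
    ext z; simp [coeff]
  rw [this, fderiv_fun_add (hh I) (hk I), map_add, add_mul]

theorem flatD_map (T : Lam m →ₗ[ℝ] Lam m) {h : E → Lam m} {y : E} (hh : CoeffDiff h y) :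
    flatD (fun z => T (h z)) y
      = ∑ I, ExteriorAlgebra.ι ℝ (fderiv ℝ (coeff h I) y) * T (lamBasis m I) :=
  flatD_sum _ _ _ _ _ (fun I _ => hh I) (Filter.Eventually.of_forall fun z => by
    simp only [← map_smul, ← map_sum, sum_coeff])

theorem coeffDiff_of_sum {α : Type*} (s : Finset α) (f : α → E → ℝ) (c : α → Lam m)
    (h : E → Lam m) (y : E) (hf : ∀ a ∈ s, DifferentiableAt ℝ (f a) y)
    (hh : h =ᶠ[nhds y] fun z => ∑ a ∈ s, f a z • c a) : CoeffDiff h y := by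
  intro I
  have : coeff h I =ᶠ[nhds y] fun z => ∑ a ∈ s, f a z * (lamBasis m).repr (c a) I := by
    filter_upwards [hh] with z hz
    simp [coeff, hz, map_sum, Finsupp.finsetSum_apply]
  rw [this.differentiableAt_iff]
  exact DifferentiableAt.fun_sum fun a ha => (hf a ha).mul_const _

theorem flatD_inv {h : E → Lam m} {y : E} (hh : CoeffDiff h y) :
    flatD (fun z => inv (h z)) y = - inv (flatD h y) := by
  have := flatD_map (inv (m := m)).toLinearMap hh
  rw [show (fun z => inv (h z)) = fun z => (inv (m := m)).toLinearMap (h z) from rfl, this]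
  unfold flatD
  rw [map_sum, ← Finset.sum_neg_distrib]
  refine Finset.sum_congr rfl fun I _ => ?_
  rw [map_mul, inv_ι]
  simp

theorem mul_expand (h k : Lam m) :
    h * k = ∑ p : Finset (Fin m) × Finset (Fin m),
      ((lamBasis m).repr h p.1 * (lamBasis m).repr k p.2) • (lamBasis m p.1 * lamBasis m p.2) := by
  conv_lhs => rw [← (lamBasis m).sum_repr h, ← (lamBasis m).sum_repr k, Finset.sum_mul_sum]
  rw [Fintype.sum_prod_type]
  refine Finset.sum_congr rfl fun I _ => Finset.sum_congr rfl fun J _ => ?_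
  rw [smul_mul_smul_comm]

theorem coeffDiff_mul {h k : E → Lam m} {y : E} (hh : CoeffDiff h y) (hk : CoeffDiff k y) :
    CoeffDiff (fun z => h z * k z) y :=
  coeffDiff_of_sum Finset.univ
    (fun p : Finset (Fin m) × Finset (Fin m) => fun z => coeff h p.1 z * coeff k p.2 z)
    (fun p => lamBasis m p.1 * lamBasis m p.2) _ _ (fun _ _ => (hh _).mul (hk _))
    (Filter.Eventually.of_forall fun _ => mul_expand _ _)

theorem flatD_mul {h k : E → Lam m} {y : E} (hh : CoeffDiff h y) (hk : CoeffDiff k y) :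
    flatD (fun z => h z * k z) y = flatD h y * k y + inv (h y) * flatD k y := by
  rw [flatD_sum Finset.univ
    (fun p : Finset (Fin m) × Finset (Fin m) => fun z => coeff h p.1 z * coeff k p.2 z)
    (fun p => lamBasis m p.1 * lamBasis m p.2) _ _ (fun _ _ => (hh _).mul (hk _))
    (Filter.Eventually.of_forall fun _ => mul_expand _ _)]
  have e1 : flatD h y * k y = ∑ p : Finset (Fin m) × Finset (Fin m),
      (ExteriorAlgebra.ι ℝ (fderiv ℝ (coeff h p.1) y) * lamBasis m p.1) *
        (coeff k p.2 y • lamBasis m p.2) := by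
    conv_lhs => rw [← sum_coeff k y]
    unfold flatD
    rw [Finset.sum_mul_sum, Fintype.sum_prod_type]
  have e2 : inv (h y) * flatD k y = ∑ p : Finset (Fin m) × Finset (Fin m),
      inv (coeff h p.1 y • lamBasis m p.1) *
        (ExteriorAlgebra.ι ℝ (fderiv ℝ (coeff k p.2) y) * lamBasis m p.2) := by
    conv_lhs => rw [← sum_coeff h y]
    unfold flatD
    rw [map_sum, Finset.sum_mul_sum, Fintype.sum_prod_type]
  rw [e1, e2, ← Finset.sum_add_distrib]
  refine Finset.sum_congr rfl fun p _ => ?_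
  rw [fderiv_fun_mul (hh _) (hk _), map_add, map_smul, map_smul, add_mul, map_smul]
  have e3 : inv (lamBasis m p.1) * (ExteriorAlgebra.ι ℝ (fderiv ℝ (coeff k p.2) y) * lamBasis m p.2)
      = ExteriorAlgebra.ι ℝ (fderiv ℝ (coeff k p.2) y) * (lamBasis m p.1 * lamBasis m p.2) := by
    rw [← mul_assoc, ← ι_mul, mul_assoc]
  simp only [smul_mul_assoc, mul_smul_comm, e3]
  rw [add_comm, mul_assoc]

theorem flatD_fderiv {g : E → ℝ} {y : E} (hg : ContDiffAt ℝ 2 g y) :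
    flatD (fun z => ExteriorAlgebra.ι ℝ (fderiv ℝ g z)) y = 0 := by
  have hd : DifferentiableAt ℝ (fderiv ℝ g) y :=
    (hg.fderiv_right (m := 1) (by norm_num)).differentiableAt (by norm_num)
  rw [flatD_sum Finset.univ (fun i z => fderiv ℝ g z (EuclideanSpace.single i 1))
    (fun i => ExteriorAlgebra.ι ℝ (cotBasis m i)) _ _ (fun i _ => hd.clm_apply (by fun_prop))
    (Filter.Eventually.of_forall fun z => by
      simp only [← map_smul, ← map_sum, sum_cot])]
  have hs := hg.isSymmSndFDerivAt (by simp)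
  have e : ∀ i j : Fin m, fderiv ℝ (fun z => fderiv ℝ g z (EuclideanSpace.single i 1)) y
      (EuclideanSpace.single j 1)
      = fderiv ℝ (fderiv ℝ g) y (EuclideanSpace.single j 1) (EuclideanSpace.single i 1) := by
    intro i j
    rw [fderiv_clm_apply hd (by fun_prop)]
    simp
  set S := ∑ i, ExteriorAlgebra.ι ℝ (fderiv ℝ (fun z => fderiv ℝ g z (EuclideanSpace.single i 1)) y)
    * ExteriorAlgebra.ι ℝ (cotBasis m i) with hS
  have e1 : S = ∑ i, ∑ j, (fderiv ℝ (fderiv ℝ g) y (EuclideanSpace.single j 1)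
      (EuclideanSpace.single i 1)) •
      (ExteriorAlgebra.ι ℝ (cotBasis m j) * ExteriorAlgebra.ι ℝ (cotBasis m i)) := by
    rw [hS]
    refine Finset.sum_congr rfl fun i _ => ?_
    rw [← sum_cot (fderiv ℝ (fun z => fderiv ℝ g z (EuclideanSpace.single i 1)) y), map_sum,
      Finset.sum_mul]
    refine Finset.sum_congr rfl fun j _ => ?_
    rw [map_smul, smul_mul_assoc, e]
  have e2 : S = -S := by
    conv_lhs => rw [e1, Finset.sum_comm]
    rw [e1, ← Finset.sum_neg_distrib]
    refine Finset.sum_congr rfl fun i _ => ?_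
    rw [← Finset.sum_neg_distrib]
    refine Finset.sum_congr rfl fun j _ => ?_
    rw [hs.eq, ← smul_neg]
    congr 1
    exact eq_neg_of_add_eq_zero_left (ExteriorAlgebra.ι_add_mul_swap _ _)
  have : (2 : ℝ) • S = 0 := by rw [two_smul]; nth_rewrite 1 [e2]; simp
  exact (smul_eq_zero.mp this).resolve_left (by norm_num)

/-- The projection of `Λ((ℝ^m)^*)` onto its part of degree `k`. -/
def gradeProj (k : ℕ) : Lam m →ₗ[ℝ] Lam m := GradedAlgebra.proj (fun i : ℕ => ⋀[ℝ]^i (Cot m)) k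

theorem gradeProj_mem (k : ℕ) (a : Lam m) : gradeProj k a ∈ ⋀[ℝ]^k (Cot m) :=
  SetLike.coe_mem (DirectSum.decompose (fun i : ℕ => ⋀[ℝ]^i (Cot m)) a k)

theorem gradeProj_of_mem {k : ℕ} {a : Lam m} (ha : a ∈ ⋀[ℝ]^k (Cot m)) : gradeProj k a = a :=
  DirectSum.decompose_of_mem_same (fun i : ℕ => ⋀[ℝ]^i (Cot m)) ha

theorem gradeProj_of_ne {k l : ℕ} {a : Lam m} (ha : a ∈ ⋀[ℝ]^k (Cot m)) (h : k ≠ l) :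
    gradeProj l a = 0 :=
  DirectSum.decompose_of_mem_ne (fun i : ℕ => ⋀[ℝ]^i (Cot m)) ha h

theorem lamBasis_apply (s : Finset (Fin m)) : lamBasis m s
    = ExteriorAlgebra.ιMulti ℝ s.card (fun i => cotBasis m (s.orderEmbOfFin rfl i)) := by
  rw [lamBasis, ExteriorAlgebra.basis_apply_ofCard (cotBasis m) (s := s) rfl]
  rfl

theorem lamBasis_mem (s : Finset (Fin m)) : lamBasis m s ∈ ⋀[ℝ]^s.card (Cot m) := by
  rw [lamBasis_apply]
  exact ExteriorAlgebra.ιMulti_range ℝ s.card ⟨_, rfl⟩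

theorem sum_gradeProj (a : Lam m) : ∑ k ∈ Finset.range (m + 1), gradeProj k a = a := by
  have : (∑ k ∈ Finset.range (m + 1), gradeProj k : Lam m →ₗ[ℝ] Lam m) = LinearMap.id := by
    refine (lamBasis m).ext fun s => ?_
    rw [LinearMap.sum_apply, Finset.sum_eq_single s.card, gradeProj_of_mem (lamBasis_mem s)]
    · rfl
    · intro k _ hk; exact gradeProj_of_ne (lamBasis_mem s) hk.symm
    · intro h; exact absurd (Finset.mem_range.mpr (Nat.lt_succ_of_le (by
        simpa using Finset.card_le_univ s))) h
  simpa using LinearMap.congr_fun this a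

theorem gradeProj_mul (k : ℕ) (a b : Lam m) :
    gradeProj k (a * b) = ∑ i ∈ Finset.range (m + 1), ∑ j ∈ Finset.range (m + 1),
      if i + j = k then gradeProj i a * gradeProj j b else 0 := by
  conv_lhs => rw [← sum_gradeProj a, ← sum_gradeProj b, Finset.sum_mul_sum, map_sum]
  refine Finset.sum_congr rfl fun i _ => ?_
  rw [map_sum]
  refine Finset.sum_congr rfl fun j _ => ?_
  have hm : gradeProj i a * gradeProj j b ∈ ⋀[ℝ]^(i + j) (Cot m) :=
    SetLike.mul_mem_graded (A := fun i : ℕ => ⋀[ℝ]^i (Cot m)) (gradeProj_mem i a)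
      (gradeProj_mem j b)
  split_ifs with h
  · exact gradeProj_of_mem (h ▸ hm)
  · exact gradeProj_of_ne hm h

theorem ι_mem (v : Cot m) : ExteriorAlgebra.ι ℝ v ∈ ⋀[ℝ]^1 (Cot m) := by
  rw [ExteriorAlgebra.exteriorPower, pow_one]; exact ⟨v, rfl⟩

theorem gradeProj_ι_mul (k : ℕ) (v : Cot m) (a : Lam m) :
    gradeProj (k + 1) (ExteriorAlgebra.ι ℝ v * a) = ExteriorAlgebra.ι ℝ v * gradeProj k a := by
  induction a using DirectSum.Decomposition.inductionOn (fun i : ℕ => ⋀[ℝ]^i (Cot m)) with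
  | zero => simp
  | add a b ha hb => rw [mul_add, map_add, ha, hb, map_add, mul_add]
  | @homogeneous i a =>
    have hm : ExteriorAlgebra.ι ℝ v * (a : Lam m) ∈ ⋀[ℝ]^(1 + i) (Cot m) :=
      SetLike.mul_mem_graded (A := fun i : ℕ => ⋀[ℝ]^i (Cot m)) (ι_mem v) a.2
    rw [add_comm] at hm
    by_cases h : i = k
    · subst h; rw [gradeProj_of_mem hm, gradeProj_of_mem a.2]
    · rw [gradeProj_of_ne hm (by omega), gradeProj_of_ne a.2 h, mul_zero]

theorem flatD_gradeProj (k : ℕ) {h : E → Lam m} {y : E} (hh : CoeffDiff h y) :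
    flatD (fun z => gradeProj k (h z)) y = gradeProj (k + 1) (flatD h y) := by
  rw [flatD_map _ hh]
  unfold flatD
  rw [map_sum]
  exact Finset.sum_congr rfl fun I _ => (gradeProj_ι_mul k _ _).symm

end flat

section manifold
variable (m : ℕ) {M : Type u} [TopologicalSpace M] [ChartedSpace (EuclideanSpace ℝ (Fin m)) M]
local notation "E" => EuclideanSpace ℝ (Fin m)

/-- The differential of a function at a point, as a covector. (In Mathlib every tangent space of an
`m`-manifold is the model space `ℝ^m`, so the fibre of `Λ T^*M` at each point is `Lam m`.) -/
def dAt (f : M → ℝ) (x : M) : Cot m := mfderiv (𝓡 m) 𝓘(ℝ, ℝ) f x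

/-- The algebra generated by the functions `f` and the differentials `df`,
for `f` smooth on the open set `V`. -/
def formGen (V : Opens M) : Subalgebra ℝ (V → Lam m) :=
  Algebra.adjoin ℝ {w | ∃ f : M → ℝ, ContMDiffOn (𝓡 m) 𝓘(ℝ, ℝ) ∞ f V ∧
    ((w = fun x : V => algebraMap ℝ (Lam m) (f x)) ∨
      (w = fun x : V => ExteriorAlgebra.ι ℝ (dAt m f x)))}

variable {m} in
/-- Restriction of sections. -/
def restr {U V : Opens M} (h : U ≤ V) : (V → Lam m) →ₐ[ℝ] (U → Lam m) :=
  AlgHom.pi fun x => Pi.evalAlgHom ℝ _ (⟨x, h x.2⟩ : V)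

variable {m} in
theorem restr_apply {U V : Opens M} (h : U ≤ V) (w : V → Lam m) (x : U) :
    restr h w x = w ⟨x, h x.2⟩ := rfl

theorem restr_formGen {U V : Opens M} (h : U ≤ V) {w : V → Lam m} (hw : w ∈ formGen m V) :
    restr h w ∈ formGen m U := by
  have : formGen m V ≤ (formGen m U).comap (restr h) := by
    refine Algebra.adjoin_le ?_
    rintro _ ⟨f, hf, rfl | rfl⟩
    · exact Algebra.subset_adjoin ⟨f, hf.mono h, Or.inl rfl⟩
    · exact Algebra.subset_adjoin ⟨f, hf.mono h, Or.inr rfl⟩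
  exact this hw

/-- The algebra `Ω(U)` of smooth differential forms on `U`: the sections of `Λ T^*M` that are
locally sums of products of smooth functions and of differentials of smooth functions. -/
def Form (U : Opens M) : Subalgebra ℝ (U → Lam m) where
  carrier := {w | ∀ x ∈ U, ∃ V : Opens M, ∃ h : V ≤ U, x ∈ V ∧ restr h w ∈ formGen m V}
  mul_mem' := by
    intro a b ha hb x hx
    obtain ⟨V, hV, hxV, h1⟩ := ha x hx
    obtain ⟨W, hW, hxW, h2⟩ := hb x hx
    refine ⟨V ⊓ W, inf_le_left.trans hV, ⟨hxV, hxW⟩, ?_⟩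
    rw [map_mul]
    exact mul_mem (restr_formGen m inf_le_left h1) (restr_formGen m inf_le_right h2)
  add_mem' := by
    intro a b ha hb x hx
    obtain ⟨V, hV, hxV, h1⟩ := ha x hx
    obtain ⟨W, hW, hxW, h2⟩ := hb x hx
    refine ⟨V ⊓ W, inf_le_left.trans hV, ⟨hxV, hxW⟩, ?_⟩
    rw [map_add]
    exact add_mem (restr_formGen m inf_le_left h1) (restr_formGen m inf_le_right h2)
  algebraMap_mem' := by
    intro r x hx
    refine ⟨U, le_rfl, hx, ?_⟩
    rw [AlgHom.commutes]
    exact Subalgebra.algebraMap_mem _ r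

variable {m} in
/-- Extension of a section by zero. -/
def extZero {U : Opens M} (w : U → Lam m) : M → Lam m := by
  classical exact fun x => if h : x ∈ U then w ⟨x, h⟩ else 0

variable {m} in
theorem extZero_of_mem {U : Opens M} (w : U → Lam m) {x : M} (h : x ∈ U) :
    extZero w x = w ⟨x, h⟩ := dif_pos h

variable {m} in
/-- Precomposition of covectors with a linear map. -/
def precomp (T : E →L[ℝ] E) : Cot m →ₗ[ℝ] Cot m where
  toFun ℓ := ℓ.comp T
  map_add' _ _ := rfl
  map_smul' _ _ := rfl

/-- Pullback of covectors along the inverse of the preferred chart at `x`. -/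
def chartPull (x : M) (y : E) : Lam m →ₐ[ℝ] Lam m :=
  ExteriorAlgebra.map (precomp (mfderiv (𝓡 m) (𝓡 m) (chartAt E x).symm y))

/-- A form in the preferred chart at `x`. -/
def rep {U : Opens M} (x : M) (w : U → Lam m) (y : E) : Lam m :=
  chartPull m x y (extZero w ((chartAt E x).symm y))

/-- The exterior derivative; `(dw)(x)` is computed in the preferred chart at `x`. -/
def formD {U : Opens M} (w : U → Lam m) : U → Lam m :=
  fun x => flatD (rep m x.1 w) (chartAt E x.1 x.1)

/-- The part of the chart domain at `x` that lies in `U`, in coordinates. -/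
def chartDom (x : M) (U : Opens M) : Set E := (chartAt E x).target ∩ (chartAt E x).symm ⁻¹' U

theorem isOpen_chartDom (x : M) (U : Opens M) : IsOpen (chartDom m x U) :=
  (chartAt E x).isOpen_inter_preimage_symm U.2

theorem mem_chartDom {x : M} {U : Opens M} (hx : x ∈ U) : chartAt E x x ∈ chartDom m x U :=
  ⟨mem_chart_target _ x, by simpa [(chartAt E x).left_inv (mem_chart_source _ x)] using hx⟩

theorem rep_of_mem {U : Opens M} (x : M) (w : U → Lam m) {y : E} (hy : y ∈ chartDom m x U) :
    rep m x w y = chartPull m x y (w ⟨(chartAt E x).symm y, hy.2⟩) := by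
  rw [rep, extZero_of_mem w hy.2]

theorem rep_restr {U V : Opens M} (h : V ≤ U) (x : M) (w : U → Lam m) {y : E}
    (hy : y ∈ chartDom m x V) : rep m x (restr h w) y = rep m x w y := by
  rw [rep_of_mem m x _ hy, rep_of_mem m x w ⟨hy.1, h hy.2⟩, restr_apply]

theorem formD_restr {U V : Opens M} (h : V ≤ U) (w : U → Lam m) :
    formD m (restr h w) = restr h (formD m w) := by
  ext x
  refine flatD_congr ?_
  filter_upwards [(isOpen_chartDom m x.1 V).mem_nhds (mem_chartDom m x.2)] with y hy
  exact rep_restr m h x.1 w hy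

variable [IsManifold (𝓡 m) ∞ M]

theorem contDiffOn_chart (x : M) {V : Opens M} {f : M → ℝ}
    (hf : ContMDiffOn (𝓡 m) 𝓘(ℝ, ℝ) ∞ f V) :
    ContDiffOn ℝ ∞ (f ∘ (chartAt E x).symm) (chartDom m x V) := by
  rw [← contMDiffOn_iff_contDiffOn]
  exact hf.comp ((contMDiffOn_chart_symm (I := 𝓡 m) (x := x)).mono fun y hy => hy.1)
    fun y hy => hy.2

theorem chartPull_dAt (x : M) {V : Opens M} {f : M → ℝ}
    (hf : ContMDiffOn (𝓡 m) 𝓘(ℝ, ℝ) ∞ f V) {y : E} (hy : y ∈ chartDom m x V) :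
    chartPull m x y (ExteriorAlgebra.ι ℝ (dAt m f ((chartAt E x).symm y)))
      = ExteriorAlgebra.ι ℝ (fderiv ℝ (f ∘ (chartAt E x).symm) y) := by
  have h1 : MDifferentiableAt (𝓡 m) 𝓘(ℝ, ℝ) f ((chartAt E x).symm y) :=
    (hf.contMDiffAt (V.2.mem_nhds hy.2)).mdifferentiableAt (by simp)
  have h2 : MDifferentiableAt (𝓡 m) (𝓡 m) (chartAt E x).symm y :=
    ((contMDiffOn_chart_symm (I := 𝓡 m) (x := x) (n := ∞)).contMDiffAt
      ((chartAt E x).open_target.mem_nhds hy.1)).mdifferentiableAt (by simp)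
  rw [chartPull, ExteriorAlgebra.map_apply_ι]
  congr 1
  have h3 := mfderiv_comp y h1 h2
  rw [mfderiv_eq_fderiv] at h3
  exact h3.symm

theorem coeff_rep (x : M) {V : Opens M} {w : V → Lam m} (hw : w ∈ formGen m V)
    (I : Finset (Fin m)) : ContDiffOn ℝ ∞ (coeff (rep m x w) I) (chartDom m x V) := by
  induction hw using Algebra.adjoin_induction generalizing I with
  | mem w h =>
    obtain ⟨f, hf, rfl | rfl⟩ := h
    · have : ContDiffOn ℝ ∞ (fun y => (f ∘ (chartAt E x).symm) y *
          (lamBasis m).repr (1 : Lam m) I) (chartDom m x V) :=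
        (contDiffOn_chart m x hf).mul contDiffOn_const
      refine this.congr fun y hy => ?_
      simp [coeff, rep_of_mem m x _ hy, Algebra.algebraMap_eq_smul_one]
    · let T : Cot m →L[ℝ] ℝ := LinearMap.toContinuousLinearMap
        ((lamBasis m).coord I ∘ₗ ExteriorAlgebra.ι ℝ)
      have : ContDiffOn ℝ ∞ (fun y => T (fderiv ℝ (f ∘ (chartAt E x).symm) y))
          (chartDom m x V) :=
        T.contDiff.comp_contDiffOn ((contDiffOn_chart m x hf).fderiv_of_isOpen
          (isOpen_chartDom m x V) (by simp))
      refine this.congr fun y hy => ?_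
      simp only [coeff, rep_of_mem m x _ hy]
      rw [chartPull_dAt m x hf hy]
      rfl
  | algebraMap r =>
    refine (contDiffOn_const (c := (lamBasis m).repr (algebraMap ℝ (Lam m) r) I)).congr
      fun y hy => ?_
    simp [coeff, rep_of_mem m x _ hy]
  | add a b _ _ ha hb =>
    refine ((ha I).add (hb I)).congr fun y hy => ?_
    simp [coeff, rep_of_mem m x _ hy]
  | mul a b _ _ ha hb =>
    have : ContDiffOn ℝ ∞ (fun y => ∑ p : Finset (Fin m) × Finset (Fin m),
        (coeff (rep m x a) p.1 y * coeff (rep m x b) p.2 y) *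
          (lamBasis m).repr (lamBasis m p.1 * lamBasis m p.2) I) (chartDom m x V) :=
      ContDiffOn.sum fun p _ => ((ha _).mul (hb _)).mul contDiffOn_const
    refine this.congr fun y hy => ?_
    have : rep m x (a * b) y = rep m x a y * rep m x b y := by
      simp [rep_of_mem m x _ hy]
    rw [coeff, this, mul_expand]
    simp [map_sum, Finsupp.finsetSum_apply, coeff]

theorem coeffDiff_rep {V : Opens M} {w : V → Lam m} (hw : w ∈ formGen m V) (x : V) :
    CoeffDiff (rep m x.1 w) (chartAt E x.1 x.1) := fun I =>
  ((coeff_rep m x.1 hw I).contDiffAt ((isOpen_chartDom m x.1 V).mem_nhds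
    (mem_chartDom m x.2))).differentiableAt (by simp)

/-- At the base point of a preferred chart the pullback is the identity. -/
theorem chartPull_self (x : M) (a : Lam m) : chartPull m x (chartAt E x x) a = a := by
  have h2 : MDifferentiableAt (𝓡 m) (𝓡 m) (chartAt E x).symm (chartAt E x x) :=
    ((contMDiffOn_chart_symm (I := 𝓡 m) (x := x) (n := ∞)).contMDiffAt
      ((chartAt E x).open_target.mem_nhds (mem_chart_target _ x))).mdifferentiableAt (by simp)
  have h3 : fderiv ℝ (chartAt E x ∘ (chartAt E x).symm) (chartAt E x x)
      = ContinuousLinearMap.id ℝ E := by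
    rw [← fderiv_id (𝕜 := ℝ) (x := chartAt E x x)]
    refine Filter.EventuallyEq.fderiv_eq ?_
    filter_upwards [(chartAt E x).open_target.mem_nhds (mem_chart_target _ x)] with y hy
    exact (chartAt E x).right_inv hy
  have h4 : (mfderiv (𝓡 m) (𝓡 m) (chartAt E x).symm (chartAt E x x) : E →L[ℝ] E)
      = ContinuousLinearMap.id ℝ E := by
    rw [← h3]
    simp only [mfderiv, h2, writtenInExtChartAt]
    simp [mfld_simps]
    simp only [chartAt_self_eq]
    rfl
  have h : precomp (ContinuousLinearMap.id ℝ E) = (LinearMap.id : Cot m →ₗ[ℝ] Cot m) := rfl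
  rw [chartPull, show precomp (mfderiv (𝓡 m) (𝓡 m) (chartAt E x).symm (chartAt E x x)) =
    (LinearMap.id : Cot m →ₗ[ℝ] Cot m) from (congrArg precomp h4).trans h, ExteriorAlgebra.map_id]
  rfl

theorem rep_self {U : Opens M} (w : U → Lam m) (x : U) :
    rep m x.1 w (chartAt E x.1 x.1) = w x := by
  rw [rep_of_mem m x.1 w (mem_chartDom m x.2), chartPull_self]
  congr 1
  exact Subtype.ext ((chartAt E x.1).left_inv (mem_chart_source _ _))

variable {m} in
/-- Pointwise grade involution. -/
def invF {U : Opens M} : (U → Lam m) →ₐ[ℝ] (U → Lam m) :=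
  AlgHom.pi fun x => inv.comp (Pi.evalAlgHom ℝ _ x)

theorem formD_add {V : Opens M} {a b : V → Lam m} (ha : a ∈ formGen m V) (hb : b ∈ formGen m V) :
    formD m (a + b) = formD m a + formD m b := by
  ext x
  rw [Pi.add_apply, formD, formD, formD, ← flatD_add (coeffDiff_rep m ha x) (coeffDiff_rep m hb x)]
  refine flatD_congr ?_
  filter_upwards [(isOpen_chartDom m x.1 V).mem_nhds (mem_chartDom m x.2)] with y hy
  simp [rep_of_mem m x.1 _ hy]

theorem formD_mul {V : Opens M} {a b : V → Lam m} (ha : a ∈ formGen m V) (hb : b ∈ formGen m V) :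
    formD m (a * b) = formD m a * b + invF a * formD m b := by
  ext x
  have := flatD_mul (coeffDiff_rep m ha x) (coeffDiff_rep m hb x)
  rw [rep_self, rep_self] at this
  refine Eq.trans (flatD_congr ?_) this
  filter_upwards [(isOpen_chartDom m x.1 V).mem_nhds (mem_chartDom m x.2)] with y hy
  simp [rep_of_mem m x.1 _ hy]

theorem chartPull_inv (x : M) (y : E) (a : Lam m) :
    chartPull m x y (inv a) = inv (chartPull m x y a) := by
  have : (chartPull m x y).comp inv = inv.comp (chartPull m x y) := by
    refine ExteriorAlgebra.hom_ext (LinearMap.ext fun ℓ => ?_)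
    simp [chartPull, ExteriorAlgebra.map_apply_ι]
  exact DFunLike.congr_fun this a

theorem formD_inv {V : Opens M} {a : V → Lam m} (ha : a ∈ formGen m V) :
    formD m (invF a) = - invF (formD m a) := by
  ext x
  refine Eq.trans (flatD_congr ?_) (flatD_inv (coeffDiff_rep m ha x))
  filter_upwards [(isOpen_chartDom m x.1 V).mem_nhds (mem_chartDom m x.2)] with y hy
  rw [rep_of_mem m x.1 _ hy, rep_of_mem m x.1 _ hy, ← chartPull_inv]
  rfl

theorem formD_fun {V : Opens M} {f : M → ℝ} (hf : ContMDiffOn (𝓡 m) 𝓘(ℝ, ℝ) ∞ f V) :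
    formD m (fun x : V => algebraMap ℝ (Lam m) (f x))
      = fun x : V => ExteriorAlgebra.ι ℝ (dAt m f x) := by
  ext x
  have hd := ((contDiffOn_chart m x.1 hf).contDiffAt ((isOpen_chartDom m x.1 V).mem_nhds
    (mem_chartDom m x.2))).differentiableAt (by simp)
  have h1 := chartPull_dAt m x.1 hf (mem_chartDom m x.2)
  rw [chartPull_self, (chartAt E x.1).left_inv (mem_chart_source _ _)] at h1
  rw [h1, formD, flatD_sum {()} (fun _ => f ∘ (chartAt E x.1).symm) (fun _ => 1) _ _
    (fun _ _ => hd)]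
  · simp
  · filter_upwards [(isOpen_chartDom m x.1 V).mem_nhds (mem_chartDom m x.2)] with y hy
    simp [rep_of_mem m x.1 _ hy, Algebra.algebraMap_eq_smul_one]

theorem formD_dAt {V : Opens M} {f : M → ℝ} (hf : ContMDiffOn (𝓡 m) 𝓘(ℝ, ℝ) ∞ f V) :
    formD m (fun x : V => ExteriorAlgebra.ι ℝ (dAt m f x)) = 0 := by
  ext x
  have hd := ((contDiffOn_chart m x.1 hf).contDiffAt ((isOpen_chartDom m x.1 V).mem_nhds
    (mem_chartDom m x.2))).of_le (m := 2) (WithTop.coe_le_coe.2 (le_top : (2 : ℕ∞) ≤ ⊤))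
  refine Eq.trans (flatD_congr ?_) (flatD_fderiv hd)
  filter_upwards [(isOpen_chartDom m x.1 V).mem_nhds (mem_chartDom m x.2)] with y hy
  rw [rep_of_mem m x.1 _ hy, chartPull_dAt m x.1 hf hy]

theorem formD_algebraMap {V : Opens M} (r : ℝ) :
    formD m (algebraMap ℝ (V → Lam m) r) = 0 := by
  have := formD_fun m (V := V) (f := fun _ => r) contMDiffOn_const
  refine this.trans ?_
  ext x
  simp only [dAt, mfderiv_const]
  exact map_zero _

theorem invF_mem {V : Opens M} {a : V → Lam m} (ha : a ∈ formGen m V) : invF a ∈ formGen m V := by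
  have : formGen m V ≤ (formGen m V).comap invF := by
    refine Algebra.adjoin_le ?_
    rintro _ ⟨f, hf, rfl | rfl⟩
    · have : invF (fun x : V => algebraMap ℝ (Lam m) (f x)) = fun x : V => algebraMap ℝ (Lam m) (f x) := by
        ext x; simp [invF]
      rw [SetLike.mem_coe, Subalgebra.mem_comap, this]
      exact Algebra.subset_adjoin ⟨f, hf, Or.inl rfl⟩
    · have : invF (fun x : V => ExteriorAlgebra.ι ℝ (dAt m f x))
          = - fun x : V => ExteriorAlgebra.ι ℝ (dAt m f x) := by
        ext x; exact inv_ι _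
      rw [SetLike.mem_coe, Subalgebra.mem_comap, this]
      exact neg_mem (Algebra.subset_adjoin ⟨f, hf, Or.inr rfl⟩)
  exact this ha

theorem formD_gen {V : Opens M} {a : V → Lam m} (ha : a ∈ formGen m V) :
    formD m a ∈ formGen m V ∧ formD m (formD m a) = 0 := by
  induction ha using Algebra.adjoin_induction with
  | mem w h =>
    obtain ⟨f, hf, rfl | rfl⟩ := h
    · rw [formD_fun m hf]
      exact ⟨Algebra.subset_adjoin ⟨f, hf, Or.inr rfl⟩, formD_dAt m hf⟩
    · rw [formD_dAt m hf]
      exact ⟨zero_mem _, by simpa using formD_algebraMap m (V := V) 0⟩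
  | algebraMap r =>
    rw [formD_algebraMap]
    exact ⟨zero_mem _, by simpa using formD_algebraMap m (V := V) 0⟩
  | add a b ha hb iha ihb =>
    rw [formD_add m ha hb]
    refine ⟨add_mem iha.1 ihb.1, ?_⟩
    rw [formD_add m iha.1 ihb.1, iha.2, ihb.2, add_zero]
  | mul a b ha hb iha ihb =>
    rw [formD_mul m ha hb]
    have hia := invF_mem m ha
    refine ⟨add_mem (mul_mem iha.1 hb) (mul_mem hia ihb.1), ?_⟩
    rw [formD_add m (mul_mem iha.1 hb) (mul_mem hia ihb.1), formD_mul m iha.1 hb,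
      formD_mul m hia ihb.1, iha.2, ihb.2, formD_inv m ha]
    simp

/-- Pointwise projection to forms of degree `k`. -/
def projF {U : Opens M} (k : ℕ) : (U → Lam m) →ₗ[ℝ] (U → Lam m) :=
  LinearMap.pi fun x => gradeProj k ∘ₗ LinearMap.proj x

theorem projF_hom {V : Opens M} {a : V → Lam m} {l : ℕ} (h : ∀ x, a x ∈ ⋀[ℝ]^l (Cot m)) (k : ℕ) :
    projF m k a = if l = k then a else 0 := by
  ext x
  split_ifs with hk
  · subst hk; exact gradeProj_of_mem (h x)
  · exact gradeProj_of_ne (h x) hk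

theorem algebraMap_mem_zero (r : ℝ) : algebraMap ℝ (Lam m) r ∈ ⋀[ℝ]^0 (Cot m) := by
  rw [ExteriorAlgebra.exteriorPower, pow_zero]; exact Submodule.algebraMap_mem r

theorem projF_mem {V : Opens M} {a : V → Lam m} (ha : a ∈ formGen m V) (k : ℕ) :
    projF m k a ∈ formGen m V := by
  induction ha using Algebra.adjoin_induction generalizing k with
  | mem w h =>
    obtain ⟨f, hf, rfl | rfl⟩ := h
    · rw [projF_hom m (l := 0) (fun x => algebraMap_mem_zero m _)]
      split_ifs
      · exact Algebra.subset_adjoin ⟨f, hf, Or.inl rfl⟩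
      · exact zero_mem _
    · rw [projF_hom m (l := 1) (fun x => ι_mem _)]
      split_ifs
      · exact Algebra.subset_adjoin ⟨f, hf, Or.inr rfl⟩
      · exact zero_mem _
  | algebraMap r =>
    rw [projF_hom m (a := algebraMap ℝ (V → Lam m) r) (l := 0)
      (fun x => algebraMap_mem_zero m r)]
    split_ifs
    · exact Subalgebra.algebraMap_mem _ r
    · exact zero_mem _
  | add a b ha hb iha ihb => rw [map_add]; exact add_mem (iha k) (ihb k)
  | mul a b ha hb iha ihb =>
    have : projF m k (a * b) = ∑ i ∈ Finset.range (m + 1), ∑ j ∈ Finset.range (m + 1),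
      if i + j = k then projF m i a * projF m j b else 0 := by
      ext x
      simp only [Finset.sum_apply]
      refine (gradeProj_mul k (a x) (b x)).trans ?_
      refine Finset.sum_congr rfl fun i _ => Finset.sum_congr rfl fun j _ => ?_
      split_ifs <;> rfl
    rw [this]
    refine sum_mem fun i _ => sum_mem fun j _ => ?_
    split_ifs
    · exact mul_mem (iha i) (ihb j)
    · exact zero_mem _

end manifold

/-- A topological space with a sheaf of graded-commutative `ℝ`-algebras, graded by `ℕ`. The sheaf
condition is that of sheaves of graded algebras: homogeneous sections of equal degree glue. -/
structure GradedSpace where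
  /-- the body -/
  carrier : Type u
  [top : TopologicalSpace carrier]
  /-- the functions on an open set -/
  fn : Opens carrier → Type u
  [ring : ∀ U, Ring (fn U)]
  [algebra : ∀ U, Algebra ℝ (fn U)]
  /-- the functions of a given degree -/
  deg : ∀ U, ℕ → Submodule ℝ (fn U)
  one_mem : ∀ U, (1 : fn U) ∈ deg U 0
  mul_mem : ∀ {U i j} {a b : fn U}, a ∈ deg U i → b ∈ deg U j → a * b ∈ deg U (i + j)
  isInternal : ∀ U, DirectSum.IsInternal (deg U)
  graded_comm : ∀ {U i j} {a b : fn U}, a ∈ deg U i → b ∈ deg U j →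
    a * b = (-1 : ℝ) ^ (i * j) • (b * a)
  /-- restriction -/
  res : ∀ {U V : Opens carrier}, U ≤ V → fn V →ₐ[ℝ] fn U
  res_mem : ∀ {U V : Opens carrier} (h : U ≤ V) {k} {a : fn V}, a ∈ deg V k → res h a ∈ deg U k
  res_self : ∀ {U : Opens carrier} (a : fn U), res le_rfl a = a
  res_res : ∀ {U V W : Opens carrier} (h : U ≤ V) (h' : V ≤ W) (a : fn W),
    res h (res h' a) = res (h.trans h') a
  glue : ∀ {ι : Type u} (k : ℕ) (V : Opens carrier) (U : ι → Opens carrier)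
    (hU : ∀ i, U i ≤ V), (∀ x ∈ V, ∃ i, x ∈ U i) → ∀ s : ∀ i, fn (U i),
    (∀ i, s i ∈ deg (U i) k) →
    (∀ i j (W : Opens carrier) (hi : W ≤ U i) (hj : W ≤ U j), res hi (s i) = res hj (s j)) →
    ∃! t, t ∈ deg V k ∧ ∀ i, res (hU i) t = s i

attribute [instance] GradedSpace.top GradedSpace.ring GradedSpace.algebra

/-- The exponents `μ` of the monomials `ξ^μ` in graded-commuting variables `ξ_j` of degree `d_j`
(variables of odd degree square to zero). -/
abbrev MonoExp {q : ℕ} (d : Fin q → ℕ) : Type := {μ : Fin q → ℕ // ∀ j, Odd (d j) → μ j ≤ 1}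

/-- The monomial `ξ_1^{μ_1} ⋯ ξ_q^{μ_q}`. -/
def monomial {R : Type*} [Ring R] {q : ℕ} (ξ : Fin q → R) (μ : Fin q → ℕ) : R :=
  ((List.finRange q).map fun j => ξ j ^ μ j).prod

/-- Local coordinates on an open set `U` of the body: a chart of the body that identifies the
functions of degree `0` with the smooth functions, and finitely many homogeneous functions `ξ_j` of
positive degree, such that over every open `V ⊆ U` the algebra of functions is the free
graded-commutative algebra in the `ξ_j` over the functions of degree `0`. That is, over `U` the
space is a domain of `ℝ^p` with the sheaf `C^∞ ⊗ S(ξ_1, …, ξ_q)`. -/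
structure LocalCoords (X : GradedSpace.{u}) (U : Opens X.carrier) where
  /-- the number of coordinates of degree `0` -/
  p : ℕ
  chart : OpenPartialHomeomorph X.carrier (EuclideanSpace ℝ (Fin p))
  source_eq : chart.source = U
  /-- the value of a function at the points of the body -/
  val : ∀ V : Opens X.carrier, V ≤ U → X.fn V →ₐ[ℝ] (V → ℝ)
  val_res : ∀ (V W : Opens X.carrier) (hV : V ≤ U) (hW : W ≤ V) (a : X.fn V) (x : W),
    val W (hW.trans hV) (X.res hW a) x = val V hV a ⟨x, hW x.2⟩
  val_inj : ∀ (V : Opens X.carrier) (hV : V ≤ U) (a : X.fn V),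
    a ∈ X.deg V 0 → val V hV a = 0 → a = 0
  val_range : ∀ (V : Opens X.carrier) (hV : V ≤ U) (g : X.carrier → ℝ),
    (∃ a ∈ X.deg V 0, val V hV a = fun x : V => g x) ↔
      ContDiffOn ℝ ∞ (g ∘ chart.symm) (chart '' V)
  /-- the number of coordinates of positive degree -/
  q : ℕ
  /-- their degrees -/
  d : Fin q → ℕ
  d_pos : ∀ j, 0 < d j
  ξ : Fin q → X.fn U
  ξ_mem : ∀ j, ξ j ∈ X.deg U (d j)
  expand : ∀ (V : Opens X.carrier) (hV : V ≤ U) (a : X.fn V),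
    ∃! c : MonoExp d →₀ X.fn V, (∀ μ, c μ ∈ X.deg V 0) ∧
      a = c.sum fun μ f => f * X.res hV (monomial ξ μ)

/-- An N-manifold (non-negatively graded supermanifold), given by its body `0 · X` and the sheaf of
finite sums of homogeneous functions on it (`f` has degree `k` if `f(λ · x) = λ^k f(x)` for the
action of `(ℝ, ×)`). The body is Hausdorff and second countable, and locally the space is a domain
of `ℝ^p` with the sheaf of graded-commutative algebras freely generated over `C^∞` by finitely many
variables of positive degree. The parity of a homogeneous function is that of its degree. -/
structure NManifold extends GradedSpace.{u} where
  [t2 : T2Space carrier]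
  [secondCountable : SecondCountableTopology carrier]
  locally_model : ∀ x : carrier, ∃ U : Opens carrier, x ∈ U ∧
    Nonempty (LocalCoords toGradedSpace U)

/-- An NQ-manifold: an N-manifold with a vector field `Q` of degree `1` and square `0`. -/
structure NQManifold extends NManifold.{u} where
  Q : ∀ U : Opens carrier, fn U →ₗ[ℝ] fn U
  Q_mem : ∀ {U k} {a : fn U}, a ∈ deg U k → Q U a ∈ deg U (k + 1)
  Q_mul : ∀ {U k} {a : fn U}, a ∈ deg U k → ∀ b : fn U,
    Q U (a * b) = Q U a * b + (-1 : ℝ) ^ k • (a * Q U b)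
  Q_res : ∀ {U V : Opens carrier} (h : U ≤ V) (a : fn V), Q U (res h a) = res h (Q V a)
  Q_Q : ∀ {U} (a : fn U), Q U (Q U a) = 0

/-- An N-map: a map of spaces with sheaves of graded algebras. -/
structure NMap (X Y : NManifold.{u}) where
  base : C(X.carrier, Y.carrier)
  /-- pullback of functions -/
  pull : ∀ V : Opens Y.carrier, Y.fn V →ₐ[ℝ] X.fn (Opens.comap base V)
  pull_mem : ∀ {V k} {a : Y.fn V}, a ∈ Y.deg V k → pull V a ∈ X.deg (Opens.comap base V) k
  pull_res : ∀ {V W : Opens Y.carrier} (h : V ≤ W) (a : Y.fn W),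
    pull V (Y.res h a) = X.res (Opens.comap_mono base h) (pull W a)

namespace NMap

/-- The identity. -/
def id (X : NManifold.{u}) : NMap X X where
  base := .id _
  pull V := AlgHom.id ℝ (X.fn V)
  pull_mem h := h
  pull_res _ _ := rfl

variable {X Y Z : NManifold.{u}}

/-- The composition `ψ ∘ φ`. -/
def comp (ψ : NMap Y Z) (φ : NMap X Y) : NMap X Z where
  base := ψ.base.comp φ.base
  pull V := (φ.pull (Opens.comap ψ.base V)).comp (ψ.pull V)
  pull_mem h := φ.pull_mem (ψ.pull_mem h)
  pull_res h a := (congrArg (φ.pull _) (ψ.pull_res h a)).trans (φ.pull_res _ _)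

/-- The pullback to `X` of a function defined on an open set that contains the image of `X`. -/
def pullTop (φ : NMap X Y) {W : Opens Y.carrier} (h : ∀ x, φ.base x ∈ W) :
    Y.fn W →ₐ[ℝ] X.fn ⊤ :=
  (X.res (fun x _ => h x)).comp (φ.pull W)

end NMap

/-- NQ-maps: N-maps that intertwine the vector fields `Q`. -/
def IsNQMap {X Y : NQManifold.{u}} (φ : NMap X.toNManifold Y.toNManifold) : Prop :=
  ∀ (V : Opens Y.carrier) (a : Y.fn V), φ.pull V (Y.Q V a) = X.Q _ (φ.pull V a)

/-- The additive group of N-maps `S → ℝ[n]`. As `ℝ[n]` has one coordinate, of degree `n`, an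
N-map into it is the same as a function of degree `n` (the pullback of the coordinate), and the
group law of `ℝ[n]` is the addition. Since `Q = 0` on `ℝ[n]`, the NQ-maps are the `f` with
`Q f = 0`. -/
abbrev MapToR (n : ℕ) (S : NManifold.{u}) : Type u := S.deg ⊤ n

/-- Composition of an N-map `T → S` with an N-map `S → ℝ[n]`. -/
def MapToR.comp {n : ℕ} {S T : NManifold.{u}} (f : MapToR n S) (ψ : NMap T S) : MapToR n T :=
  ⟨ψ.pullTop (W := ⊤) (fun _ => trivial) f.1, T.res_mem _ (ψ.pull_mem f.2)⟩

/-- A space `X → B` over the NQ-manifold `B` with an action of the group `ℝ[n]`, in the category of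
NQ-manifolds. The action `ℝ[n] × X → X` is given by its effect on `S`-points for N-manifolds `S`
(for NQ-manifolds `S` it has to preserve NQ-maps). -/
structure RnSpace (n : ℕ) (B : NQManifold.{u}) where
  total : NQManifold.{u}
  proj : NMap total.toNManifold B.toNManifold
  proj_nq : IsNQMap proj
  act : ∀ {S : NManifold.{u}}, MapToR n S → NMap S total.toNManifold → NMap S total.toNManifold
  act_natural : ∀ {S T : NManifold.{u}} (ψ : NMap T S) (f : MapToR n S)
    (φ : NMap S total.toNManifold), (act f φ).comp ψ = act (f.comp ψ) (φ.comp ψ)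
  act_zero : ∀ {S : NManifold.{u}} (φ : NMap S total.toNManifold), act 0 φ = φ
  act_add : ∀ {S : NManifold.{u}} (f g : MapToR n S) (φ : NMap S total.toNManifold),
    act (f + g) φ = act f (act g φ)
  act_nq : ∀ {S : NQManifold.{u}} (f : MapToR n S.toNManifold)
    (φ : NMap S.toNManifold total.toNManifold),
    S.Q ⊤ f.1 = 0 → IsNQMap φ → IsNQMap (act f φ)
  proj_act : ∀ {S : NManifold.{u}} (f : MapToR n S) (φ : NMap S total.toNManifold),
    proj.comp (act f φ) = proj.comp φ

/-- The part of the total space over an open set of the base. -/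
def RnSpace.over {n : ℕ} {B : NQManifold.{u}} (P : RnSpace n B) (U : Opens B.carrier) :
    Opens P.total.carrier := Opens.comap P.proj.base U

/-- `ξ`, a function of degree `n` on the part of `P` over `U`, i.e. an N-map from there to `ℝ[n]`,
is the fibre coordinate of an N-trivialization over `U`: it is equivariant, and together with the
projection it identifies the part of `P` over `U` with `U × ℝ[n]`. -/
structure RnSpace.IsTriv {n : ℕ} {B : NQManifold.{u}} (P : RnSpace n B) (U : Opens B.carrier)
    (ξ : P.total.fn (P.over U)) : Prop where
  mem : ξ ∈ P.total.deg (P.over U) n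
  equivariant : ∀ (S : NManifold.{u}) (φ : NMap S P.total.toNManifold) (f : MapToR n S)
    (h : ∀ s, φ.base s ∈ P.over U) (h' : ∀ s, (P.act f φ).base s ∈ P.over U),
    (P.act f φ).pullTop h' ξ = f + φ.pullTop h ξ
  bijective : ∀ (S : NManifold.{u}) (φ₀ : NMap S B.toNManifold), (∀ s, φ₀.base s ∈ U) →
    ∀ f : MapToR n S, ∃! φ : NMap S P.total.toNManifold,
      P.proj.comp φ = φ₀ ∧ ∃ h : ∀ s, φ.base s ∈ P.over U, φ.pullTop h ξ = f

/-- A principal `ℝ[n]`-bundle over `B` in the category of NQ-manifolds. -/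
structure PrincipalBundle (n : ℕ) (B : NQManifold.{u}) extends RnSpace n B where
  locally_trivial : ∀ x : B.carrier, ∃ U : Opens B.carrier, x ∈ U ∧ ∃ ξ, toRnSpace.IsTriv U ξ

/-- Isomorphisms of principal `ℝ[n]`-bundles over `B` in the category of NQ-manifolds. -/
structure BundleIso {n : ℕ} {B : NQManifold.{u}} (P P' : PrincipalBundle n B) where
  hom : NMap P.total.toNManifold P'.total.toNManifold
  inv : NMap P'.total.toNManifold P.total.toNManifold
  hom_inv : inv.comp hom = NMap.id _
  inv_hom : hom.comp inv = NMap.id _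
  hom_nq : IsNQMap hom
  inv_nq : IsNQMap inv
  over_base : P'.proj.comp hom = P.proj
  equivariant : ∀ {S : NManifold.{u}} (f : MapToR n S) (φ : NMap S P.total.toNManifold),
    hom.comp (P.act f φ) = P'.act f (hom.comp φ)

theorem NMap.comp_assoc {W X Y Z : NManifold.{u}} (χ : NMap Y Z) (ψ : NMap X Y) (φ : NMap W X) :
    (χ.comp ψ).comp φ = χ.comp (ψ.comp φ) := rfl

theorem NMap.comp_id {X Y : NManifold.{u}} (φ : NMap X Y) : φ.comp (NMap.id X) = φ := rfl

theorem NMap.id_comp {X Y : NManifold.{u}} (φ : NMap X Y) : (NMap.id Y).comp φ = φ := rfl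

theorem IsNQMap.id (X : NQManifold.{u}) : IsNQMap (X := X) (Y := X) (NMap.id X.toNManifold) :=
  fun _ _ => rfl

theorem IsNQMap.comp {X Y Z : NQManifold.{u}} {ψ : NMap Y.toNManifold Z.toNManifold}
    {φ : NMap X.toNManifold Y.toNManifold} (hψ : IsNQMap ψ) (hφ : IsNQMap φ) :
    IsNQMap (X := X) (Y := Z) (ψ.comp φ) := fun V a =>
  (congrArg (φ.pull _) (hψ V a)).trans (hφ _ _)

/-- Isomorphism is an equivalence relation on principal bundles. -/
instance bundleSetoid (n : ℕ) (B : NQManifold.{u}) : Setoid (PrincipalBundle n B) where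
  r P P' := Nonempty (BundleIso P P')
  iseqv :=
    { refl := fun P => ⟨⟨NMap.id _, NMap.id _, rfl, rfl, IsNQMap.id _, IsNQMap.id _, rfl,
        fun _ _ => rfl⟩⟩
      symm := by
        rintro P P' ⟨e⟩
        refine ⟨⟨e.inv, e.hom, e.inv_hom, e.hom_inv, e.inv_nq, e.hom_nq, ?_, ?_⟩⟩
        · rw [← e.over_base, NMap.comp_assoc, e.inv_hom, NMap.comp_id]
        · intro S f φ
          have := e.equivariant f (e.inv.comp φ)
          rw [← NMap.comp_assoc e.hom, e.inv_hom, NMap.id_comp] at this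
          rw [← this, ← NMap.comp_assoc, e.hom_inv, NMap.id_comp]
      trans := by
        rintro P P' P'' ⟨e⟩ ⟨e'⟩
        refine ⟨⟨e'.hom.comp e.hom, e.inv.comp e'.inv, ?_, ?_, e'.hom_nq.comp e.hom_nq,
          e.inv_nq.comp e'.inv_nq, ?_, ?_⟩⟩
        · rw [NMap.comp_assoc, ← NMap.comp_assoc e'.inv, e'.hom_inv, NMap.id_comp, e.hom_inv]
        · rw [NMap.comp_assoc, ← NMap.comp_assoc e.hom, e.inv_hom, NMap.id_comp, e'.inv_hom]
        · rw [← NMap.comp_assoc, e'.over_base, e.over_base]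
        · intro S f φ
          rw [NMap.comp_assoc, e.equivariant, e'.equivariant, NMap.comp_assoc] }

section T1
variable (m : ℕ) {M : Type u} [TopologicalSpace M] [ChartedSpace (EuclideanSpace ℝ (Fin m)) M]
local notation "E" => EuclideanSpace ℝ (Fin m)

theorem restr_form {U V : Opens M} (h : U ≤ V) {w : V → Lam m} (hw : w ∈ Form m V) :
    restr h w ∈ Form m U := by
  intro x hx
  obtain ⟨W, hW, hxW, h1⟩ := hw x (h hx)
  exact ⟨W ⊓ U, inf_le_right, ⟨hxW, hx⟩, restr_formGen m inf_le_left h1⟩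

theorem form_of_gen {V : Opens M} {w : V → Lam m} (hw : w ∈ formGen m V) : w ∈ Form m V :=
  fun _ hx => ⟨V, le_rfl, hx, hw⟩

/-- Restriction of forms. -/
def formRes {U V : Opens M} (h : U ≤ V) : Form m V →ₐ[ℝ] Form m U :=
  ((restr h).comp (Form m V).val).codRestrict _ fun w => restr_form m h w.2

/-- The forms of degree `k`. -/
def formDeg (U : Opens M) (k : ℕ) : Submodule ℝ (Form m U) where
  carrier := {w | ∀ x, w.1 x ∈ ⋀[ℝ]^k (Cot m)}
  add_mem' ha hb x := add_mem (ha x) (hb x)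
  zero_mem' _ := zero_mem _
  smul_mem' r _ ha x := Submodule.smul_mem _ r (ha x)

theorem form_glue {ι : Type*} (V : Opens M) (U : ι → Opens M)
    (hU : ∀ i, U i ≤ V) (hc : ∀ x ∈ V, ∃ i, x ∈ U i) (s : ∀ i, Form m (U i))
    (hs : ∀ i j (W : Opens M) (hi : W ≤ U i) (hj : W ≤ U j),
      formRes m hi (s i) = formRes m hj (s j)) :
    ∃ t : Form m V, ∀ i, formRes m (hU i) t = s i := by
  choose i hi using fun x : V => hc x.1 x.2
  have key : ∀ (x : V) (j) (hj : x.1 ∈ U j), (s (i x)).1 ⟨x.1, hi x⟩ = (s j).1 ⟨x.1, hj⟩ := by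
    intro x j hj
    have := hs (i x) j (U (i x) ⊓ U j) inf_le_left inf_le_right
    exact congrFun (congrArg Subtype.val this) ⟨x.1, hi x, hj⟩
  have hr : ∀ j, restr (hU j) (fun x : V => (s (i x)).1 ⟨x.1, hi x⟩) = (s j).1 := by
    intro j; ext x; exact key ⟨x.1, hU j x.2⟩ j x.2
  refine ⟨⟨fun x => (s (i x)).1 ⟨x.1, hi x⟩, ?_⟩, fun j => Subtype.ext (hr j)⟩
  intro x hx
  obtain ⟨j, hj⟩ := hc x hx
  obtain ⟨W, hW, hxW, h1⟩ := (s j).2 x hj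
  refine ⟨W, hW.trans (hU j), hxW, ?_⟩
  rw [← hr j] at h1
  exact h1

variable [IsManifold (𝓡 m) ∞ M]

theorem projF_form {U : Opens M} {w : U → Lam m} (hw : w ∈ Form m U) (k : ℕ) :
    projF m k w ∈ Form m U := by
  intro x hx
  obtain ⟨W, hW, hxW, h1⟩ := hw x hx
  exact ⟨W, hW, hxW, projF_mem m h1 k⟩

theorem form_isInternal (U : Opens M) : DirectSum.IsInternal (formDeg m U) := by
  rw [DirectSum.isInternal_submodule_iff_iSupIndep_and_iSup_eq_top]
  constructor
  · intro k
    rw [Submodule.disjoint_def]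
    intro w hw hw'
    have hle : ⨆ j, ⨆ (_ : j ≠ k), formDeg m U j
        ≤ LinearMap.ker (projF m k ∘ₗ (Form m U).val.toLinearMap) := by
      refine iSup₂_le fun j hj a ha => ?_
      exact (projF_hom m (a := a.1) ha k).trans (if_neg hj)
    have h0 : projF m k w.1 = 0 := hle hw'
    rw [projF_hom m hw, if_pos rfl] at h0
    exact Subtype.ext h0
  · rw [eq_top_iff]
    intro w _
    have : w = ∑ k ∈ Finset.range (m + 1), (⟨projF m k w.1, projF_form m w.2 k⟩ : Form m U) := by
      refine Subtype.ext ?_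
      rw [AddSubmonoidClass.coe_finsetSum]
      ext x
      rw [Finset.sum_apply]
      exact (sum_gradeProj (w.1 x)).symm
    rw [this]
    refine sum_mem fun k _ => Submodule.mem_iSup_of_mem k ?_
    exact fun x => gradeProj_mem k _

theorem formD_form {U : Opens M} {w : U → Lam m} (hw : w ∈ Form m U) : formD m w ∈ Form m U := by
  intro x hx
  obtain ⟨W, hW, hxW, h1⟩ := hw x hx
  refine ⟨W, hW, hxW, ?_⟩
  rw [← formD_restr]
  exact (formD_gen m h1).1

theorem restr_formD_apply {U V : Opens M} (h : V ≤ U) (w : U → Lam m) {x : M} (hx : x ∈ V) :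
    formD m w ⟨x, h hx⟩ = formD m (restr h w) ⟨x, hx⟩ := by
  rw [formD_restr]; rfl

theorem formD_form_add {U : Opens M} {a b : U → Lam m} (ha : a ∈ Form m U) (hb : b ∈ Form m U) :
    formD m (a + b) = formD m a + formD m b := by
  ext ⟨x, hx⟩
  obtain ⟨V, hV, hxV, h1⟩ := ha x hx
  obtain ⟨W, hW, hxW, h2⟩ := hb x hx
  have h : V ⊓ W ≤ U := inf_le_left.trans hV
  have hx' : x ∈ V ⊓ W := ⟨hxV, hxW⟩
  rw [Pi.add_apply, restr_formD_apply m h _ hx', restr_formD_apply m h _ hx',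
    restr_formD_apply m h _ hx', map_add]
  have h1' : restr h a ∈ formGen m (V ⊓ W) := restr_formGen m inf_le_left h1
  have h2' : restr h b ∈ formGen m (V ⊓ W) := restr_formGen m inf_le_right h2
  rw [formD_add m h1' h2']
  rfl

theorem formD_form_mul {U : Opens M} {a b : U → Lam m} (ha : a ∈ Form m U) (hb : b ∈ Form m U) :
    formD m (a * b) = formD m a * b + invF a * formD m b := by
  ext ⟨x, hx⟩
  obtain ⟨V, hV, hxV, h1⟩ := ha x hx
  obtain ⟨W, hW, hxW, h2⟩ := hb x hx
  have h : V ⊓ W ≤ U := inf_le_left.trans hV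
  have hx' : x ∈ V ⊓ W := ⟨hxV, hxW⟩
  rw [Pi.add_apply, Pi.mul_apply, Pi.mul_apply, restr_formD_apply m h _ hx',
    restr_formD_apply m h _ hx', restr_formD_apply m h _ hx', map_mul]
  have h1' : restr h a ∈ formGen m (V ⊓ W) := restr_formGen m inf_le_left h1
  have h2' : restr h b ∈ formGen m (V ⊓ W) := restr_formGen m inf_le_right h2
  rw [formD_mul m h1' h2']
  rfl

theorem formD_formD {U : Opens M} {a : U → Lam m} (ha : a ∈ Form m U) :
    formD m (formD m a) = 0 := by
  ext ⟨x, hx⟩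
  obtain ⟨V, hV, hxV, h1⟩ := ha x hx
  rw [restr_formD_apply m hV _ hxV, ← formD_restr, (formD_gen m h1).2]
  rfl

theorem chartPull_mem {k : ℕ} (x : M) (y : E) {a : Lam m} (ha : a ∈ ⋀[ℝ]^k (Cot m)) :
    chartPull m x y a ∈ ⋀[ℝ]^k (Cot m) := by
  induction ha using Submodule.pow_induction_on_left' with
  | algebraMap r => rw [AlgHom.commutes]; exact algebraMap_mem_zero m r
  | add a b i _ _ iha ihb => rw [map_add]; exact add_mem iha ihb
  | mem_mul v hv i a _ ih =>
    obtain ⟨v, rfl⟩ := hv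
    rw [map_mul, chartPull, ExteriorAlgebra.map_apply_ι, Nat.succ_eq_add_one, add_comm]
    exact SetLike.mul_mem_graded (A := fun i : ℕ => ⋀[ℝ]^i (Cot m)) (ι_mem _) ih

theorem chartPull_gradeProj (k : ℕ) (x : M) (y : E) (a : Lam m) :
    chartPull m x y (gradeProj k a) = gradeProj k (chartPull m x y a) := by
  induction a using DirectSum.Decomposition.inductionOn (fun i : ℕ => ⋀[ℝ]^i (Cot m)) with
  | zero => simp
  | add a b ha hb => rw [map_add, map_add, ha, hb, map_add, map_add]
  | @homogeneous i a =>
    by_cases h : i = k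
    · subst h; rw [gradeProj_of_mem a.2, gradeProj_of_mem (chartPull_mem m x y a.2)]
    · rw [gradeProj_of_ne a.2 h, gradeProj_of_ne (chartPull_mem m x y a.2) h, map_zero]

theorem formD_projF {U : Opens M} {a : U → Lam m} (ha : a ∈ Form m U) (k : ℕ) :
    formD m (projF m k a) = projF m (k + 1) (formD m a) := by
  ext ⟨x, hx⟩
  obtain ⟨V, hV, hxV, h1⟩ := ha x hx
  rw [restr_formD_apply m hV _ hxV]
  have h2 := flatD_gradeProj k (coeffDiff_rep m h1 ⟨x, hxV⟩)
  have h3 : projF m (k + 1) (formD m a) ⟨x, hx⟩ = gradeProj (k + 1)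
    (formD m (restr hV a) ⟨x, hxV⟩) := by rw [← restr_formD_apply m hV]; rfl
  rw [h3]
  refine Eq.trans (flatD_congr ?_) h2
  filter_upwards [(isOpen_chartDom m x V).mem_nhds (mem_chartDom m hxV)] with y hy
  rw [rep_of_mem m x _ hy, rep_of_mem m x _ hy, ← chartPull_gradeProj]
  rfl

theorem projF_self {U : Opens M} {a : U → Lam m} {k : ℕ} (h : ∀ x, a x ∈ ⋀[ℝ]^k (Cot m)) :
    projF m k a = a := by rw [projF_hom m h, if_pos rfl]

/-- The exterior derivative on forms. -/
def extD (U : Opens M) : Form m U →ₗ[ℝ] Form m U where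
  toFun w := ⟨formD m w.1, formD_form m w.2⟩
  map_add' a b := Subtype.ext (formD_form_add m a.2 b.2)
  map_smul' r a := by
    refine Subtype.ext ?_
    have := formD_form_mul m (Subalgebra.algebraMap_mem (Form m U) r) a.2
    rw [formD_algebraMap, zero_mul, zero_add, AlgHom.commutes, ← Algebra.smul_def,
      ← Algebra.smul_def] at this
    exact this

variable (M) in
/-- The graded space `(M, Ω)`. -/
abbrev formSpace : GradedSpace.{u} where
  carrier := M
  fn U := Form m U
  deg U := formDeg m U
  one_mem U x := by
    have := algebraMap_mem_zero m 1
    rwa [map_one] at this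
  mul_mem ha hb x := SetLike.mul_mem_graded (A := fun i : ℕ => ⋀[ℝ]^i (Cot m)) (ha x) (hb x)
  isInternal U := form_isInternal m U
  graded_comm ha hb := Subtype.ext (funext fun x => comm_of_mem (ha x) (hb x))
  res h := formRes m h
  res_mem h _ _ ha x := ha _
  res_self a := rfl
  res_res h h' a := rfl
  glue k V U hU hc s hs hcomp := by
    obtain ⟨t, ht⟩ := form_glue m V U hU hc s hcomp
    have hval : ∀ (t' : Form m V), (∀ i, formRes m (hU i) t' = s i) → ∀ (x : M) (hx : x ∈ V) i
        (hi : x ∈ U i), t'.1 ⟨x, hx⟩ = (s i).1 ⟨x, hi⟩ := by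
      intro t' h x hx i hi
      rw [← h i]; rfl
    refine ⟨t, ⟨?_, ht⟩, ?_⟩
    · rintro ⟨x, hx⟩
      obtain ⟨i, hi⟩ := hc x hx
      rw [hval t ht x hx i hi]
      exact hs i _
    · rintro t' ⟨-, ht'⟩
      refine Subtype.ext (funext fun ⟨x, hx⟩ => ?_)
      obtain ⟨i, hi⟩ := hc x hx
      rw [hval t ht x hx i hi, hval t' ht' x hx i hi]

theorem monomial_eq_lamBasis (s : Finset (Fin m)) :
    monomial (fun j => ExteriorAlgebra.ι ℝ (cotBasis m j)) (fun j => if j ∈ s then 1 else 0)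
      = lamBasis m s := by
  have hs : (List.finRange m).filter (· ∈ s) = List.ofFn (fun i => s.orderEmbOfFin rfl i) := by
    refine List.SortedLT.eq_of_mem_iff ((List.sortedLT_finRange m).pairwise.filter _).sortedLT
      (List.sortedLT_ofFn_iff.2 (s.orderEmbOfFin rfl).strictMono) fun a => ?_
    have := Set.ext_iff.1 (s.range_orderEmbOfFin rfl) a
    rw [Set.mem_range, Finset.mem_coe] at this
    rw [List.mem_ofFn, this]
    simp [List.mem_finRange]
  rw [lamBasis_apply, ExteriorAlgebra.ιMulti_apply]
  have : (List.ofFn fun i => ExteriorAlgebra.ι ℝ (cotBasis m (s.orderEmbOfFin rfl i)))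
      = ((List.finRange m).filter (· ∈ s)).map (fun j => ExteriorAlgebra.ι ℝ (cotBasis m j)) := by
    rw [hs, List.map_ofFn]; rfl
  rw [this, monomial]
  generalize List.finRange m = l
  induction l with
  | nil => rfl
  | cons a l ih =>
    rw [List.map_cons, List.prod_cons, ih, List.filter_cons]
    by_cases ha : a ∈ s
    · simp [ha]
    · simp [ha]

theorem chartPull_injective (x : M) {y : E} (hy : y ∈ (chartAt E x).target) :
    Function.Injective (chartPull m x y) := by
  obtain ⟨p, hp, rfl⟩ : ∃ p ∈ (chartAt E x).source, chartAt E x p = y :=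
    ⟨(chartAt E x).symm y, (chartAt E x).map_target hy, (chartAt E x).right_inv hy⟩
  have h2 : MDifferentiableAt (𝓡 m) (𝓡 m) (chartAt E x).symm (chartAt E x p) :=
    ((contMDiffOn_chart_symm (I := 𝓡 m) (x := x) (n := ∞)).contMDiffAt
      ((chartAt E x).open_target.mem_nhds hy)).mdifferentiableAt (by simp)
  have h1 : MDifferentiableAt (𝓡 m) (𝓡 m) (chartAt E x) p :=
    ((contMDiffOn_chart (I := 𝓡 m) (x := x) (n := ∞)).contMDiffAt
      ((chartAt E x).open_source.mem_nhds hp)).mdifferentiableAt (by simp)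
  have h3 : mfderiv (𝓡 m) (𝓡 m) ((chartAt E x).symm ∘ chartAt E x) p
      = mfderiv (𝓡 m) (𝓡 m) (_root_.id : M → M) p := by
    refine Filter.EventuallyEq.mfderiv_eq ?_
    filter_upwards [(chartAt E x).open_source.mem_nhds hp] with z hz
    exact (chartAt E x).left_inv hz
  have h5 : ∀ v : E, (mfderiv (𝓡 m) (𝓡 m) (chartAt E x).symm (chartAt E x p) : E →L[ℝ] E)
      ((mfderiv (𝓡 m) (𝓡 m) (chartAt E x) p : E →L[ℝ] E) v) = v := by
    intro v
    have h6 := DFunLike.congr_fun ((mfderiv_comp p h2 h1).symm.trans h3) v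
    rw [mfderiv_id] at h6
    exact h6
  have h4 : (precomp (mfderiv (𝓡 m) (𝓡 m) (chartAt E x) p)) ∘ₗ
      (precomp (mfderiv (𝓡 m) (𝓡 m) (chartAt E x).symm (chartAt E x p)))
        = (LinearMap.id : Cot m →ₗ[ℝ] Cot m) :=
    LinearMap.ext fun ℓ => ContinuousLinearMap.ext fun v => congrArg ℓ (h5 v)
  refine Function.LeftInverse.injective
    (g := ExteriorAlgebra.map (precomp (mfderiv (𝓡 m) (𝓡 m) (chartAt E x) p))) fun a => ?_
  rw [chartPull, ← AlgHom.comp_apply, ExteriorAlgebra.map_comp_map, h4, ExteriorAlgebra.map_id]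
  rfl

/-- The domain of the preferred chart at `x`. -/
def chartOpen (x : M) : Opens M := ⟨(chartAt E x).source, (chartAt E x).open_source⟩

/-- The coordinate functions. -/
def coordFun (x : M) (j : Fin m) : M → ℝ := fun p => chartAt E x p j

theorem coordFun_smooth (x : M) (j : Fin m) :
    ContMDiffOn (𝓡 m) 𝓘(ℝ, ℝ) ∞ (coordFun m x j) (chartOpen m x) := by
  have h : ContMDiff (𝓡 m) 𝓘(ℝ, ℝ) ∞ (fun v : E => v j) :=
    (contMDiff_iff_contDiff).2 (by fun_prop)
  exact h.comp_contMDiffOn contMDiffOn_chart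

/-- The differentials of the coordinate functions, as forms. -/
def coordForm (x : M) (j : Fin m) : Form m (chartOpen m x) :=
  ⟨fun p => ExteriorAlgebra.ι ℝ (dAt m (coordFun m x j) p),
    form_of_gen m (Algebra.subset_adjoin ⟨_, coordFun_smooth m x j, Or.inr rfl⟩)⟩

theorem mem_dom (x : M) {V : Opens M} (hV : V ≤ chartOpen m x) {p : M} (hp : p ∈ V) :
    chartAt E x p ∈ chartDom m x V := by
  have h1 : p ∈ (chartAt E x).source := hV hp
  refine ⟨(chartAt E x).map_source h1, ?_⟩
  show (chartAt E x).symm (chartAt E x p) ∈ V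
  rwa [(chartAt E x).left_inv h1]

theorem rep_chart (x : M) {V : Opens M} (hV : V ≤ chartOpen m x) (w : V → Lam m) (p : V) :
    rep m x w (chartAt E x p.1) = chartPull m x (chartAt E x p.1) (w p) := by
  rw [rep_of_mem m x w (mem_dom m x hV p.2)]
  congr 2
  exact Subtype.ext ((chartAt E x).left_inv (hV p.2))

theorem chartPull_coordForm (x : M) (p : chartOpen m x) (j : Fin m) :
    chartPull m x (chartAt E x p.1) ((coordForm m x j).1 p)
      = ExteriorAlgebra.ι ℝ (cotBasis m j) := by
  have hd := mem_dom m x le_rfl p.2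
  have h1 := chartPull_dAt m x (coordFun_smooth m x j) hd
  rw [(chartAt E x).left_inv p.2] at h1
  refine h1.trans ?_
  congr 1
  have h2 : coordFun m x j ∘ (chartAt E x).symm =ᶠ[nhds (chartAt E x p.1)] cotBasis m j := by
    filter_upwards [(chartAt E x).open_target.mem_nhds hd.1] with y hy
    rw [cotBasis_apply]
    simp [coordFun, (chartAt E x).right_inv hy]
  rw [h2.fderiv_eq]
  exact (cotBasis m j).fderiv

theorem chartPull_monomial (x : M) (p : chartOpen m x) (μ : Fin m → ℕ) :
    chartPull m x (chartAt E x p.1) ((monomial (coordForm m x) μ).1 p)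
      = monomial (fun j => ExteriorAlgebra.ι ℝ (cotBasis m j)) μ := by
  let T : Form m (chartOpen m x) →ₐ[ℝ] Lam m :=
    (chartPull m x (chartAt E x p.1)).comp ((Pi.evalAlgHom ℝ _ p).comp (Form m _).val)
  have : T (monomial (coordForm m x) μ)
      = monomial (fun j => ExteriorAlgebra.ι ℝ (cotBasis m j)) μ := by
    rw [monomial, map_list_prod, List.map_map, monomial]
    congr 2
    ext j
    simp only [Function.comp_apply, map_pow]
    congr 1
    exact chartPull_coordForm m x p j
  exact this

/-- Exponents of square-free monomials. -/
def expEquiv : MonoExp (fun _ : Fin m => 1) ≃ Finset (Fin m) where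
  toFun μ := Finset.univ.filter fun j => μ.1 j = 1
  invFun s := ⟨fun j => if j ∈ s then 1 else 0, fun j _ => by dsimp only; split_ifs <;> simp⟩
  left_inv μ := by
    refine Subtype.ext (funext fun j => ?_)
    have := μ.2 j odd_one
    simp only [Finset.mem_filter, Finset.mem_univ, true_and]
    split_ifs <;> omega
  right_inv s := by ext j; simp

/-- The value of a form at the points of the body: its part of degree `0`. -/
def formVal (V : Opens M) : Form m V →ₐ[ℝ] (V → ℝ) :=
  (AlgHom.pi fun p : V => (ExteriorAlgebra.algebraMapInv (R := ℝ) (M := Cot m)).comp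
    (Pi.evalAlgHom ℝ (fun _ : V => Lam m) p)).comp (Form m V).val

theorem formVal_apply {V : Opens M} (w : Form m V) (p : V) :
    formVal m V w p = ExteriorAlgebra.algebraMapInv (w.1 p) := rfl

theorem algebraMap_formVal {V : Opens M} {w : Form m V} (hw : w ∈ formDeg m V 0) (p : V) :
    algebraMap ℝ (Lam m) (formVal m V w p) = w.1 p := by
  have := hw p
  rw [ExteriorAlgebra.exteriorPower, pow_zero] at this
  obtain ⟨r, hr⟩ := Submodule.mem_one.1 this
  rw [formVal_apply, ← hr, ExteriorAlgebra.algebraMap_leftInverse]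

/-- A smooth function as a form of degree `0`. -/
def funForm {V : Opens M} {f : M → ℝ} (hf : ContMDiffOn (𝓡 m) 𝓘(ℝ, ℝ) ∞ f V) : Form m V :=
  ⟨fun p => algebraMap ℝ (Lam m) (f p), form_of_gen m (Algebra.subset_adjoin ⟨f, hf, Or.inl rfl⟩)⟩

/-- The coefficients of a form in the coordinates at `x` are smooth. -/
theorem coeff_form (x : M) {V : Opens M} {w : V → Lam m} (hw : w ∈ Form m V)
    (I : Finset (Fin m)) : ContDiffOn ℝ ∞ (coeff (rep m x w) I) (chartDom m x V) := by
  intro y hy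
  obtain ⟨W, hW, hxW, h1⟩ := hw _ hy.2
  have hyW : y ∈ chartDom m x W := ⟨hy.1, hxW⟩
  have h2 := (coeff_rep m x h1 I).contDiffAt ((isOpen_chartDom m x W).mem_nhds hyW)
  refine (h2.congr_of_eventuallyEq ?_).contDiffWithinAt
  filter_upwards [(isOpen_chartDom m x W).mem_nhds hyW] with z hz
  rw [coeff, coeff, rep_restr m hW x w hz]

theorem image_chart (x : M) {V : Opens M} (hV : V ≤ chartOpen m x) :
    chartAt E x '' V = chartDom m x V := by
  refine Set.Subset.antisymm ?_ ?_
  · rintro _ ⟨p, hp, rfl⟩; exact mem_dom m x hV hp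
  · intro y hy; exact ⟨_, hy.2, (chartAt E x).right_inv hy.1⟩

theorem smooth_comp_chart (x : M) {V : Opens M} (hV : V ≤ chartOpen m x) {g : E → ℝ}
    (hg : ContDiffOn ℝ ∞ g (chartDom m x V)) :
    ContMDiffOn (𝓡 m) 𝓘(ℝ, ℝ) ∞ (g ∘ chartAt E x) V := by
  rw [← contMDiffOn_iff_contDiffOn] at hg
  exact hg.comp ((contMDiffOn_chart (I := 𝓡 m) (x := x)).mono hV) fun p hp => mem_dom m x hV hp

theorem lamBasis_empty : lamBasis m ∅ = 1 := by
  rw [lamBasis_apply]; exact ExteriorAlgebra.ιMulti_zero_apply _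

theorem formVal_range (x : M) {V : Opens M} (hV : V ≤ chartOpen m x) (g : M → ℝ) :
    (∃ a ∈ formDeg m V 0, formVal m V a = fun p : V => g p) ↔
      ContDiffOn ℝ ∞ (g ∘ (chartAt E x).symm) (chartAt E x '' V) := by
  rw [image_chart m x hV]
  constructor
  · rintro ⟨w, hw, h⟩
    refine (coeff_form m x w.2 ∅).congr fun y hy => ?_
    have h3 : w.1 ⟨(chartAt E x).symm y, hy.2⟩
        = algebraMap ℝ (Lam m) (g ((chartAt E x).symm y)) := by
      rw [← algebraMap_formVal m hw, h]
    rw [coeff, rep_of_mem m x _ hy, h3, AlgHom.commutes, Algebra.algebraMap_eq_smul_one,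
      ← lamBasis_empty]
    simp
  · intro hg
    have hs : ContMDiffOn (𝓡 m) 𝓘(ℝ, ℝ) ∞ g V :=
      (smooth_comp_chart m x hV hg).congr fun p hp => by
        have : p ∈ (chartAt E x).source := hV hp
        simp [(chartAt E x).left_inv this]
    refine ⟨funForm m hs, fun p => algebraMap_mem_zero m _, funext fun p => ?_⟩
    exact ExteriorAlgebra.algebraMap_leftInverse _ _

theorem formVal_inj {V : Opens M} (w : Form m V) (hw : w ∈ formDeg m V 0)
    (h0 : formVal m V w = 0) : w = 0 := by
  refine Subtype.ext (funext fun p => ?_)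
  rw [← algebraMap_formVal m hw p, h0]
  exact map_zero _

theorem chartPull_sum (x : M) {V : Opens M} (hV : V ≤ chartOpen m x)
    (c : MonoExp (fun _ : Fin m => 1) →₀ Form m V) (hc : ∀ μ, c μ ∈ formDeg m V 0) (p : V) :
    chartPull m x (chartAt E x p.1)
      ((c.sum fun μ f => f * formRes m hV (monomial (coordForm m x) μ)).1 p)
      = ∑ s, formVal m V (c ((expEquiv m).symm s)) p • lamBasis m s := by
  let T : Form m V →ₐ[ℝ] Lam m :=
    (chartPull m x (chartAt E x p.1)).comp ((Pi.evalAlgHom ℝ _ p).comp (Form m _).val)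
  let _ : Fintype (MonoExp (fun _ : Fin m => 1)) := Fintype.ofEquiv _ (expEquiv m).symm
  have h1 : T (c.sum fun μ f => f * formRes m hV (monomial (coordForm m x) μ))
      = ∑ s, formVal m V (c ((expEquiv m).symm s)) p • lamBasis m s := by
    rw [Finsupp.sum_fintype _ _ (fun _ => zero_mul _), map_sum, ← (expEquiv m).symm.sum_comp]
    refine Finset.sum_congr rfl fun s _ => ?_
    rw [map_mul, ← monomial_eq_lamBasis, Algebra.smul_def]
    congr 1
    · refine (congrArg (chartPull m x _) (algebraMap_formVal m (hc _) p).symm).trans ?_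
      exact AlgHom.commutes _ _
    · exact chartPull_monomial m x ⟨p.1, hV p.2⟩ _
  exact h1

theorem form_expand (x : M) {V : Opens M} (hV : V ≤ chartOpen m x) (w : Form m V) :
    ∃! c : MonoExp (fun _ : Fin m => 1) →₀ Form m V, (∀ μ, c μ ∈ formDeg m V 0) ∧
      w = c.sum fun μ f => f * formRes m hV (monomial (coordForm m x) μ) := by
  have _ : Finite (MonoExp (fun _ : Fin m => 1)) := Finite.of_equiv _ (expEquiv m).symm
  let c₀ : MonoExp (fun _ : Fin m => 1) →₀ Form m V := Finsupp.equivFunOnFinite.symm fun μ =>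
    funForm m (smooth_comp_chart m x hV (coeff_form m x w.2 (expEquiv m μ)))
  have hc₀ : ∀ μ, c₀ μ ∈ formDeg m V 0 := fun μ p => algebraMap_mem_zero m _
  refine ⟨c₀, ⟨hc₀, ?_⟩, ?_⟩
  · refine Subtype.ext (funext fun p => ?_)
    have hp : chartAt E x p.1 ∈ (chartAt E x).target := (mem_dom m x hV p.2).1
    apply chartPull_injective m x hp
    rw [chartPull_sum m x hV c₀ hc₀ p, ← rep_chart m x hV w.1 p, ← sum_coeff (rep m x w.1)]
    refine Finset.sum_congr rfl fun s _ => ?_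
    congr 1
    have h1 : formVal m V (c₀ ((expEquiv m).symm s)) p
        = coeff (rep m x w.1) (expEquiv m ((expEquiv m).symm s)) (chartAt E x p.1) :=
      ExteriorAlgebra.algebraMap_leftInverse _ _
    rw [h1, Equiv.apply_symm_apply]
  · rintro c ⟨hc, hw⟩
    refine Finsupp.ext fun μ => ?_
    rw [← sub_eq_zero]
    refine formVal_inj m _ (sub_mem (hc μ) (hc₀ μ)) (funext fun p => ?_)
    have h1 := chartPull_sum m x hV c hc p
    rw [← hw, ← rep_chart m x hV w.1 p] at h1
    have h2 := congrArg (fun a => (lamBasis m).repr a (expEquiv m μ)) h1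
    simp only [(lamBasis m).repr_sum_self, Equiv.symm_apply_apply] at h2
    have h3 : formVal m V (c₀ μ) p
        = coeff (rep m x w.1) (expEquiv m μ) (chartAt E x p.1) :=
      ExteriorAlgebra.algebraMap_leftInverse _ _
    rw [map_sub, Pi.sub_apply, h3, coeff, h2, sub_self]
    rfl

/-- The coordinates `x^j`, `dx^j` on `(M, Ω)`. -/
def formCoords (x : M) : LocalCoords (formSpace m M) (chartOpen m x) where
  p := m
  chart := chartAt E x
  source_eq := rfl
  val := fun (V : Opens M) _ => formVal m V
  val_res _ _ _ _ _ _ := rfl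
  val_inj := fun (V : Opens M) _ w hw h0 => formVal_inj m (V := V) w hw h0
  val_range := fun (V : Opens M) hV g => formVal_range m x (V := V) hV g
  q := m
  d _ := 1
  d_pos _ := one_pos
  ξ := coordForm m x
  ξ_mem _ _ := ι_mem _
  expand := fun (V : Opens M) hV w => form_expand m x (V := V) hV w

theorem extD_mem {U : Opens M} {k : ℕ} {a : Form m U} (ha : a ∈ formDeg m U k) :
    extD m U a ∈ formDeg m U (k + 1) := by
  have h1 := formD_projF m a.2 k
  rw [projF_self m ha] at h1
  intro x
  have h2 := congrFun h1 x
  show formD m a.1 x ∈ _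
  rw [h2]
  exact gradeProj_mem _ _

theorem extD_mul {U : Opens M} {k : ℕ} {a : Form m U} (ha : a ∈ formDeg m U k) (b : Form m U) :
    extD m U (a * b) = extD m U a * b + (-1 : ℝ) ^ k • (a * extD m U b) := by
  refine Subtype.ext ((formD_form_mul m a.2 b.2).trans ?_)
  have : invF a.1 = (-1 : ℝ) ^ k • a.1 := funext fun x => inv_of_mem (ha x)
  rw [this, smul_mul_assoc]
  rfl

variable (M) in
/-- The NQ-manifold `T[1]M`: its functions are the differential forms on `M`, and `Q` is the
exterior derivative. -/
def T1 [T2Space M] [SecondCountableTopology M] : NQManifold.{u} where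
  toGradedSpace := formSpace m M
  t2 := ‹T2Space M›
  secondCountable := ‹SecondCountableTopology M›
  locally_model := fun (x : M) => ⟨chartOpen m x, mem_chart_source E x, ⟨formCoords m x⟩⟩
  Q := fun (U : Opens M) => extD m U
  Q_mem := fun {U : Opens M} _ _ ha => extD_mem m (U := U) ha
  Q_mul := fun {U : Opens M} _ _ ha b => extD_mul m (U := U) ha b
  Q_res := fun {U V : Opens M} h a => Subtype.ext (formD_restr m h a.1)
  Q_Q := fun {U : Opens M} a => Subtype.ext (formD_formD m a.2)

variable (M) [T2Space M] [SecondCountableTopology M]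

/-- The differential forms of degree `k` on `M`. -/
abbrev Forms (k : ℕ) : Submodule ℝ ((T1 m M).fn ⊤) := (T1 m M).deg ⊤ k

/-- The closed differential forms of degree `k` on `M`. -/
def closedForms (k : ℕ) : Submodule ℝ ((T1 m M).fn ⊤) :=
  Forms m M k ⊓ LinearMap.ker ((T1 m M).Q ⊤)

/-- The exact differential forms of degree `k` on `M`. -/
def exactForms : ℕ → Submodule ℝ ((T1 m M).fn ⊤)
  | 0 => ⊥
  | k + 1 => (Forms m M k).map ((T1 m M).Q ⊤)

/-- The de Rham cohomology `H^k_{DR}(M)`. -/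
abbrev HDR (k : ℕ) : Type u :=
  closedForms m M k ⧸ (exactForms m M k).submoduleOf (closedForms m M k)

variable {m M} in
/-- The cohomology class of a closed form. -/
def HDR.mk {k : ℕ} (η : (T1 m M).fn ⊤) (h : η ∈ closedForms m M k) : HDR m M k :=
  Submodule.Quotient.mk ⟨η, h⟩

end T1

/-- `η` is the vertical part of `Q` in the global N-trivialization with fibre coordinate `ξ`: under
the identification of the total space with `B × ℝ[n]`, its vector field is `Q_B + η ∂/∂ξ`. (The
vector field extends that of `B`, so it is determined by `Q ξ`, which is the pullback of `η`.) -/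
def RnSpace.IsVerticalPart {n : ℕ} {B : NQManifold.{u}} (P : RnSpace n B)
    (ξ : P.total.fn (P.over ⊤)) (η : B.fn ⊤) : Prop :=
  P.total.Q (P.over ⊤) ξ = P.proj.pull ⊤ η

/-- The pullback to the total space of a function on the base. -/
def RnSpace.pullBase {n : ℕ} {B : NQManifold.{u}} (P : RnSpace n B) :
    B.fn ⊤ →ₐ[ℝ] P.total.fn (P.over ⊤) := P.proj.pull ⊤

end NQ

end

/-! Fibre coordinates of N-trivializations over a fixed open set form a torsor under the degree `n`
functions of the base. If `σ` is the zero section for `ξ`, then every point `x` of the bundle is the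
translate of `σ(π(x))` by `ξ(x)`. Equivariance of another coordinate `ξ'` therefore gives `ξ' = ξ +
π^*α` with `α = σ^*ξ'` (`IsTriv.exists_eq_add`). Local coordinates thus yield a Čech 1-cocycle with
values in `Ω^n`. A partition of unity makes it a coboundary (`form_cech`), and the corrected local
coordinates glue to a global one (`PrincipalBundle.exists_isTriv`).

The action is a map of NQ-manifolds and `Q = 0` on `ℝ[n]`. Hence translation by the coordinate `τ`
of `ℝ[n]` sends `Qξ` to `Q(ξ + τ) = Qξ`: the function `Qξ` is invariant, so it equals `π^*η` with `η
= σ^*(Qξ)`. Since `π^*` is injective, `Q² = 0` gives `dη = 0` (`IsTriv.exists_verticalPart`).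
Replacing `ξ` by `ξ + π^*α` replaces `η` by `η + dα`, so the class of `η` depends on the bundle
only, and isomorphisms transport `ξ` without changing `η`.

Conversely, `η` determines the bundle: `(π, ξ)` identifies it with the product `B × ℝ[n]` carrying
the vector field `Q + η ∂/∂τ` (`nonempty_bundleIso`), as a derivation is determined by its values on
the base functions and on `ξ`. Every closed `η` occurs, because this vector field squares to zero
(`fibreQ_fibreQ`). Two bundles with cohomologous vertical parts become isomorphic to the same
product once one coordinate is changed by `α`.

Actions and trivializations are expressed through `S`-points, so these arguments require actual
N-manifolds as test objects: open submanifolds (for sections and universal points) and products with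
`ℝ[n]` (for the universal translation, and for the model bundles). N-maps must also be glued. The
functions on the product are polynomials in `τ`, with `τ² = 0` for odd `n` and a sign when `τ`
passes a function; most of the work is to show that they form an N-manifold with the required
universal property. -/

noncomputable section

namespace NQ

/-! ### Graded functions: homogeneous components and sign automorphisms. -/

namespace GradedSpace

variable {X : GradedSpace.{u}}

theorem induction_homogeneous {U : Opens X.carrier} (p : Submodule ℝ (X.fn U))
    (h : ∀ k, ∀ a ∈ X.deg U k, a ∈ p) (a : X.fn U) : a ∈ p := by
  have h1 : ⨆ k, X.deg U k ≤ p := iSup_le h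
  rw [(X.isInternal U).submodule_iSup_eq_top] at h1
  exact h1 trivial

instance (U : Opens X.carrier) : SetLike.GradedMonoid (X.deg U) where
  one_mem := X.one_mem U
  mul_mem _ _ _ _ := X.mul_mem

/-- Linear maps that agree on homogeneous elements are equal. -/
theorem linearMap_ext {D : Type*} [AddCommGroup D] [Module ℝ D] {U : Opens X.carrier}
    {f g : X.fn U →ₗ[ℝ] D} (h : ∀ k, ∀ a ∈ X.deg U k, f a = g a) : f = g :=
  LinearMap.ext fun a => induction_homogeneous (LinearMap.eqLocus f g) h a

theorem algHom_ext {D : Type*} [Ring D] [Algebra ℝ D] {U : Opens X.carrier}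
    {f g : X.fn U →ₐ[ℝ] D} (h : ∀ k, ∀ a ∈ X.deg U k, f a = g a) : f = g :=
  AlgHom.toLinearMap_injective (linearMap_ext h)

variable (X) in
/-- The homogeneous component of degree `k`. -/
def part (U : Opens X.carrier) (k : ℕ) : X.fn U →ₗ[ℝ] X.fn U :=
  (X.deg U k).subtype ∘ₗ DirectSum.component ℝ ℕ (fun k => X.deg U k) k ∘ₗ
    (LinearEquiv.ofBijective (DirectSum.coeLinearMap (X.deg U)) (X.isInternal U)).symm.toLinearMap

theorem part_mem {U : Opens X.carrier} (k : ℕ) (a : X.fn U) : X.part U k a ∈ X.deg U k :=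
  SetLike.coe_mem _

theorem coeLinearMap_symm {U : Opens X.carrier} {k : ℕ} {a : X.fn U} (ha : a ∈ X.deg U k) :
    (LinearEquiv.ofBijective (DirectSum.coeLinearMap (X.deg U)) (X.isInternal U)).symm a
      = DirectSum.lof ℝ ℕ (fun k => X.deg U k) k ⟨a, ha⟩ := by
  rw [LinearEquiv.symm_apply_eq]
  exact (DirectSum.coeLinearMap_lof (X.deg U) k ⟨a, ha⟩).symm

theorem part_of_mem {U : Opens X.carrier} {k : ℕ} {a : X.fn U} (ha : a ∈ X.deg U k) :
    X.part U k a = a := by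
  simp only [part, LinearMap.comp_apply, LinearEquiv.coe_coe]
  rw [coeLinearMap_symm ha, DirectSum.component.lof_self]
  rfl

theorem part_of_ne {U : Opens X.carrier} {k l : ℕ} {a : X.fn U} (ha : a ∈ X.deg U k)
    (h : k ≠ l) : X.part U l a = 0 := by
  simp only [part, LinearMap.comp_apply, LinearEquiv.coe_coe]
  rw [coeLinearMap_symm ha, DirectSum.component.of, dif_neg h]
  rfl

theorem eq_zero_of_part {U : Opens X.carrier} {a : X.fn U} (h : ∀ k, X.part U k a = 0) :
    a = 0 := by
  have h1 : (LinearEquiv.ofBijective (DirectSum.coeLinearMap (X.deg U)) (X.isInternal U)).symm a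
      = 0 := DirectSum.ext_component ℝ fun k => Subtype.ext (h k)
  simpa using h1

theorem part_res {U V : Opens X.carrier} (h : U ≤ V) (k : ℕ) (a : X.fn V) :
    X.part U k (X.res h a) = X.res h (X.part V k a) := by
  have : X.part U k ∘ₗ (X.res h).toLinearMap = (X.res h).toLinearMap ∘ₗ X.part V k := by
    refine linearMap_ext fun l a ha => ?_
    simp only [LinearMap.comp_apply, AlgHom.toLinearMap_apply]
    by_cases hl : l = k
    · subst hl; rw [part_of_mem ha, part_of_mem (X.res_mem h ha)]
    · rw [part_of_ne ha hl, part_of_ne (X.res_mem h ha) hl, map_zero]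
  exact LinearMap.congr_fun this a

/-- Sections that agree locally are equal. -/
theorem eq_of_res_eq {ι : Type u} {V : Opens X.carrier} {U : ι → Opens X.carrier}
    (hU : ∀ i, U i ≤ V) (hc : ∀ x ∈ V, ∃ i, x ∈ U i) {a b : X.fn V}
    (h : ∀ i, X.res (hU i) a = X.res (hU i) b) : a = b := by
  rw [← sub_eq_zero]
  refine eq_zero_of_part fun k => ?_
  -- The uniqueness in `glue` concerns homogeneous sections only. It is applied to each component of
  -- `a - b`, which like `0` glues the zero sections.
  obtain ⟨t, -, ht⟩ := X.glue k V U hU hc (fun i => 0) (fun _ => zero_mem _)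
    (fun _ _ _ _ _ => by rw [map_zero, map_zero])
  rw [ht (X.part V k (a - b)) ⟨part_mem _ _, fun i => ?_⟩, ht 0 ⟨zero_mem _, fun i => map_zero _⟩]
  rw [← part_res, map_sub, h, sub_self, map_zero]

variable (X) in
/-- The automorphism `a ↦ (-1)^{e|a|} a` of the algebra of functions. -/
def sgn (e : ℕ) (U : Opens X.carrier) : X.fn U →ₐ[ℝ] X.fn U :=
  (DirectSum.toAlgebra ℝ (fun k => X.deg U k)
    (fun k => (-1 : ℝ) ^ (e * k) • (X.deg U k).subtype)
    (by
      show (-1 : ℝ) ^ (e * 0) • (1 : X.fn U) = 1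
      simp)
    (fun {i j} a b => by
      show (-1 : ℝ) ^ (e * (i + j)) • ((a : X.fn U) * (b : X.fn U))
        = ((-1 : ℝ) ^ (e * i) • (a : X.fn U)) * ((-1 : ℝ) ^ (e * j) • (b : X.fn U))
      rw [smul_mul_smul_comm, ← pow_add, mul_add])).comp
  (AlgEquiv.ofBijective (DirectSum.coeAlgHom (X.deg U)) (X.isInternal U)).symm.toAlgHom

theorem sgn_of_mem {U : Opens X.carrier} {k : ℕ} {a : X.fn U} (ha : a ∈ X.deg U k) (e : ℕ) :
    X.sgn e U a = (-1 : ℝ) ^ (e * k) • a := by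
  have h : (AlgEquiv.ofBijective (DirectSum.coeAlgHom (X.deg U)) (X.isInternal U)).symm a
      = DirectSum.of (fun k => X.deg U k) k ⟨a, ha⟩ := by
    rw [AlgEquiv.symm_apply_eq]
    exact (DirectSum.coeAlgHom_of (X.deg U) k ⟨a, ha⟩).symm
  have h2 : X.sgn e U a = DirectSum.toModule ℝ ℕ (X.fn U)
      (fun k => (-1 : ℝ) ^ (e * k) • (X.deg U k).subtype)
      ((AlgEquiv.ofBijective (DirectSum.coeAlgHom (X.deg U)) (X.isInternal U)).symm a) := rfl
  rw [h2, h, ← DirectSum.lof_eq_of ℝ, DirectSum.toModule_lof]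
  rfl

theorem sgn_mem {U : Opens X.carrier} {k : ℕ} {a : X.fn U} (ha : a ∈ X.deg U k) (e : ℕ) :
    X.sgn e U a ∈ X.deg U k := by
  rw [sgn_of_mem ha]; exact Submodule.smul_mem _ _ ha

theorem sgn_res {U V : Opens X.carrier} (h : U ≤ V) (e : ℕ) (a : X.fn V) :
    X.sgn e U (X.res h a) = X.res h (X.sgn e V a) := by
  have : (X.sgn e U).comp (X.res h) = (X.res h).comp (X.sgn e V) :=
    algHom_ext fun k a ha => by
      rw [AlgHom.comp_apply, AlgHom.comp_apply, sgn_of_mem ha, sgn_of_mem (X.res_mem h ha),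
        map_smul]
  exact DFunLike.congr_fun this a

/-- Moving a homogeneous function past another one. -/
theorem mul_comm_sgn {U : Opens X.carrier} {k : ℕ} {t : X.fn U} (ht : t ∈ X.deg U k)
    (a : X.fn U) : t * a = X.sgn k U a * t := by
  have : LinearMap.mulLeft ℝ t = LinearMap.mulRight ℝ t ∘ₗ (X.sgn k U).toLinearMap :=
    linearMap_ext fun l a ha => by
      simp only [LinearMap.mulLeft_apply, LinearMap.comp_apply, LinearMap.mulRight_apply,
        AlgHom.toLinearMap_apply]
      rw [sgn_of_mem ha, smul_mul_assoc, X.graded_comm ht ha]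
  exact LinearMap.congr_fun this a

theorem mul_self_of_odd {U : Opens X.carrier} {k : ℕ} (hk : Odd k) {t : X.fn U}
    (ht : t ∈ X.deg U k) : t * t = 0 := by
  have h := X.graded_comm ht ht
  rw [(hk.mul hk).neg_one_pow, neg_one_smul, eq_neg_iff_add_eq_zero, ← two_smul ℝ] at h
  exact (smul_eq_zero.mp h).resolve_left (by norm_num)

/-! ### Open submanifolds. -/

/-- The image in `X` of an open subset of an open subset of `X`. -/
def img {U : Opens X.carrier} (W : Opens U) : Opens X.carrier :=
  ⟨Subtype.val '' (W : Set U), U.2.isOpenMap_subtype_val _ W.2⟩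

theorem mem_img {U : Opens X.carrier} {W : Opens U} {x : X.carrier} :
    x ∈ img W ↔ ∃ h : x ∈ U, ⟨x, h⟩ ∈ W :=
  ⟨by rintro ⟨y, hy, rfl⟩; exact ⟨y.2, hy⟩, fun ⟨h, hx⟩ => ⟨⟨x, h⟩, hx, rfl⟩⟩

theorem coe_mem_img {U : Opens X.carrier} {W : Opens U} {x : U} : x.1 ∈ img W ↔ x ∈ W :=
  ⟨fun h => (mem_img.1 h).2, fun h => mem_img.2 ⟨x.2, h⟩⟩

theorem img_mono {U : Opens X.carrier} {V W : Opens U} (h : V ≤ W) : img V ≤ img W :=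
  Set.image_mono h

theorem img_le {U : Opens X.carrier} (W : Opens U) : img W ≤ U := fun _ hx => (mem_img.1 hx).1

theorem exists_img {U W : Opens X.carrier} (h : W ≤ U) : ∃ W' : Opens U, img W' = W :=
  ⟨Opens.comap ⟨Subtype.val, continuous_subtype_val⟩ W, by
    ext x; exact mem_img.trans ⟨fun h => h.2, fun hx => ⟨h hx, hx⟩⟩⟩

theorem le_of_img_le {U : Opens X.carrier} {V W : Opens U} (h : img V ≤ img W) : V ≤ W :=
  fun _ hx => coe_mem_img.1 (h (coe_mem_img.2 hx))

variable (X) in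
/-- The restriction of a graded space to an open subset of the body. -/
abbrev restrict (U : Opens X.carrier) : GradedSpace.{u} where
  carrier := U
  fn W := X.fn (img W)
  deg W := X.deg (img W)
  one_mem W := X.one_mem (img W)
  mul_mem := X.mul_mem
  isInternal W := X.isInternal (img W)
  graded_comm := X.graded_comm
  res h := X.res (img_mono h)
  res_mem h := X.res_mem (img_mono h)
  res_self a := X.res_self a
  res_res h h' a := X.res_res (img_mono h) (img_mono h') a
  glue k V W hW hc s hs hcomp := by
    refine X.glue k (img V) (fun i => img (W i)) (fun i => img_mono (hW i)) ?_ s hs ?_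
    · rintro _ ⟨x, hx, rfl⟩
      obtain ⟨i, hi⟩ := hc x hx
      exact ⟨i, coe_mem_img.2 hi⟩
    · intro i j T hi hj
      -- `glue` in `X` tests agreement on all opens of `X`; one that lies in `U` is the image of an
      -- open of `U`, where `hcomp` applies.
      obtain ⟨T, rfl⟩ := exists_img (hi.trans (img_le _))
      exact hcomp i j T (le_of_img_le hi) (le_of_img_le hj)

end GradedSpace

theorem map_monomial {A B : Type*} [Ring A] [Ring B] [Algebra ℝ A] [Algebra ℝ B] (f : A →ₐ[ℝ] B)
    {q : ℕ} (ξ : Fin q → A) (μ : Fin q → ℕ) :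
    f (monomial ξ μ) = monomial (fun j => f (ξ j)) μ := by
  rw [monomial, map_list_prod, List.map_map, monomial]
  congr 2
  ext j
  simp only [Function.comp_apply, map_pow]

open GradedSpace

/-- Restriction of local coordinates. -/
def LocalCoords.restrict {X : GradedSpace.{u}} {U : Opens X.carrier} (c : LocalCoords X U)
    (T : Opens X.carrier) (hT : Nonempty T) :
    LocalCoords (X.restrict T) (Opens.comap ⟨Subtype.val, continuous_subtype_val⟩ U) where
  p := c.p
  chart := c.chart.subtypeRestr hT
  source_eq := by
    rw [c.chart.subtypeRestr_source, c.source_eq]; rfl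
  val V hV := (AlgHom.pi fun x : V => (Pi.evalAlgHom ℝ (fun _ => ℝ)
    (⟨x.1.1, coe_mem_img.2 x.2⟩ : img V))).comp
      (c.val (img V) (by rintro _ ⟨x, hx, rfl⟩; exact hV hx))
  val_res V W hV hW a x := c.val_res (img V) (img W) _ (img_mono hW) a ⟨x.1.1, coe_mem_img.2 x.2⟩
  val_inj V hV a ha h := c.val_inj (img V) (by rintro _ ⟨x, hx, rfl⟩; exact hV hx) a ha (by
    ext ⟨_, x, hx, rfl⟩
    exact congrFun h ⟨x, hx⟩)
  val_range V hV g := by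
    classical
    have hV' : img V ≤ U := by rintro _ ⟨x, hx, rfl⟩; exact hV hx
    -- The property of `c` is about functions on the whole body, so `g` is extended by zero outside
    -- `T`. Only its values on `V` matter.
    have h1 := c.val_range (img V) hV' (fun x => if h : x ∈ T then g ⟨x, h⟩ else 0)
    have himg : c.chart '' (img V) = (c.chart.subtypeRestr hT) '' V := by
      rw [c.chart.subtypeRestr_coe hT]
      exact (Set.image_image c.chart Subtype.val (V : Set T))
    rw [himg] at h1
    have hcongr : ContDiffOn ℝ ∞ ((fun x => if h : x ∈ T then g ⟨x, h⟩ else 0) ∘ c.chart.symm)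
        ((c.chart.subtypeRestr hT) '' V) ↔ ContDiffOn ℝ ∞ (g ∘ (c.chart.subtypeRestr hT).symm)
        ((c.chart.subtypeRestr hT) '' V) := by
      refine contDiffOn_congr ?_
      rintro _ ⟨x, hx, rfl⟩
      have hs : x ∈ (c.chart.subtypeRestr hT).source := by
        rw [c.chart.subtypeRestr_source, c.source_eq]; exact hV hx
      have hs' : x.1 ∈ c.chart.source := by rw [c.source_eq]; exact hV hx
      rw [Function.comp_apply, Function.comp_apply, (c.chart.subtypeRestr hT).left_inv hs,
        c.chart.subtypeRestr_coe hT, Set.domRestrict_apply, c.chart.left_inv hs', dif_pos x.2]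
    rw [← hcongr, ← h1]
    refine exists_congr fun a => and_congr_right fun _ => ?_
    constructor
    · intro h
      ext ⟨_, x, hx, rfl⟩
      rw [dif_pos x.2]
      exact congrFun h ⟨x, hx⟩
    · intro h
      ext x
      refine (congrFun h ⟨x.1.1, coe_mem_img.2 x.2⟩).trans ?_
      exact dif_pos x.1.2
  q := c.q
  d := c.d
  d_pos := c.d_pos
  ξ j := X.res (by rintro _ ⟨x, hx, rfl⟩; exact hx) (c.ξ j)
  ξ_mem j := X.res_mem _ (c.ξ_mem j)
  expand V hV a := by
    have hV' : img V ≤ U := by rintro _ ⟨x, hx, rfl⟩; exact hV hx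
    have h := c.expand (img V) hV' a
    have e : ∀ μ, X.res (img_mono hV) (monomial (fun j => X.res
        (show img (Opens.comap ⟨Subtype.val, continuous_subtype_val⟩ U : Opens T) ≤ U by
          rintro _ ⟨x, hx, rfl⟩; exact hx) (c.ξ j)) μ) = X.res hV' (monomial c.ξ μ) := by
      intro μ
      rw [← map_monomial, X.res_res]
    simp only [e]
    exact h

namespace NManifold

variable (X : NManifold.{u})

/-- The part of an N-manifold over an open subset of the body. -/
abbrev restrict (U : Opens X.carrier) : NManifold.{u} where
  toGradedSpace := X.toGradedSpace.restrict U
  t2 := by have := X.t2; infer_instance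
  secondCountable := by have := X.secondCountable; infer_instance
  locally_model := fun (x : U) => by
    obtain ⟨V, hV, ⟨c⟩⟩ := X.locally_model x.1
    exact ⟨_, hV, ⟨c.restrict U ⟨x⟩⟩⟩

variable {X}

/-- The inclusion of the part over an open subset. -/
def incl (U : Opens X.carrier) : NMap (X.restrict U) X where
  base := ⟨Subtype.val, continuous_subtype_val⟩
  pull V := X.res (by rintro _ ⟨x, hx, rfl⟩; exact hx)
  pull_mem h := X.res_mem _ h
  pull_res h a := by rw [X.res_res]; exact (X.res_res _ _ a).symm

/-- The inclusion of the part over an open subset into the part over a bigger one. -/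
def inclLE {U V : Opens X.carrier} (h : U ≤ V) : NMap (X.restrict U) (X.restrict V) where
  base := ⟨fun x => ⟨x.1, h x.2⟩, by fun_prop⟩
  pull W := X.res (by
    rintro _ ⟨x, hx, rfl⟩
    exact coe_mem_img.2 (show (⟨x.1, h x.2⟩ : V) ∈ W from hx))
  pull_mem h := X.res_mem _ h
  pull_res h a := (X.res_res _ _ a).trans (X.res_res _ _ a).symm

end NManifold

/-! ### Locality and gluing of N-maps. -/

namespace NMap

open NManifold

variable {X Y Z : NManifold.{u}}

/-- The two pullbacks take values over preimages that are only propositionally equal. Restriction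
along this equality of open sets plays the role of a cast and composes well with other restrictions.
-/
theorem ext_res {φ ψ : NMap X Y} (hb : φ.base = ψ.base)
    (hp : ∀ V a, φ.pull V a = X.res (le_of_eq (by rw [hb])) (ψ.pull V a)) : φ = ψ := by
  obtain ⟨b, p, _, _⟩ := φ
  obtain ⟨b', p', _, _⟩ := ψ
  obtain rfl : b = b' := hb
  have : p = p' := by
    funext V
    refine AlgHom.ext fun a => (hp V a).trans (X.res_self _)
  subst this
  rfl

theorem pull_congr {φ ψ : NMap X Y} (h : φ = ψ) (V) (a) :
    φ.pull V a = X.res (le_of_eq (by rw [h])) (ψ.pull V a) := by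
  subst h; exact (X.res_self _).symm

theorem pull_le_congr {φ ψ : NMap X Y} (h : φ = ψ) {V} {W : Opens X.carrier}
    (hW : W ≤ Opens.comap φ.base V) (hW' : W ≤ Opens.comap ψ.base V) (a : Y.fn V) :
    X.res hW (φ.pull V a) = X.res hW' (ψ.pull V a) := by
  subst h; rfl

/-- N-maps that agree locally are equal. -/
theorem ext_local {ι : Type u} {U : ι → Opens X.carrier} (hc : ∀ x, ∃ i, x ∈ U i)
    {φ ψ : NMap X Y} (h : ∀ i, φ.comp (incl (U i)) = ψ.comp (incl (U i))) : φ = ψ := by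
  have hb : φ.base = ψ.base := by
    ext x
    obtain ⟨i, hi⟩ := hc x
    exact congrArg (fun χ : NMap (X.restrict (U i)) Y => χ.base (⟨x, hi⟩ : U i)) (h i)
  refine ext_res hb fun V a => ?_
  refine X.eq_of_res_eq (U := fun i => img (Opens.comap (incl (U i)).base (Opens.comap φ.base V)))
    (fun i => by rintro _ ⟨x, hx, rfl⟩; exact hx) (fun x hx => ?_) fun i => ?_
  · obtain ⟨i, hi⟩ := hc x
    exact ⟨i, mem_img.2 ⟨hi, hx⟩⟩
  · refine (pull_congr (h i) V a).trans ?_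
    exact ((X.res_res _ _ _).trans (X.res_res _ _ _).symm)

/-- Gluing of N-maps. -/
theorem exists_glue {ι : Type u} {U : ι → Opens X.carrier} (hc : ∀ x, ∃ i, x ∈ U i)
    (φ : ∀ i, NMap (X.restrict (U i)) Y)
    (h : ∀ i j, (φ i).comp (inclLE (inf_le_left : U i ⊓ U j ≤ U i))
      = (φ j).comp (inclLE (inf_le_right : U i ⊓ U j ≤ U j))) :
    ∃ ψ : NMap X Y, ∀ i, ψ.comp (incl (U i)) = φ i := by
  choose i hi using hc
  have hb : ∀ j (x : U j), (φ (i x)).base (⟨x.1, hi x⟩ : U (i x)) = (φ j).base x := fun j x =>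
    congrArg (fun χ : NMap (X.restrict (U (i x.1) ⊓ U j)) Y =>
      χ.base (⟨x.1, hi x, x.2⟩ : (U (i x.1) ⊓ U j : Opens _))) (h (i x) j)
  let b : C(X.carrier, Y.carrier) :=
    ⟨fun x => (φ (i x)).base (⟨x, hi x⟩ : U (i x)), continuous_iff_continuousAt.2 fun x => by
      -- The chosen index varies with the point, but by `hb` the map coincides on `U (i x)` with the
      -- single map `φ (i x)`.
      have h1 : ContinuousOn (fun x => (φ (i x)).base (⟨x, hi x⟩ : U (i x))) (U (i x)) := by
        rw [continuousOn_iff_continuous_domRestrict]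
        exact ((φ (i x)).base.continuous).congr fun y => (hb (i x) y).symm
      exact h1.continuousAt ((U (i x)).2.mem_nhds (hi x))⟩
  have hbj : ∀ j (x : U j), b x.1 = (φ j).base x := hb
  let W : ∀ (V : Opens Y.carrier) (j : ι), Opens X.carrier := fun V j =>
    img (Opens.comap (φ j).base V)
  have hW : ∀ V j, W V j ≤ Opens.comap b V := by
    rintro V j _ ⟨x, hx, rfl⟩
    show b x.1 ∈ V
    rw [hbj]; exact hx
  have hcov : ∀ V, ∀ x ∈ Opens.comap b V, ∃ j, x ∈ W V j := fun V x hx =>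
    ⟨i x, mem_img.2 ⟨hi x, hx⟩⟩
  -- The glued pullback is `R⁻¹ ∘ F`, where `R` restricts to the pieces and `F` collects the given
  -- pullbacks; it is then automatically an algebra map. That `F` lands in the range of `R` follows
  -- from `glue` for homogeneous functions, and by linearity for all.
  let R : ∀ V, X.fn (Opens.comap b V) →ₐ[ℝ] (∀ j, X.fn (W V j)) := fun V =>
    AlgHom.pi fun j => X.res (hW V j)
  have hR : ∀ V, Function.Injective (R V) := fun V a a' haa =>
    X.eq_of_res_eq (hW V) (hcov V) fun j => congrFun haa j
  let F : ∀ V, Y.fn V →ₐ[ℝ] (∀ j, X.fn (W V j)) := fun V => AlgHom.pi fun j => (φ j).pull V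
  have hcomp : ∀ V (a : Y.fn V) j k (T : Opens X.carrier) (hj : T ≤ W V j) (hk : T ≤ W V k),
      X.res hj ((φ j).pull V a) = X.res hk ((φ k).pull V a) := by
    intro V a j k T hj hk
    -- An open set inside both pieces comes from an open subset of `U j ⊓ U k`, where the maps agree
    -- by hypothesis.
    obtain ⟨T, rfl⟩ := exists_img (U := U j ⊓ U k)
      (le_inf (hj.trans (img_le _)) (hk.trans (img_le _)))
    have h1 : T ≤ Opens.comap ((φ j).comp (inclLE (inf_le_left : U j ⊓ U k ≤ U j))).base V := by
      intro x hx
      exact (coe_mem_img (x := (⟨x.1, x.2.1⟩ : U j))).1 (hj (coe_mem_img.2 hx : x.1 ∈ img T))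
    have h2 : T ≤ Opens.comap ((φ k).comp (inclLE (inf_le_right : U j ⊓ U k ≤ U k))).base V := by
      intro x hx
      exact (coe_mem_img (x := (⟨x.1, x.2.2⟩ : U k))).1 (hk (coe_mem_img.2 hx : x.1 ∈ img T))
    have h3 := pull_le_congr (h j k) h1 h2 a
    have e1 : (X.restrict (U j ⊓ U k)).res h1 (((φ j).comp (inclLE inf_le_left)).pull V a)
        = X.res hj ((φ j).pull V a) := X.res_res _ _ _
    have e2 : (X.restrict (U j ⊓ U k)).res h2 (((φ k).comp (inclLE inf_le_right)).pull V a)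
        = X.res hk ((φ k).pull V a) := X.res_res _ _ _
    rw [← e1, ← e2, h3]
  have hglue : ∀ V k, ∀ a ∈ Y.deg V k, ∃ t ∈ X.deg (Opens.comap b V) k, R V t = F V a := by
    intro V k a ha
    obtain ⟨t, ⟨h1, h2⟩, -⟩ := X.glue k _ (W V) (hW V) (hcov V) (fun j => (φ j).pull V a)
      (fun j => (φ j).pull_mem ha) (hcomp V a)
    exact ⟨t, h1, funext h2⟩
  have hrange : ∀ V a, F V a ∈ (R V).range := fun V =>
    Y.induction_homogeneous ((Subalgebra.toSubmodule (R V).range).comap (F V).toLinearMap)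
      fun k a ha => by
        obtain ⟨t, -, ht⟩ := hglue V k a ha
        exact ⟨t, ht⟩
  let p : ∀ V, Y.fn V →ₐ[ℝ] X.fn (Opens.comap b V) := fun V =>
    ((AlgEquiv.ofInjective (R V) (hR V)).symm.toAlgHom).comp
      ((F V).codRestrict (R V).range (hrange V))
  have hp : ∀ V a, R V (p V a) = F V a := fun V a =>
    congrArg Subtype.val ((AlgEquiv.ofInjective (R V) (hR V)).apply_symm_apply ⟨F V a, hrange V a⟩)
  have hpj : ∀ V a j, X.res (hW V j) (p V a) = (φ j).pull V a := fun V a => congrFun (hp V a)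
  refine ⟨⟨b, p, ?_, ?_⟩, ?_⟩
  · intro V k a ha
    obtain ⟨t, ht, h1⟩ := hglue V k a ha
    rw [← hp] at h1
    rwa [← hR V h1]
  · intro V V' hV a
    refine X.eq_of_res_eq (hW V) (hcov V) fun j => ?_
    rw [hpj, (φ j).pull_res hV]
    refine (congrArg (X.res _) (hpj V' a j)).symm.trans ?_
    rw [X.res_res, X.res_res]
  · intro j
    refine ext_res (ContinuousMap.ext fun x => hbj j x) fun V a => ?_
    refine Eq.trans ?_ (congrArg (X.res _) (hpj V a j))
    exact (X.res_res _ _ _).symm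

theorem pullTop_comp (φ : NMap X Y) (ψ : NMap Z X) {W : Opens Y.carrier} (h : ∀ x, φ.base x ∈ W)
    (h' : ∀ z, (φ.comp ψ).base z ∈ W) (a : Y.fn W) :
    (φ.comp ψ).pullTop h' a = ψ.pullTop (W := ⊤) (fun _ => trivial) (φ.pullTop h a) :=
  ((congrArg (Z.res (U := ⊤) (V := Opens.comap ψ.base ⊤) le_top) (ψ.pull_res
    (show ⊤ ≤ Opens.comap φ.base W from fun x _ => h x) (φ.pull W a))).trans (Z.res_res _ _ _)).symm

theorem pullTop_res (φ : NMap X Y) {V W : Opens Y.carrier} (hVW : V ≤ W)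
    (h : ∀ x, φ.base x ∈ V) (a : Y.fn W) :
    φ.pullTop h (Y.res hVW a) = φ.pullTop (fun x => hVW (h x)) a :=
  (congrArg (X.res _) (φ.pull_res hVW a)).trans (X.res_res _ _ _)

theorem pullTop_mem (φ : NMap X Y) {W : Opens Y.carrier} (h : ∀ x, φ.base x ∈ W) {k : ℕ}
    {a : Y.fn W} (ha : a ∈ Y.deg W k) : φ.pullTop h a ∈ X.deg ⊤ k :=
  X.res_mem _ (φ.pull_mem ha)

theorem pullTop_congr {φ ψ : NMap X Y} (e : φ = ψ) {W : Opens Y.carrier} (h : ∀ x, φ.base x ∈ W)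
    (h' : ∀ x, ψ.base x ∈ W) (a : Y.fn W) : φ.pullTop h a = ψ.pullTop h' a := by
  subst e; rfl

/-- The image of the whole open submanifold is `W`, so restricting back to `W` undoes the pullback.
Functions on `W` can thus be compared as functions on an N-manifold, that is, along a universal
`S`-point. -/
theorem pullTop_incl_injective {W : Opens X.carrier} {a b : X.fn W}
    (h : (incl W).pullTop (fun x => x.2) a = (incl W).pullTop (fun x => x.2) b) : a = b := by
  have hW : W ≤ img (⊤ : Opens W) := fun x hx => mem_img.2 ⟨hx, trivial⟩
  have h1 : ∀ a : X.fn W, X.res hW ((incl W).pullTop (fun x => x.2) a) = a := fun a =>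
    (congrArg (X.res hW) (X.res_res _ _ a)).trans ((X.res_res _ _ a).trans (X.res_self a))
  rw [← h1 a, ← h1 b, h]

theorem eq_of_pullTop_incl {ι : Type u} {U : ι → Opens X.carrier} (hc : ∀ x, ∃ i, x ∈ U i)
    {a b : X.fn ⊤} (h : ∀ i, (incl (U i)).pullTop (W := ⊤) (fun _ => trivial) a
      = (incl (U i)).pullTop (W := ⊤) (fun _ => trivial) b) : a = b := by
  refine X.eq_of_res_eq (U := U) (fun _ => le_top) (fun x _ => hc x) fun i => ?_
  exact pullTop_incl_injective (((incl (U i)).pullTop_res le_top _ a).trans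
    ((h i).trans ((incl (U i)).pullTop_res le_top _ b).symm))

end NMap

end NQ

end
-- Polynomials in a variable `τ` with `τ a = s(a) τ`.
noncomputable section

namespace NQ

/-- The exponents of the powers of a variable of degree `n`. -/
abbrev FibreExp (n : ℕ) : Type := {k : ℕ // Odd n → k ≤ 1}

/-- The algebra obtained from `A` by adjoining a variable `τ` of degree `n` with `τ a = s(a) τ`. -/
def FibreAlg (n : ℕ) {A : Type u} [Ring A] [Algebra ℝ A] (_s : A →ₐ[ℝ] A) : Type u :=
  FibreExp n →₀ A

namespace FibreAlg

variable {n : ℕ} {A : Type u} [Ring A] [Algebra ℝ A] {s : A →ₐ[ℝ] A}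

instance : AddCommGroup (FibreAlg n s) := inferInstanceAs (AddCommGroup (FibreExp n →₀ A))
instance : Module ℝ (FibreAlg n s) := inferInstanceAs (Module ℝ (FibreExp n →₀ A))

variable (n s) in
/-- The monomials with a given exponent. -/
def single (j : FibreExp n) : A →ₗ[ℝ] FibreAlg n s :=
  (Finsupp.lsingle j : A →ₗ[ℝ] FibreExp n →₀ A)

/-- The linear map with given values on monomials. -/
def elim {D : Type*} [AddCommGroup D] [Module ℝ D] (f : FibreExp n → A →ₗ[ℝ] D) :
    FibreAlg n s →ₗ[ℝ] D :=
  (Finsupp.lsum ℝ f : (FibreExp n →₀ A) →ₗ[ℝ] D)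

theorem elim_single {D : Type*} [AddCommGroup D] [Module ℝ D] (f : FibreExp n → A →ₗ[ℝ] D)
    (j : FibreExp n) (a : A) : elim f (single n s j a) = f j a :=
  Finsupp.lsum_single ℝ f j a

open Classical in
variable (n s) in
/-- The monomials `a τ^k` (zero if `τ^k = 0`). -/
def mono (k : ℕ) : A →ₗ[ℝ] FibreAlg n s :=
  if h : Odd n → k ≤ 1 then single n s ⟨k, h⟩ else 0

variable (n s) in
/-- The coefficients of the powers of `τ`. -/
def coef (j : FibreExp n) : FibreAlg n s →ₗ[ℝ] A :=
  (Finsupp.lapply j : (FibreExp n →₀ A) →ₗ[ℝ] A)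

theorem ext_coef {c d : FibreAlg n s} (h : ∀ j, coef n s j c = coef n s j d) : c = d :=
  Finsupp.ext h

theorem mono_eq_single (j : FibreExp n) (a : A) : mono n s j.1 a = single n s j a := by
  rw [mono, dif_pos j.2]

theorem mono_of_not {k : ℕ} (h : ¬ (Odd n → k ≤ 1)) : mono n s k = 0 := dif_neg h

theorem coef_mono [DecidableEq (FibreExp n)] (i j : FibreExp n) (a : A) :
    coef n s i (mono n s j.1 a) = if j = i then a else 0 := by
  rw [mono_eq_single]
  exact Finsupp.single_apply

theorem linearMap_ext {D : Type*} [AddCommGroup D] [Module ℝ D] {f g : FibreAlg n s →ₗ[ℝ] D}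
    (h : ∀ (j : FibreExp n) a, f (mono n s j.1 a) = g (mono n s j.1 a)) : f = g :=
  Finsupp.lhom_ext (M := A) (φ := f) (ψ := g) fun j a => by
    have := h j a
    rwa [mono_eq_single] at this

theorem eq_sum (c : FibreAlg n s) (p : Submodule ℝ (FibreAlg n s))
    (h : ∀ j : FibreExp n, mono n s j.1 (coef n s j c) ∈ p) : c ∈ p := by
  have h1 : c = Finsupp.sum (c : FibreExp n →₀ A) fun j a => mono n s j.1 a := by
    simp only [mono_eq_single]
    exact (Finsupp.sum_single (c : FibreExp n →₀ A)).symm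
  rw [h1]
  exact Submodule.sum_mem _ fun j _ => h j

variable (n s) in
/-- The multiplication. -/
def mulMap : FibreAlg n s →ₗ[ℝ] FibreAlg n s →ₗ[ℝ] FibreAlg n s :=
  -- The rule is `(a τ^j)(b τ^k) = a s^j(b) τ^(j+k)`. `elim` is applied to one factor at a time, and
  -- the flips restore the order of the arguments.
  elim fun j : FibreExp n => LinearMap.flip (elim fun k : FibreExp n =>
    LinearMap.flip (((LinearMap.mul ℝ A).compl₂ ((s ^ j.1 : A →ₐ[ℝ] A).toLinearMap)).compr₂
      (mono n s (j.1 + k.1))))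

/-- All natural exponents are allowed: if `τ^j` or `τ^k` vanishes, then so does `τ^(j+k)`, and both
sides are zero. Later computations therefore need no case distinction. -/
theorem mulMap_mono (j k : ℕ) (a b : A) : mulMap n s (mono n s j a) (mono n s k b)
    = mono n s (j + k) (a * (s ^ j : A →ₐ[ℝ] A) b) := by
  by_cases hj : Odd n → j ≤ 1
  swap
  · rw [mono_of_not hj, mono_of_not (k := j + k) (fun h => hj fun ho => by have := h ho; omega)]
    simp
  by_cases hk : Odd n → k ≤ 1
  swap
  · rw [mono_of_not hk, mono_of_not (k := j + k) (fun h => hk fun ho => by have := h ho; omega)]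
    simp
  rw [mono_eq_single ⟨j, hj⟩, mono_eq_single ⟨k, hk⟩, mulMap, elim_single,
    LinearMap.flip_apply, elim_single]
  rfl

instance : One (FibreAlg n s) := ⟨mono n s 0 1⟩
instance : Mul (FibreAlg n s) := ⟨fun a b => mulMap n s a b⟩

theorem one_def : (1 : FibreAlg n s) = mono n s 0 1 := rfl

theorem mul_def (a b : FibreAlg n s) : a * b = mulMap n s a b := rfl

theorem mono_mul_mono (j k : ℕ) (a b : A) : mono n s j a * mono n s k b
    = mono n s (j + k) (a * (s ^ j : A →ₐ[ℝ] A) b) := mulMap_mono j k a b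

instance : Ring (FibreAlg n s) where
  __ := (inferInstance : AddCommGroup (FibreAlg n s))
  left_distrib a b c := map_add (mulMap n s a) b c
  right_distrib a b c := by
    simp only [mul_def, map_add, LinearMap.add_apply]
  zero_mul a := by simp only [mul_def, map_zero, LinearMap.zero_apply]
  mul_zero a := by simp only [mul_def, map_zero]
  one_mul a := by
    have : mulMap n s 1 = LinearMap.id := linearMap_ext fun j a => by
      rw [one_def, mulMap_mono]; simp
    exact LinearMap.congr_fun this a
  mul_one a := by
    have : (mulMap n s).flip 1 = LinearMap.id := linearMap_ext fun j a => by
      rw [LinearMap.flip_apply, one_def, mulMap_mono]; simp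
    exact LinearMap.congr_fun this a
  mul_assoc a b c := by
    -- Both sides are trilinear, so monomials suffice; there the identity is `s^(i+j) = s^i ∘ s^j`
    -- together with the multiplicativity of `s^i`.
    have : (mulMap n s).compr₂ (mulMap n s)
        = (LinearMap.llcomp ℝ _ _ _).flip (mulMap n s) ∘ₗ
          ((LinearMap.llcomp ℝ _ _ _ : _ →ₗ[ℝ] _ →ₗ[ℝ] (FibreAlg n s →ₗ[ℝ] _)) ∘ₗ mulMap n s) := by
      refine linearMap_ext fun i a => linearMap_ext fun j b => linearMap_ext fun k c => ?_
      simp only [LinearMap.compr₂_apply, LinearMap.comp_apply, LinearMap.flip_apply,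
        LinearMap.llcomp_apply, mulMap_mono, map_mul, mul_assoc, pow_add, add_assoc]
      rfl
    exact LinearMap.congr_fun (LinearMap.congr_fun (LinearMap.congr_fun this a) b) c

instance : Algebra ℝ (FibreAlg n s) := Algebra.ofModule
  (fun r a b => by simp only [mul_def, map_smul, LinearMap.smul_apply])
  (fun r a b => by simp only [mul_def, map_smul])

variable (n s) in
/-- The inclusion of the coefficients. -/
def emb : A →ₐ[ℝ] FibreAlg n s :=
  AlgHom.ofLinearMap (mono n s 0) rfl fun a b => by rw [mono_mul_mono]; simp

variable (n s) in
/-- The variable. -/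
def tau : FibreAlg n s := mono n s 1 1

theorem emb_apply (a : A) : emb n s a = mono n s 0 a := rfl

theorem tau_pow (k : ℕ) : tau n s ^ k = mono n s k 1 := by
  induction k with
  | zero => rfl
  | succ k ih => rw [pow_succ, ih, tau, mono_mul_mono, map_one, mul_one]

theorem mono_eq (k : ℕ) (a : A) : mono n s k a = emb n s a * tau n s ^ k := by
  rw [tau_pow, emb_apply, mono_mul_mono]; simp

theorem tau_mul_emb (a : A) : tau n s * emb n s a = emb n s (s a) * tau n s := by
  rw [tau, emb_apply, emb_apply, mono_mul_mono, mono_mul_mono]; simp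

theorem tau_mul_tau (h : Odd n) : tau n s * tau n s = 0 := by
  rw [tau, mono_mul_mono, mono_of_not (fun h' => by have := h' h; omega)]; rfl

theorem algHom_ext {D : Type*} [Ring D] [Algebra ℝ D] {f g : FibreAlg n s →ₐ[ℝ] D}
    (h1 : ∀ a, f (emb n s a) = g (emb n s a)) (h2 : f (tau n s) = g (tau n s)) : f = g :=
  AlgHom.toLinearMap_injective (linearMap_ext fun j a => by
    simp only [AlgHom.toLinearMap_apply, mono_eq, map_mul, map_pow, h1, h2])

/-- A subalgebra that contains the generators is everything. -/
theorem mem_of_generators (S : Subalgebra ℝ (FibreAlg n s)) (h1 : ∀ a, emb n s a ∈ S)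
    (h2 : tau n s ∈ S) (c : FibreAlg n s) : c ∈ S :=
  eq_sum c (Subalgebra.toSubmodule S) fun j => by
    rw [mono_eq]; exact S.mul_mem (h1 _) (S.pow_mem h2 _)

section lift

variable {D : Type*} [Ring D] [Algebra ℝ D] (g : A →ₐ[ℝ] D) (t : D)

theorem pow_mul_of_comm {g : A →ₐ[ℝ] D} {t : D} (ht : ∀ a, t * g a = g (s a) * t) (k : ℕ) (a : A) :
    t ^ k * g a = g ((s ^ k : A →ₐ[ℝ] A) a) * t ^ k := by
  induction k generalizing a with
  | zero => simp
  | succ k ih => rw [pow_succ, mul_assoc, ht, ← mul_assoc, ih, mul_assoc, pow_succ s]; rfl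

/-- The linear map `a τ^k ↦ g(a) t^k`. -/
def liftMap : FibreAlg n s →ₗ[ℝ] D :=
  elim fun k : FibreExp n => LinearMap.mulRight ℝ (t ^ k.1) ∘ₗ g.toLinearMap

/-- The relation `h2` makes the formula valid for inadmissible exponents too: for odd `n` and `k ≥
2` the power `t^k` contains `t * t`. -/
theorem liftMap_mono (h2 : Odd n → t * t = 0) (k : ℕ) (a : A) :
    liftMap (n := n) (s := s) g t (mono n s k a) = g a * t ^ k := by
  by_cases hk : Odd n → k ≤ 1
  · rw [mono_eq_single ⟨k, hk⟩, liftMap, elim_single]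
    rfl
  · rw [mono_of_not hk]
    obtain ⟨ho, hk⟩ := Classical.not_imp.1 hk
    obtain ⟨k, rfl⟩ : ∃ l, k = l + 2 := ⟨k - 2, by omega⟩
    rw [pow_add, pow_two, h2 ho]
    simp

/-- The universal property. -/
def lift (ht : ∀ a, t * g a = g (s a) * t) (h2 : Odd n → t * t = 0) : FibreAlg n s →ₐ[ℝ] D :=
  AlgHom.ofLinearMap (liftMap g t)
    (by rw [one_def, liftMap_mono g t h2]; simp)
    (by
      have : (mulMap n s).compr₂ (liftMap g t)
          = (LinearMap.mul ℝ D).compl₁₂ (liftMap g t) (liftMap g t) := by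
        refine linearMap_ext fun i a => linearMap_ext fun j b => ?_
        simp only [LinearMap.compr₂_apply, LinearMap.compl₁₂_apply, LinearMap.mul_apply',
          mulMap_mono, liftMap_mono g t h2, map_mul, pow_add]
        rw [mul_assoc (g a) (t ^ i.1), ← mul_assoc (t ^ i.1) (g b), pow_mul_of_comm ht]
        simp only [mul_assoc]
      exact fun a b => LinearMap.congr_fun (LinearMap.congr_fun this a) b)

variable {g t} {ht : ∀ a, t * g a = g (s a) * t} {h2 : Odd n → t * t = 0}

theorem lift_mono (k : ℕ) (a : A) : lift g t ht h2 (mono n s k a) = g a * t ^ k :=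
  liftMap_mono g t h2 k a

theorem lift_emb (a : A) : lift g t ht h2 (emb n s a) = g a := by
  rw [emb_apply, lift_mono]; simp

theorem lift_tau : lift g t ht h2 (tau n s) = t := by
  rw [tau, lift_mono]; simp

end lift

section map

variable {B : Type u} [Ring B] [Algebra ℝ B] {s' : B →ₐ[ℝ] B}

/-- Functoriality. -/
def map (f : A →ₐ[ℝ] B) (hf : ∀ a, s' (f a) = f (s a)) : FibreAlg n s →ₐ[ℝ] FibreAlg n s' :=
  lift ((emb n s').comp f) (tau n s')
    (fun a => by rw [AlgHom.comp_apply, tau_mul_emb, hf]; rfl) tau_mul_tau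

variable {f : A →ₐ[ℝ] B} {hf : ∀ a, s' (f a) = f (s a)}

theorem map_mono (k : ℕ) (a : A) : map f hf (mono n s k a) = mono n s' k (f a) := by
  rw [map, lift_mono, mono_eq]; rfl

theorem map_emb (a : A) : map (n := n) f hf (emb n s a) = emb n s' (f a) := map_mono 0 a

theorem map_tau : map f hf (tau n s) = tau n s' := lift_tau

theorem coef_map (j : FibreExp n) (c : FibreAlg n s) :
    coef n s' j (map f hf c) = f (coef n s j c) := by
  have : coef n s' j ∘ₗ (map f hf).toLinearMap = f.toLinearMap ∘ₗ coef n s j :=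
    linearMap_ext fun i a => by
      classical
      simp only [LinearMap.comp_apply, AlgHom.toLinearMap_apply, map_mono, coef_mono]
      split_ifs <;> simp
  exact LinearMap.congr_fun this c

end map

end FibreAlg

end NQ

end
-- The graded space `X × ℝ[n]` and its local coordinates.
noncomputable section

namespace NQ

open GradedSpace FibreAlg

/-- Independence holds because `p k` fixes `𝒜 k` and kills the span of the other pieces, so their
intersection is zero. -/
theorem isInternal_of_projections {V : Type*} [AddCommGroup V] [Module ℝ V] (𝒜 : ℕ → Submodule ℝ V)
    (p : ℕ → V →ₗ[ℝ] V) (h1 : ∀ k, ∀ a ∈ 𝒜 k, p k a = a)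
    (h2 : ∀ k l, k ≠ l → ∀ a ∈ 𝒜 k, p l a = 0) (h3 : ⨆ k, 𝒜 k = ⊤) :
    DirectSum.IsInternal 𝒜 := by
  rw [DirectSum.isInternal_submodule_iff_iSupIndep_and_iSup_eq_top]
  refine ⟨fun k => ?_, h3⟩
  rw [Submodule.disjoint_def]
  intro w hw hw'
  have hle : ⨆ j, ⨆ (_ : j ≠ k), 𝒜 j ≤ LinearMap.ker (p k) :=
    iSup₂_le fun j hj a ha => h2 j k hj a ha
  have h0 : p k w = 0 := hle hw'
  rwa [h1 k w hw] at h0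

/-- Unique expansion, as bijectivity of a linear map. -/
theorem existsUnique_expansion_iff {A : Type*} [Ring A] [Algebra ℝ A] {ι : Type*}
    (p : Submodule ℝ A) (e : ι → A) :
    (∀ a, ∃! c : ι →₀ A, (∀ μ, c μ ∈ p) ∧ a = c.sum fun μ f => f * e μ) ↔
      Function.Bijective (Finsupp.lsum ℝ fun μ => LinearMap.mulRight ℝ (e μ) ∘ₗ p.subtype :
        (ι →₀ p) →ₗ[ℝ] A) := by
  have hL : ∀ c : ι →₀ p, (Finsupp.lsum ℝ fun μ => LinearMap.mulRight ℝ (e μ) ∘ₗ p.subtype :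
        (ι →₀ p) →ₗ[ℝ] A) c = (Finsupp.mapRange.linearMap p.subtype c).sum fun μ f => f * e μ := by
    intro c
    rw [Finsupp.mapRange.linearMap_apply, Finsupp.sum_mapRange_index (fun _ => zero_mul _)]
    rfl
  have hlift : ∀ c : ι →₀ A, (∀ μ, c μ ∈ p) → ∃ c' : ι →₀ p,
      Finsupp.mapRange.linearMap p.subtype c' = c := by
    intro c hc
    exact ⟨⟨c.support, fun μ => ⟨c μ, hc μ⟩, fun μ => by simp [Subtype.ext_iff]⟩,
      Finsupp.ext fun μ => rfl⟩
  constructor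
  · intro h
    constructor
    · intro c c' hcc
      rw [hL, hL] at hcc
      have h1 := (h _).unique ⟨fun μ => (c μ).2, rfl⟩ ⟨fun μ => (c' μ).2, hcc⟩
      exact Finsupp.ext fun μ => Subtype.ext (DFunLike.congr_fun h1 μ)
    · intro a
      obtain ⟨c, ⟨hc, ha⟩, -⟩ := h a
      obtain ⟨c', rfl⟩ := hlift c hc
      exact ⟨c', (hL c').trans ha.symm⟩
  · intro h a
    obtain ⟨c, rfl⟩ := h.2 a
    refine ⟨Finsupp.mapRange.linearMap p.subtype c, ⟨fun μ => (c μ).2, hL c⟩, ?_⟩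
    rintro d ⟨hd, hda⟩
    obtain ⟨d', rfl⟩ := hlift d hd
    rw [← hL] at hda
    rw [h.1 hda]

namespace GradedSpace

variable (X : GradedSpace.{u}) (n : ℕ)

theorem sgn_sgn {X : GradedSpace.{u}} {U : Opens X.carrier} (i j : ℕ) (a : X.fn U) :
    X.sgn i U (X.sgn j U a) = X.sgn j U (X.sgn i U a) := by
  have : (X.sgn i U).comp (X.sgn j U) = (X.sgn j U).comp (X.sgn i U) :=
    algHom_ext fun k a ha => by
      rw [AlgHom.comp_apply, AlgHom.comp_apply, sgn_of_mem ha, sgn_of_mem ha, map_smul, map_smul,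
        sgn_of_mem ha, sgn_of_mem ha, smul_comm]
  exact DFunLike.congr_fun this a

/-- The functions of degree `k - l`. -/
def degSub (U : Opens X.carrier) (k l : ℕ) : Submodule ℝ (X.fn U) :=
  -- Subtraction of natural numbers truncates, so for `l > k` the value has to be set to zero
  -- explicitly.
  if l ≤ k then X.deg U (k - l) else ⊥

variable {X} in
theorem mem_degSub {U : Opens X.carrier} {i l k : ℕ} (h : i + l = k) {a : X.fn U} :
    a ∈ X.degSub U k l ↔ a ∈ X.deg U i := by
  rw [degSub, if_pos (by omega), show k - l = i by omega]

variable {X} in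
theorem mem_degSub_of_lt {U : Opens X.carrier} {l k : ℕ} (h : k < l) {a : X.fn U} :
    a ∈ X.degSub U k l ↔ a = 0 := by
  rw [degSub, if_neg (by omega)]; exact Submodule.mem_bot ℝ

/-- The functions on `X × ℝ[n]`. -/
abbrev FibreFn (U : Opens X.carrier) : Type u := FibreAlg n (X.sgn n U)

/-- The functions of degree `k` on `X × ℝ[n]`. -/
def fibreDeg (U : Opens X.carrier) (k : ℕ) : Submodule ℝ (X.FibreFn n U) :=
  ⨅ j : FibreExp n, (X.degSub U k (n * j.1)).comap (coef n (X.sgn n U) j)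

variable {X n} {U V : Opens X.carrier}

theorem mem_fibreDeg {k : ℕ} {c : X.FibreFn n U} :
    c ∈ X.fibreDeg n U k ↔ ∀ j, coef n (X.sgn n U) j c ∈ X.degSub U k (n * j.1) := by
  simp [fibreDeg]

theorem mono_mem {i j k : ℕ} (h : i + n * j = k) {a : X.fn U} (ha : a ∈ X.deg U i) :
    mono n (X.sgn n U) j a ∈ X.fibreDeg n U k := by
  classical
  by_cases hj : Odd n → j ≤ 1
  · rw [mem_fibreDeg]
    intro l
    rw [coef_mono l ⟨j, hj⟩]
    split_ifs with e
    · subst e; exact (mem_degSub h).2 ha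
    · exact zero_mem _
  · rw [mono_of_not hj]; exact zero_mem _

theorem emb_mem {k : ℕ} {a : X.fn U} (ha : a ∈ X.deg U k) :
    emb n (X.sgn n U) a ∈ X.fibreDeg n U k := mono_mem (by omega) ha

theorem tau_mem : tau n (X.sgn n U) ∈ X.fibreDeg n U n := mono_mem (by omega) (X.one_mem U)

/-- Homogeneous functions are sums of homogeneous monomials. -/
theorem fibreDeg_induction {k : ℕ} {p : Submodule ℝ (X.FibreFn n U)}
    (h : ∀ i j a, i + n * j = k → a ∈ X.deg U i → mono n (X.sgn n U) j a ∈ p)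
    {c : X.FibreFn n U} (hc : c ∈ X.fibreDeg n U k) : c ∈ p := by
  refine eq_sum c p fun j => ?_
  have h1 := mem_fibreDeg.1 hc j
  rcases lt_or_ge k (n * j.1) with hk | hk
  · rw [(mem_degSub_of_lt hk).1 h1, map_zero]; exact zero_mem _
  · exact h (k - n * j.1) j.1 _ (by omega) ((mem_degSub (by omega)).1 h1)

theorem sgn_pow {k : ℕ} {a : X.fn U} (ha : a ∈ X.deg U k) (e j : ℕ) :
    (X.sgn e U ^ j : X.fn U →ₐ[ℝ] X.fn U) a = (-1 : ℝ) ^ (e * j * k) • a := by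
  induction j with
  | zero => simp
  | succ j ih =>
    rw [pow_succ, AlgHom.mul_apply, sgn_of_mem ha, map_smul, ih, smul_smul, ← pow_add]
    congr 2; ring

theorem fibreDeg_mul {i j : ℕ} {a b : X.FibreFn n U} (ha : a ∈ X.fibreDeg n U i)
    (hb : b ∈ X.fibreDeg n U j) : a * b ∈ X.fibreDeg n U (i + j) := by
  refine fibreDeg_induction (p := (X.fibreDeg n U (i + j)).comap (LinearMap.mulRight ℝ b)) ?_ ha
  intro i' k a hi ha
  refine fibreDeg_induction (p := (X.fibreDeg n U (i + j)).comap (LinearMap.mulLeft ℝ (mono n _ k a))) ?_ hb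
  intro j' l b hj hb
  rw [Submodule.mem_comap, LinearMap.mulLeft_apply, mono_mul_mono, sgn_pow hb]
  have h : (i' + j') + n * (k + l) = i + j := by rw [← hi, ← hj]; ring
  exact mono_mem h (X.mul_mem ha (Submodule.smul_mem _ _ hb))

/-- Powers of `τ` commute without sign in this algebra, while graded commutativity asks for
`(-1)^(nk·nl)` between `τ^k` and `τ^l`. The two agree whenever `τ^(k+l) ≠ 0`: the exponent is even
for even `n`, and for odd `n` one of `k`, `l` is zero. The remaining signs come from moving powers
of `τ` past coefficients. -/
theorem fibreDeg_comm {i j : ℕ} {a b : X.FibreFn n U} (ha : a ∈ X.fibreDeg n U i)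
    (hb : b ∈ X.fibreDeg n U j) : a * b = (-1 : ℝ) ^ (i * j) • (b * a) := by
  refine fibreDeg_induction (p := LinearMap.eqLocus (LinearMap.mulRight ℝ b)
    ((-1 : ℝ) ^ (i * j) • LinearMap.mulLeft ℝ b)) ?_ ha
  intro i' k a hi ha
  refine fibreDeg_induction (p := LinearMap.eqLocus (LinearMap.mulLeft ℝ (mono n _ k a))
    ((-1 : ℝ) ^ (i * j) • LinearMap.mulRight ℝ (mono n _ k a))) ?_ hb
  intro j' l b hj hb
  rw [LinearMap.mem_eqLocus, LinearMap.mulLeft_apply, LinearMap.smul_apply,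
    LinearMap.mulRight_apply, mono_mul_mono, mono_mul_mono, sgn_pow hb, sgn_pow ha,
    mul_smul_comm, mul_smul_comm, X.graded_comm ha hb, smul_smul, map_smul, map_smul, smul_smul,
    add_comm k l]
  by_cases hkl : Odd n → l + k ≤ 1
  swap
  · rw [mono_of_not hkl, LinearMap.zero_apply, smul_zero, smul_zero]
  congr 1
  have key : (-1 : ℝ) ^ (n * k * (n * l)) = 1 := by
    rcases Nat.even_or_odd n with he | ho
    · exact (he.mul_right k |>.mul_right _).neg_one_pow
    · have := hkl ho
      rcases Nat.eq_zero_or_pos k with rfl | hk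
      · simp
      · obtain rfl : l = 0 := by omega
        simp
  rw [← hi, ← hj, ← pow_add, ← pow_add]
  have e : (i' + n * k) * (j' + n * l) + n * l * i'
      = (n * k * j' + i' * j') + n * k * (n * l) + 2 * (n * l * i') := by ring
  rw [e, pow_add _ (n * k * j' + i' * j' + n * k * (n * l)), pow_add _ (n * k * j' + i' * j'), key,
    mul_one, pow_mul _ 2, neg_one_sq, one_pow, mul_one, pow_add]

/-- The projection to degree `k` replaces the coefficient of `τ^j` by its component of degree `k -
nj`, or by zero if `nj > k`. -/
theorem fibreDeg_isInternal : DirectSum.IsInternal (X.fibreDeg n U) := by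
  refine isInternal_of_projections _ (fun k => elim fun j : FibreExp n =>
    if n * j.1 ≤ k then single n _ j ∘ₗ X.part U (k - n * j.1) else 0) ?_ ?_ ?_
  · intro k a ha
    refine fibreDeg_induction (p := LinearMap.eqLocus _ LinearMap.id) ?_ ha
    intro i j a hij ha
    by_cases hj : Odd n → j ≤ 1
    swap
    · rw [mono_of_not hj]; exact zero_mem _
    rw [LinearMap.mem_eqLocus, mono_eq_single ⟨j, hj⟩, elim_single, if_pos (by simp; omega),
      LinearMap.comp_apply, show k - n * j = i by omega, part_of_mem ha]
    rfl
  · intro k l hkl a ha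
    refine fibreDeg_induction (p := LinearMap.ker _) ?_ ha
    intro i j a hij ha
    by_cases hj : Odd n → j ≤ 1
    swap
    · rw [mono_of_not hj]; exact zero_mem _
    rw [LinearMap.mem_ker, mono_eq_single ⟨j, hj⟩, elim_single]
    split_ifs with h
    · have h' : n * j ≤ l := h
      rw [LinearMap.comp_apply, part_of_ne ha (by simp only; omega), map_zero]
    · rfl
  · rw [eq_top_iff]
    intro c _
    refine eq_sum c _ fun j => ?_
    refine X.induction_homogeneous ((⨆ k, X.fibreDeg n U k).comap (mono n _ j.1)) ?_ _
    intro k a ha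
    exact Submodule.mem_iSup_of_mem (k + n * j.1) (mono_mem rfl ha)

/-- Restriction of functions on `X × ℝ[n]`. -/
def fibreRes (h : U ≤ V) : X.FibreFn n V →ₐ[ℝ] X.FibreFn n U :=
  FibreAlg.map (X.res h) (fun a => sgn_res h n a)

theorem coef_fibreRes (h : U ≤ V) (j : FibreExp n) (c : X.FibreFn n V) :
    coef n (X.sgn n U) j (fibreRes h c) = X.res h (coef n (X.sgn n V) j c) := coef_map j c

theorem res_mem_degSub (h : U ≤ V) {k l : ℕ} {a : X.fn V} (ha : a ∈ X.degSub V k l) :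
    X.res h a ∈ X.degSub U k l := by
  rcases lt_or_ge k l with hk | hk
  · rw [(mem_degSub_of_lt hk).1 ha, map_zero]; exact zero_mem _
  · exact (mem_degSub (by omega)).2 (X.res_mem h ((mem_degSub (i := k - l) (by omega)).1 ha))

/-- This bounds the `τ`-degree of a function of degree `k`, as `j ≤ nj` for `n ≥ 1`. Without the
bound, gluing coefficients could produce an infinite series in `τ`. -/
theorem finite_fibreExp_le (hn : 1 ≤ n) (k : ℕ) : {j : FibreExp n | n * j.1 ≤ k}.Finite := by
  refine ((Set.finite_Iic k).preimage Subtype.val_injective.injOn).subset fun j hj => ?_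
  exact (Nat.le_mul_of_pos_left j.1 hn).trans hj

/-- Gluing is coefficientwise: the coefficient of `τ^j` is glued in degree `k - nj`, and is zero
when `nj > k`. -/
theorem fibre_glue (hn : 1 ≤ n) {ι : Type u} (k : ℕ) (V : Opens X.carrier)
    (U : ι → Opens X.carrier) (hU : ∀ i, U i ≤ V) (hc : ∀ x ∈ V, ∃ i, x ∈ U i)
    (s : ∀ i, X.FibreFn n (U i)) (hs : ∀ i, s i ∈ X.fibreDeg n (U i) k)
    (hcomp : ∀ i j (W : Opens X.carrier) (hi : W ≤ U i) (hj : W ≤ U j),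
      fibreRes hi (s i) = fibreRes hj (s j)) :
    ∃! t, t ∈ X.fibreDeg n V k ∧ ∀ i, fibreRes (hU i) t = s i := by
  have h1 : ∀ j : FibreExp n, ∃ t ∈ X.degSub V k (n * j.1),
      ∀ i, X.res (hU i) t = coef n _ j (s i) := by
    intro j
    have hsj := fun i => mem_fibreDeg.1 (hs i) j
    rcases lt_or_ge k (n * j.1) with hk | hk
    · refine ⟨0, zero_mem _, fun i => ?_⟩
      rw [map_zero, (mem_degSub_of_lt hk).1 (hsj i)]
    · obtain ⟨t, ⟨ht, ht'⟩, -⟩ := X.glue (k - n * j.1) V U hU hc (fun i => coef n _ j (s i))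
        (fun i => (mem_degSub (by omega)).1 (hsj i)) (fun i i' W hi hi' => by
          rw [← coef_fibreRes, ← coef_fibreRes, hcomp i i' W hi hi'])
      exact ⟨t, (mem_degSub (by omega)).2 ht, ht'⟩
  choose t ht ht' using h1
  have hfin : (Function.support t).Finite := (finite_fibreExp_le hn k).subset fun j hj => by
    by_contra h
    exact hj ((mem_degSub_of_lt (not_le.1 h)).1 (ht j))
  let T : X.FibreFn n V := Finsupp.ofSupportFinite t hfin
  have hT : ∀ j, coef n _ j T = t j := fun j => rfl
  refine ⟨T, ⟨mem_fibreDeg.2 fun j => by rw [hT]; exact ht j, fun i => ext_coef fun j => ?_⟩, ?_⟩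
  · rw [coef_fibreRes, hT, ht']
  · rintro T' ⟨-, h⟩
    refine ext_coef fun j => X.eq_of_res_eq hU hc fun i => ?_
    rw [← coef_fibreRes, ← coef_fibreRes, h i]
    refine ext_coef (c := s i) (d := fibreRes (hU i) T) (fun j => ?_) ▸ rfl
    rw [coef_fibreRes, hT, ht']

variable (X) in
/-- The graded space `X × ℝ[n]`. -/
abbrev fibreSpace (hn : 1 ≤ n) : GradedSpace.{u} where
  carrier := X.carrier
  fn U := X.FibreFn n U
  deg U := X.fibreDeg n U
  one_mem U := emb_mem (X.one_mem U)
  mul_mem := fibreDeg_mul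
  isInternal U := fibreDeg_isInternal
  graded_comm := fibreDeg_comm
  res h := fibreRes h
  res_mem h k a ha := mem_fibreDeg.2 fun j => by
    rw [coef_fibreRes]; exact res_mem_degSub h (mem_fibreDeg.1 ha j)
  res_self a := ext_coef fun j => by rw [coef_fibreRes, X.res_self]
  res_res h h' a := ext_coef fun j => by simp only [coef_fibreRes, X.res_res]
  glue k V U hU hc s hs hcomp := fibre_glue hn k V U hU hc s hs hcomp

theorem fibreRes_emb (h : U ≤ V) (a : X.fn V) :
    fibreRes h (emb n (X.sgn n V) a) = emb n (X.sgn n U) (X.res h a) := map_emb a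

theorem fibreRes_tau (h : U ≤ V) : fibreRes h (tau n (X.sgn n V)) = tau n (X.sgn n U) := map_tau

/-- In a monomial of total degree `0` both the degree of the coefficient and `nj` vanish, so `j = 0`
since `n ≥ 1`. Thus the product has the same functions of degree zero as `X`, and the chart of the
body can be reused. -/
theorem exists_emb_of_mem_zero (hn : 1 ≤ n) {c : X.FibreFn n U} (hc : c ∈ X.fibreDeg n U 0) :
    ∃ a ∈ X.deg U 0, emb n (X.sgn n U) a = c := by
  refine fibreDeg_induction (p := (X.deg U 0).map (emb n (X.sgn n U)).toLinearMap) ?_ hc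
  intro i j a hij ha
  obtain rfl : i = 0 := by omega
  have : n * j = 0 := by omega
  obtain rfl : j = 0 := (Nat.mul_eq_zero.1 this).resolve_left (by omega)
  exact ⟨a, ha, rfl⟩

theorem coef_emb (a : X.fn U) : coef n (X.sgn n U) ⟨0, fun _ => Nat.zero_le _⟩ (emb n _ a) = a := by
  classical
  exact (coef_mono _ ⟨0, fun _ => Nat.zero_le _⟩ a).trans (if_pos rfl)

theorem emb_injective : Function.Injective (emb n (X.sgn n U)) := fun a b h => by
  rw [← coef_emb a, h, coef_emb]

end GradedSpace

theorem monomial_snoc {R : Type*} [Ring R] {q : ℕ} (ξ : Fin q → R) (t : R)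
    (μ : Fin (q + 1) → ℕ) : monomial (Fin.snoc (α := fun _ => R) ξ t) μ
      = monomial ξ (fun j => μ j.castSucc) * t ^ μ (Fin.last q) := by
  simp only [monomial, List.finRange_succ_last, List.map_append, List.map_map, List.prod_append,
    List.map_cons, List.map_nil, List.prod_cons, List.prod_nil, mul_one, Fin.snoc_last]
  congr 3
  ext j
  simp

/-- Exponents in `q + 1` variables. -/
def monoExpEquiv {q : ℕ} (d : Fin q → ℕ) (n : ℕ) :
    FibreExp n × MonoExp d ≃ MonoExp (Fin.snoc (α := fun _ => ℕ) d n) where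
  toFun p := ⟨Fin.snoc (α := fun _ => ℕ) p.2.1 p.1.1, fun j => by
    refine Fin.lastCases ?_ (fun j => ?_) j
    · simpa using p.1.2
    · simpa using p.2.2 j⟩
  invFun μ := ⟨⟨μ.1 (Fin.last q), by simpa using μ.2 (Fin.last q)⟩,
    ⟨fun j => μ.1 j.castSucc, fun j => by simpa using μ.2 j.castSucc⟩⟩
  left_inv p := by
    refine Prod.ext (Subtype.ext ?_) (Subtype.ext (funext fun j => ?_)) <;> simp
  right_inv μ := Subtype.ext (funext fun j => by
    refine Fin.lastCases ?_ (fun j => ?_) j <;> simp)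

open GradedSpace

/-- Expanding in `ξ_1, …, ξ_q, τ` means expanding each coefficient of a power of `τ` in the `ξ_j`.
As linear maps, this says that `L'` is, up to the reindexing isomorphism `G`, the map `K` applying
the bijection `L` coefficientwise. -/
theorem fibre_expand {X : GradedSpace.{u}} {n : ℕ} (hn : 1 ≤ n) {V : Opens X.carrier} {q : ℕ}
    {d : Fin q → ℕ} (ξ : Fin q → X.fn V)
    (h : ∀ a : X.fn V, ∃! c : MonoExp d →₀ X.fn V, (∀ μ, c μ ∈ X.deg V 0) ∧
      a = c.sum fun μ f => f * monomial ξ μ) (a : X.FibreFn n V) :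
    ∃! c : MonoExp (Fin.snoc (α := fun _ => ℕ) d n) →₀ X.FibreFn n V,
      (∀ μ, c μ ∈ X.fibreDeg n V 0) ∧
      a = c.sum fun μ f => f * monomial (Fin.snoc (α := fun _ => X.FibreFn n V)
        (fun j => emb n _ (ξ j)) (tau n _)) μ := by
  refine (existsUnique_expansion_iff (X.fibreDeg n V 0) (fun μ : MonoExp _ => monomial _ μ.1)).2
    ?_ a
  have hL := (existsUnique_expansion_iff (X.deg V 0) (fun μ : MonoExp d => monomial ξ μ)).1 h
  set L := (Finsupp.lsum ℝ fun μ : MonoExp d => LinearMap.mulRight ℝ (monomial ξ μ) ∘ₗ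
    (X.deg V 0).subtype : (MonoExp d →₀ X.deg V 0) →ₗ[ℝ] X.fn V) with hLdef
  let i0 : X.deg V 0 →ₗ[ℝ] X.fibreDeg n V 0 :=
    (emb n (X.sgn n V)).toLinearMap.restrict fun a ha => emb_mem ha
  have hi0 : Function.Bijective i0 := by
    constructor
    · intro a b hab
      exact Subtype.ext (emb_injective (congrArg Subtype.val hab))
    · rintro ⟨c, hc⟩
      obtain ⟨a, ha, rfl⟩ := exists_emb_of_mem_zero hn hc
      exact ⟨⟨a, ha⟩, rfl⟩
  let G : (FibreExp n →₀ MonoExp d →₀ X.deg V 0) ≃ₗ[ℝ]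
      (MonoExp (Fin.snoc (α := fun _ => ℕ) d n) →₀ X.fibreDeg n V 0) :=
    (Finsupp.curryLinearEquiv ℝ).symm ≪≫ₗ Finsupp.domLCongr (monoExpEquiv d n) ≪≫ₗ
      Finsupp.mapRange.linearEquiv (LinearEquiv.ofBijective i0 hi0)
  let K : (FibreExp n →₀ MonoExp d →₀ X.deg V 0) →ₗ[ℝ] X.FibreFn n V :=
    (Finsupp.mapRange.linearMap L : _ →ₗ[ℝ] FibreExp n →₀ X.fn V)
  have hK : Function.Bijective K :=
    ⟨Finsupp.mapRange_injective L (map_zero _) hL.1, Finsupp.mapRange_surjective L (map_zero _) hL.2⟩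
  set L' := (Finsupp.lsum ℝ fun μ : MonoExp (Fin.snoc (α := fun _ => ℕ) d n) =>
    LinearMap.mulRight ℝ (monomial (Fin.snoc (α := fun _ => X.FibreFn n V)
        (fun j => emb n _ (ξ j)) (tau n _)) μ.1) ∘ₗ (X.fibreDeg n V 0).subtype :
    (MonoExp (Fin.snoc (α := fun _ => ℕ) d n) →₀ X.fibreDeg n V 0) →ₗ[ℝ] X.FibreFn n V) with hL'
  have hcomp : L' ∘ₗ G.toLinearMap = K := by
    refine Finsupp.lhom_ext' fun j => Finsupp.lhom_ext fun ν a => ?_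
    have e1 : G (Finsupp.single j (Finsupp.single ν a))
        = Finsupp.single (monoExpEquiv d n (j, ν)) (i0 a) := by
      simp only [G, LinearEquiv.trans_apply]
      rw [Finsupp.curryLinearEquiv_symm_apply, Finsupp.uncurry_single, Finsupp.domLCongr_single]
      exact Finsupp.mapRange_single (hf := map_zero _)
    have e2 : K (Finsupp.single j (Finsupp.single ν a)) = single n _ j (a.1 * monomial ξ ν.1) := by
      have : L (Finsupp.single ν a) = a.1 * monomial ξ ν.1 := by
        rw [hLdef, Finsupp.lsum_single]; rfl
      rw [← this]
      exact Finsupp.mapRange_single (hf := map_zero _)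
    have e3 : L' (Finsupp.single (monoExpEquiv d n (j, ν)) (i0 a))
        = emb n _ a.1 * monomial (Fin.snoc (α := fun _ => X.FibreFn n V)
        (fun j => emb n _ (ξ j)) (tau n _)) (monoExpEquiv d n (j, ν)).1 := by
      rw [hL', Finsupp.lsum_single]; rfl
    have e4 : monomial (fun j => emb n (X.sgn n V) (ξ j))
        (fun i => (monoExpEquiv d n (j, ν)).1 i.castSucc) = emb n _ (monomial ξ ν.1) := by
      rw [map_monomial]
      congr 1
      ext i
      simp [monoExpEquiv]
    have e5 : (monoExpEquiv d n (j, ν)).1 (Fin.last q) = j.1 := by simp [monoExpEquiv]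
    show L' (G (Finsupp.single j (Finsupp.single ν a))) = K (Finsupp.single j (Finsupp.single ν a))
    rw [e1, e2, e3, monomial_snoc, e4, e5, ← mul_assoc, ← map_mul, ← mono_eq, mono_eq_single]
  have : Function.Bijective (L' ∘ G) := by
    have e : L' ∘ G = K := funext fun c => LinearMap.congr_fun hcomp c
    rw [e]; exact hK
  exact (Function.Bijective.of_comp_iff _ G.bijective).1 this

/-- The extension of an algebra homomorphism by zero on the variable. -/
def fibreVal (n : ℕ) {X : GradedSpace.{u}} {V : Opens X.carrier} {D : Type*} [Ring D] [Algebra ℝ D]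
    (g : X.fn V →ₐ[ℝ] D) : X.FibreFn n V →ₐ[ℝ] D :=
  FibreAlg.lift g 0 (fun a => by rw [zero_mul, mul_zero]) (fun _ => zero_mul _)

theorem fibreVal_emb {n : ℕ} {X : GradedSpace.{u}} {V : Opens X.carrier} {D : Type*} [Ring D]
    [Algebra ℝ D] (g : X.fn V →ₐ[ℝ] D) (a : X.fn V) : fibreVal n g (emb n _ a) = g a := lift_emb a

theorem fibreVal_tau {n : ℕ} {X : GradedSpace.{u}} {V : Opens X.carrier} {D : Type*} [Ring D]
    [Algebra ℝ D] (g : X.fn V →ₐ[ℝ] D) : fibreVal n g (tau n _) = 0 := lift_tau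

/-- Local coordinates on `X × ℝ[n]`. -/
def LocalCoords.fibre {X : GradedSpace.{u}} {n : ℕ} (hn : 1 ≤ n) {U : Opens X.carrier}
    (c : LocalCoords X U) : LocalCoords (X.fibreSpace hn) U where
  p := c.p
  chart := c.chart
  source_eq := c.source_eq
  val (V : Opens X.carrier) hV := fibreVal n (c.val V hV)
  val_res (V W : Opens X.carrier) hV hW a x := by
    have : ((Pi.evalAlgHom ℝ (fun _ : W => ℝ) x).comp
          (fibreVal n (c.val W (hW.trans hV)))).comp (fibreRes hW)
        = (Pi.evalAlgHom ℝ (fun _ : V => ℝ) ⟨x.1, hW x.2⟩).comp (fibreVal n (c.val V hV)) := by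
      refine FibreAlg.algHom_ext (fun a => ?_) ?_
      · simp only [AlgHom.comp_apply, fibreRes_emb, fibreVal_emb]
        exact c.val_res V W hV hW a x
      · simp only [AlgHom.comp_apply, fibreRes_tau, fibreVal_tau, map_zero]
    exact DFunLike.congr_fun this a
  val_inj (V : Opens X.carrier) hV a ha h := by
    obtain ⟨b, hb, rfl⟩ := exists_emb_of_mem_zero hn ha
    rw [fibreVal_emb] at h
    rw [c.val_inj V hV b hb h, map_zero]
  val_range (V : Opens X.carrier) hV g := by
    rw [← c.val_range V hV g]
    constructor
    · rintro ⟨a, ha, h⟩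
      obtain ⟨b, hb, rfl⟩ := exists_emb_of_mem_zero hn ha
      rw [fibreVal_emb] at h
      exact ⟨b, hb, h⟩
    · rintro ⟨b, hb, h⟩
      exact ⟨emb n _ b, emb_mem hb, by rw [fibreVal_emb]; exact h⟩
  q := c.q + 1
  d := Fin.snoc (α := fun _ => ℕ) c.d n
  d_pos j := by
    refine Fin.lastCases ?_ (fun j => ?_) j
    · rw [Fin.snoc_last]; exact hn
    · rw [Fin.snoc_castSucc]; exact c.d_pos j
  ξ := Fin.snoc (α := fun _ => X.FibreFn n U) (fun j => emb n _ (c.ξ j)) (tau n _)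
  ξ_mem j := by
    refine Fin.lastCases ?_ (fun j => ?_) j
    · rw [Fin.snoc_last, Fin.snoc_last]; exact tau_mem
    · rw [Fin.snoc_castSucc, Fin.snoc_castSucc]; exact emb_mem (c.ξ_mem j)
  expand (V : Opens X.carrier) hV a := by
    have e : ∀ μ, fibreRes hV (monomial (Fin.snoc (α := fun _ => X.FibreFn n U)
        (fun j => emb n _ (c.ξ j)) (tau n _)) μ)
        = monomial (Fin.snoc (α := fun _ => X.FibreFn n V)
        (fun j => emb n _ (X.res hV (c.ξ j))) (tau n _)) μ := by
      intro μ
      rw [monomial_snoc, monomial_snoc, map_mul, map_pow, fibreRes_tau, map_monomial]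
      simp only [fibreRes_emb]
    simp only [e]
    refine fibre_expand hn (fun j => X.res hV (c.ξ j)) (fun a => ?_) a
    simp only [← map_monomial]
    exact c.expand V hV a

end NQ

end
-- The vector field `Q + η ∂/∂τ` on `X × ℝ[n]`.
noncomputable section

namespace NQ

open GradedSpace FibreAlg

namespace NQManifold

variable {X : NQManifold.{u}} {U V : Opens X.carrier}

/-- Writing the sign as the grade involution `sgn 1` frees the Leibniz rule from homogeneity, so it
can be applied to arbitrary coefficients. -/
theorem Q_mul_sgn (a b : X.fn U) : X.Q U (a * b) = X.Q U a * b + X.sgn 1 U a * X.Q U b := by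
  have : X.Q U ∘ₗ LinearMap.mulRight ℝ b = LinearMap.mulRight ℝ b ∘ₗ X.Q U
      + LinearMap.mulRight ℝ (X.Q U b) ∘ₗ (X.sgn 1 U).toLinearMap :=
    linearMap_ext fun k a ha => by
      simp only [LinearMap.comp_apply, LinearMap.mulRight_apply, LinearMap.add_apply,
        AlgHom.toLinearMap_apply]
      rw [X.Q_mul ha, sgn_of_mem ha, one_mul, smul_mul_assoc]
  exact LinearMap.congr_fun this a

theorem Q_one : X.Q U 1 = 0 := by
  have h := Q_mul_sgn (X := X) (U := U) 1 1
  simpa using h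

theorem Q_sgn (e : ℕ) (a : X.fn U) :
    X.Q U (X.sgn e U a) = (-1 : ℝ) ^ e • X.sgn e U (X.Q U a) := by
  have : X.Q U ∘ₗ (X.sgn e U).toLinearMap
      = (-1 : ℝ) ^ e • ((X.sgn e U).toLinearMap ∘ₗ X.Q U) :=
    linearMap_ext fun k a ha => by
      simp only [LinearMap.comp_apply, LinearMap.smul_apply, AlgHom.toLinearMap_apply]
      rw [sgn_of_mem ha, sgn_of_mem (X.Q_mem ha), map_smul, smul_smul, ← pow_add]
      congr 1
      rw [show e + e * (k + 1) = e * k + 2 * e by ring, pow_add, pow_mul _ 2, neg_one_sq, one_pow,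
        mul_one]
  exact LinearMap.congr_fun this a

end NQManifold

open NQManifold

section fibreQ

variable {n : ℕ} {X : NQManifold.{u}} {U V : Opens X.carrier}

variable (n) in
/-- The vector field `Q + η ∂/∂τ`. -/
def fibreQ (η : X.fn U) : X.FibreFn n U →ₗ[ℝ] X.FibreFn n U :=
  -- The formula is `a τ^k ↦ Q(a) τ^k + k sgn(a) η τ^(k-1)`. For `k = 0` the truncated exponent is
  -- harmless, since the term has the factor `0`.
  elim fun k : FibreExp n => mono n _ k.1 ∘ₗ X.Q U
    + (k.1 : ℝ) • (mono n _ (k.1 - 1) ∘ₗ LinearMap.mulRight ℝ η ∘ₗ (X.sgn 1 U).toLinearMap)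

theorem fibreQ_mono (η : X.fn U) {k : ℕ} (hk : Odd n → k ≤ 1) (a : X.fn U) :
    fibreQ n η (mono n _ k a) = mono n _ k (X.Q U a)
      + (k : ℝ) • mono n _ (k - 1) (X.sgn 1 U a * η) := by
  rw [mono_eq_single ⟨k, hk⟩, fibreQ, elim_single]; rfl

theorem fibreQ_emb (η : X.fn U) (a : X.fn U) :
    fibreQ n η (emb n _ a) = emb n _ (X.Q U a) := by
  rw [emb_apply, fibreQ_mono η (fun _ => Nat.zero_le _)]; simp [emb_apply]

theorem fibreQ_tau (η : X.fn U) : fibreQ n η (tau n _) = emb n _ η := by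
  rw [tau, fibreQ_mono η (fun _ => le_rfl), Q_one]; simp [emb_apply]

theorem emb_mul_mono (k : ℕ) (a b : X.fn U) :
    emb n (X.sgn n U) a * mono n _ k b = mono n _ k (a * b) := by
  rw [emb_apply, mono_mul_mono]; simp

theorem tau_mul_mono (k : ℕ) (b : X.fn U) :
    tau n (X.sgn n U) * mono n _ k b = mono n _ (k + 1) (X.sgn n U b) := by
  rw [tau, mono_mul_mono]; simp [add_comm]

variable (X n U) in
/-- The grade involution. -/
def fibreInv : X.FibreFn n U →ₐ[ℝ] X.FibreFn n U :=
  FibreAlg.lift ((emb n _).comp (X.sgn 1 U)) ((-1 : ℝ) ^ n • tau n _)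
    (fun a => by
      rw [AlgHom.comp_apply, AlgHom.comp_apply, smul_mul_assoc, tau_mul_emb, sgn_sgn,
        mul_smul_comm])
    (fun h => by rw [smul_mul_smul_comm, tau_mul_tau h, smul_zero])

theorem fibreInv_emb (a : X.fn U) : fibreInv n X U (emb n _ a) = emb n _ (X.sgn 1 U a) := lift_emb a

theorem fibreInv_tau : fibreInv n X U (tau n _) = (-1 : ℝ) ^ n • tau n _ := lift_tau

theorem fibreInv_of_mem {k : ℕ} {c : X.FibreFn n U} (hc : c ∈ X.fibreDeg n U k) :
    fibreInv n X U c = (-1 : ℝ) ^ k • c := by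
  refine fibreDeg_induction (p := LinearMap.eqLocus (fibreInv n X U).toLinearMap
    ((-1 : ℝ) ^ k • LinearMap.id)) ?_ hc
  intro i j a hij ha
  rw [LinearMap.mem_eqLocus, AlgHom.toLinearMap_apply, LinearMap.smul_apply, LinearMap.id_apply,
    mono_eq, map_mul, map_pow, fibreInv_emb, fibreInv_tau, sgn_of_mem ha, smul_pow, map_smul,
    smul_mul_smul_comm, ← hij, pow_add, pow_mul _ n, one_mul]

theorem sgn_add_one (a : X.fn U) : X.sgn (n + 1) U a = X.sgn n U (X.sgn 1 U a) := by
  have : X.sgn (n + 1) U = (X.sgn n U).comp (X.sgn 1 U) := algHom_ext fun k a ha => by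
    rw [AlgHom.comp_apply, sgn_of_mem ha, sgn_of_mem ha, map_smul, sgn_of_mem ha, smul_smul,
      ← pow_add]
    congr 2; ring
  rw [this]; rfl

/-- The product `n(n+1)` is even, so `τ` and `η` commute without sign. -/
theorem sgn_eta {η : X.fn U} (hη : η ∈ X.deg U (n + 1)) : X.sgn n U η = η := by
  rw [sgn_of_mem hη, (Nat.even_mul_succ_self n).neg_one_pow, one_smul]

/-- On `b τ^k` the `η`-terms match because `k + 1 = 1 + (-1)^n k` as long as `τ^(k+1) ≠ 0`: for odd
`n` this forces `k = 0`. In the remaining case, `n` odd and `k = 1`, the left side vanishes and the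
two `η`-terms on the right cancel. -/
theorem fibreQ_tau_mul {η : X.fn U} (hη : η ∈ X.deg U (n + 1)) (c : X.FibreFn n U) :
    fibreQ n η (tau n _ * c) = emb n _ η * c + fibreInv n X U (tau n _) * fibreQ n η c := by
  have : fibreQ n η ∘ₗ LinearMap.mulLeft ℝ (tau n _) = LinearMap.mulLeft ℝ (emb n _ η)
      + LinearMap.mulLeft ℝ (fibreInv n X U (tau n _)) ∘ₗ fibreQ n η := by
    refine FibreAlg.linearMap_ext fun ⟨k, hk⟩ b => ?_
    simp only [LinearMap.comp_apply, LinearMap.mulLeft_apply, LinearMap.add_apply]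
    have h1 : (k : ℝ) • mono n (X.sgn n U) (k - 1 + 1) = (k : ℝ) • mono n (X.sgn n U) k := by
      rcases Nat.eq_zero_or_pos k with rfl | h
      · simp
      · rw [Nat.sub_add_cancel h]
    have h2 : tau n (X.sgn n U) * (k : ℝ) • mono n _ (k - 1) (X.sgn 1 U b * η)
        = (k : ℝ) • mono n _ k (X.sgn n U (X.sgn 1 U b) * η) := by
      rw [mul_smul_comm, tau_mul_mono, map_mul, sgn_eta hη, ← LinearMap.smul_apply, h1]; rfl
    rw [tau_mul_mono, emb_mul_mono, fibreInv_tau, fibreQ_mono η hk, smul_mul_assoc, mul_add,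
      tau_mul_mono, h2, mul_comm_sgn hη, sgn_add_one]
    by_cases hk1 : Odd n → k + 1 ≤ 1
    · rw [fibreQ_mono η hk1, Q_sgn, map_smul, sgn_sgn 1 n, Nat.add_sub_cancel, smul_add, smul_smul]
      have h3 : ((k + 1 : ℕ) : ℝ) = 1 + (-1) ^ n * k := by
        rcases Nat.even_or_odd n with he | ho
        · rw [he.neg_one_pow]; push_cast; ring
        · have := hk1 ho
          obtain rfl : k = 0 := by omega
          simp
      rw [h3, add_smul, one_smul]
      abel
    · obtain ⟨ho, hk2⟩ := Classical.not_imp.1 hk1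
      have := hk ho
      obtain rfl : k = 1 := by omega
      rw [mono_of_not hk1]
      simp [ho.neg_one_pow]
  exact LinearMap.congr_fun this c

/-- The elements `c` that satisfy the rule for all `d` form a subalgebra, so only the generators
`emb a` and `τ` have to be tested. -/
theorem fibreQ_mul {η : X.fn U} (hη : η ∈ X.deg U (n + 1)) (c d : X.FibreFn n U) :
    fibreQ n η (c * d) = fibreQ n η c * d + fibreInv n X U c * fibreQ n η d := by
  let S : Subalgebra ℝ (X.FibreFn n U) :=
    { carrier := {c | ∀ d, fibreQ n η (c * d)
        = fibreQ n η c * d + fibreInv n X U c * fibreQ n η d}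
      mul_mem' := fun {a b} ha hb d => by
        rw [mul_assoc, ha, hb, ha b, map_mul]; noncomm_ring
      add_mem' := fun {a b} ha hb d => by
        rw [add_mul, map_add, ha, hb, map_add, map_add]; noncomm_ring
      algebraMap_mem' := fun r d => by
        have h0 : fibreQ n η (1 : X.FibreFn n U) = 0 := by
          have := fibreQ_emb (n := n) η 1
          rwa [map_one, Q_one, map_zero] at this
        rw [AlgHom.commutes, Algebra.algebraMap_eq_smul_one, smul_mul_assoc, one_mul, map_smul,
          map_smul, h0, smul_zero, zero_mul, zero_add, smul_mul_assoc, one_mul] }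
  refine mem_of_generators S (fun a d => ?_) (fun d => ?_) c d
  · have : fibreQ n η ∘ₗ LinearMap.mulLeft ℝ (emb n _ a) = LinearMap.mulLeft ℝ (emb n _ (X.Q U a))
        + LinearMap.mulLeft ℝ (emb n _ (X.sgn 1 U a)) ∘ₗ fibreQ n η := by
      refine FibreAlg.linearMap_ext fun ⟨k, hk⟩ b => ?_
      simp only [LinearMap.comp_apply, LinearMap.mulLeft_apply, LinearMap.add_apply]
      rw [emb_mul_mono, emb_mul_mono, fibreQ_mono η hk, fibreQ_mono η hk, mul_add, mul_smul_comm,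
        emb_mul_mono, emb_mul_mono, Q_mul_sgn, map_add, map_mul (X.sgn 1 U), mul_assoc (X.sgn 1 U a),
        add_assoc]
    rw [fibreInv_emb, fibreQ_emb]
    exact LinearMap.congr_fun this d
  · rw [fibreQ_tau_mul hη, fibreQ_tau]

/-- On `a τ^k` the mixed terms cancel, because `Q` anticommutes with the grade involution and `Qη =
0`. The last term has the factor `k(k-1)` and contains `sgn(η) η`: for even `n` this product
vanishes since `η` is odd, and for odd `n` one has `k ≤ 1`. -/
theorem fibreQ_fibreQ {η : X.fn U} (hη : η ∈ X.deg U (n + 1)) (hQ : X.Q U η = 0)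
    (c : X.FibreFn n U) : fibreQ n η (fibreQ n η c) = 0 := by
  have : fibreQ n η ∘ₗ fibreQ n η = 0 := by
    refine FibreAlg.linearMap_ext fun ⟨k, hk⟩ a => ?_
    have hk' : Odd n → k - 1 ≤ 1 := fun h => (Nat.sub_le k 1).trans (hk h)
    have h1 : (k : ℝ) • ((k - 1 : ℕ) : ℝ) • mono n (X.sgn n U) (k - 1 - 1)
        (X.sgn 1 U (X.sgn 1 U a * η) * η) = 0 := by
      rcases Nat.even_or_odd n with he | ho
      · have : X.sgn 1 U η * η = 0 := by
          rw [sgn_of_mem hη, smul_mul_assoc, mul_self_of_odd he.add_one hη, smul_zero]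
        rw [map_mul (X.sgn 1 U), mul_assoc, this, mul_zero, map_zero, smul_zero, smul_zero]
      · have := hk ho
        rw [show k - 1 = 0 by omega]; simp
    rw [LinearMap.comp_apply, LinearMap.zero_apply, fibreQ_mono η hk, map_add, map_smul,
      fibreQ_mono η hk, fibreQ_mono η hk', X.Q_Q, smul_add, h1, Q_mul_sgn, hQ, Q_sgn]
    simp
  exact LinearMap.congr_fun this c

theorem fibreQ_mem {η : X.fn U} (hη : η ∈ X.deg U (n + 1)) {k : ℕ} {c : X.FibreFn n U}
    (hc : c ∈ X.fibreDeg n U k) : fibreQ n η c ∈ X.fibreDeg n U (k + 1) := by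
  refine fibreDeg_induction (p := (X.fibreDeg n U (k + 1)).comap (fibreQ n η)) ?_ hc
  intro i j a hij ha
  rw [Submodule.mem_comap]
  by_cases hj : Odd n → j ≤ 1
  swap
  · rw [mono_of_not hj, LinearMap.zero_apply, map_zero]; exact zero_mem _
  rw [fibreQ_mono η hj]
  refine add_mem (mono_mem (by omega) (X.Q_mem ha)) ?_
  rcases Nat.eq_zero_or_pos j with rfl | h
  · simp
  · refine Submodule.smul_mem _ _ (mono_mem ?_ (X.mul_mem (sgn_mem ha 1) hη))
    obtain ⟨j, rfl⟩ : ∃ l, j = l + 1 := ⟨j - 1, by omega⟩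
    rw [Nat.add_sub_cancel, ← hij]; ring

theorem fibreQ_res (h : U ≤ V) (η : X.fn V) (c : X.FibreFn n V) :
    fibreQ n (X.res h η) (fibreRes h c) = fibreRes h (fibreQ n η c) := by
  have : fibreQ n (X.res h η) ∘ₗ (fibreRes h).toLinearMap
      = (fibreRes h).toLinearMap ∘ₗ fibreQ n η := by
    refine FibreAlg.linearMap_ext fun ⟨k, hk⟩ a => ?_
    simp only [LinearMap.comp_apply, AlgHom.toLinearMap_apply, fibreRes]
    rw [map_mono, fibreQ_mono _ hk, fibreQ_mono _ hk, map_add, map_smul, map_mono, map_mono,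
      X.Q_res, map_mul (X.res h), sgn_res]
  exact LinearMap.congr_fun this c

end fibreQ

/-- The N-manifold `X × ℝ[n]`. -/
abbrev NManifold.fibre (X : NManifold.{u}) {n : ℕ} (hn : 1 ≤ n) : NManifold.{u} where
  toGradedSpace := X.toGradedSpace.fibreSpace hn
  t2 := X.t2
  secondCountable := X.secondCountable
  locally_model := fun (x : X.carrier) => by
    obtain ⟨U, hx, ⟨c⟩⟩ := X.locally_model x
    exact ⟨U, hx, ⟨c.fibre hn⟩⟩

/-- The NQ-manifold `X × ℝ[n]` with the vector field `Q + η ∂/∂τ`. -/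
abbrev NQManifold.fibre (X : NQManifold.{u}) {n : ℕ} (hn : 1 ≤ n) (η : X.fn ⊤)
    (hη : η ∈ X.deg ⊤ (n + 1)) (hQ : X.Q ⊤ η = 0) : NQManifold.{u} where
  toNManifold := X.toNManifold.fibre hn
  Q := fun (U : Opens X.carrier) => fibreQ n (X.res le_top η : X.fn U)
  Q_mem ha := fibreQ_mem (X.res_mem le_top hη) ha
  Q_mul {U k a} ha b := by
    rw [fibreQ_mul (X.res_mem le_top hη), fibreInv_of_mem ha, smul_mul_assoc]
  Q_res h a := by
    have := fibreQ_res (n := n) h (X.res le_top η) a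
    rwa [X.res_res] at this
  Q_Q a := fibreQ_fibreQ (X.res_mem le_top hη) (by rw [X.Q_res, hQ, map_zero]) a

/-! ### Maps into `X × ℝ[n]`. -/

namespace NMap

variable {S X : NManifold.{u}} {n : ℕ} {hn : 1 ≤ n}

theorem pull_sgn (φ : NMap S X) (e : ℕ) {V : Opens X.carrier} (a : X.fn V) :
    S.sgn e _ (φ.pull V a) = φ.pull V (X.sgn e V a) := by
  have h : (S.sgn e _).comp (φ.pull V) = (φ.pull V).comp (X.sgn e V) :=
    GradedSpace.algHom_ext fun k a ha => by
      rw [AlgHom.comp_apply, AlgHom.comp_apply, sgn_of_mem ha, sgn_of_mem (φ.pull_mem ha),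
        map_smul]
  exact DFunLike.congr_fun h a

/-- The projection `X × ℝ[n] → X`. -/
def fibreProj (X : NManifold.{u}) {n : ℕ} (hn : 1 ≤ n) : NMap (X.fibre hn) X where
  base := .id _
  pull V := emb n (X.sgn n V)
  pull_mem h := emb_mem h
  pull_res h a := (fibreRes_emb h a).symm

/-- Pullback of functions along the map to `X × ℝ[n]` with given components. -/
def fibrePull (φ : NMap S X) (f : MapToR n S) (V : Opens X.carrier) :
    X.FibreFn n V →ₐ[ℝ] S.fn (Opens.comap φ.base V) :=
  FibreAlg.lift (φ.pull V) (S.res le_top f.1)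
    (fun a => by
      have h := mul_comm_sgn (S.res_mem (le_top : Opens.comap φ.base V ≤ ⊤) f.2) (φ.pull V a)
      rw [h, pull_sgn])
    (fun h => mul_self_of_odd h (S.res_mem _ f.2))

theorem fibrePull_emb (φ : NMap S X) (f : MapToR n S) {V : Opens X.carrier} (a : X.fn V) :
    fibrePull φ f V (emb n _ a) = φ.pull V a := lift_emb a

theorem fibrePull_tau (φ : NMap S X) (f : MapToR n S) (V : Opens X.carrier) :
    fibrePull φ f V (tau n _) = S.res le_top f.1 := lift_tau

/-- The map to `X × ℝ[n]` with given components. -/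
def fibrePair (hn : 1 ≤ n) (φ : NMap S X) (f : MapToR n S) : NMap S (X.fibre hn) where
  base := φ.base
  pull := fibrePull φ f
  pull_mem {V k a} ha := by
    refine fibreDeg_induction (p := (S.deg _ k).comap (fibrePull φ f V).toLinearMap) ?_ ha
    intro i j a hij ha
    rw [Submodule.mem_comap, AlgHom.toLinearMap_apply, mono_eq, map_mul, map_pow, fibrePull_emb,
      fibrePull_tau, ← hij, mul_comm n j]
    exact S.mul_mem (φ.pull_mem ha) (SetLike.pow_mem_graded j (S.res_mem le_top f.2))
  pull_res {V W} h a := by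
    refine DFunLike.congr_fun (FibreAlg.algHom_ext (f := (fibrePull φ f V).comp (fibreRes h))
      (g := (S.res (Opens.comap_mono φ.base h)).comp (fibrePull φ f W)) (fun a => ?_) ?_) a
    · rw [AlgHom.comp_apply, AlgHom.comp_apply, fibreRes_emb, fibrePull_emb, fibrePull_emb,
        φ.pull_res]
    · rw [AlgHom.comp_apply, AlgHom.comp_apply, fibreRes_tau, fibrePull_tau, fibrePull_tau,
        S.res_res]

theorem fibreProj_comp_fibrePair (φ : NMap S X) (f : MapToR n S) :
    (fibreProj X hn).comp (fibrePair hn φ f) = φ :=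
  ext_res rfl fun _ a => (fibrePull_emb φ f a).trans (S.res_self _).symm

/-- The fibre coordinate on `X × ℝ[n]`. -/
def fibreTau (X : NManifold.{u}) {n : ℕ} (hn : 1 ≤ n) : (X.fibre hn).fn ⊤ := tau n (X.sgn n ⊤)

theorem fibrePair_tau (φ : NMap S X) (f : MapToR n S) :
    (fibrePair hn φ f).pullTop (W := ⊤) (fun _ => trivial) (fibreTau X hn) = f.1 :=
  (congrArg (S.res (U := ⊤) (V := Opens.comap φ.base ⊤) le_top) (fibrePull_tau φ f ⊤)).trans
    ((S.res_res _ _ _).trans (S.res_self _))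

/-- The variable over `V` is the restriction of the global one, so a single function of degree `n`
on `S` governs the pullback of `τ` over all open sets. -/
theorem pull_tau_eq (φ : NMap S (X.fibre hn)) (V : Opens X.carrier) :
    φ.pull V (tau n (X.sgn n V)) = S.res le_top (φ.pullTop (W := ⊤) (fun _ => trivial) (fibreTau X hn)) := by
  refine Eq.trans ?_ (S.res_res _ _ _).symm
  exact (congrArg (φ.pull V) (fibreRes_tau (X := X.toGradedSpace) (le_top : V ≤ ⊤)).symm).trans
    (φ.pull_res (le_top : V ≤ ⊤) _)

/-- Maps to `X × ℝ[n]` are determined by their components. -/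
theorem fibre_ext {φ ψ : NMap S (X.fibre hn)}
    (h : (fibreProj X hn).comp φ = (fibreProj X hn).comp ψ)
    (h' : φ.pullTop (W := ⊤) (fun _ => trivial) (fibreTau X hn)
      = ψ.pullTop (W := ⊤) (fun _ => trivial) (fibreTau X hn)) : φ = ψ := by
  have hb : φ.base = ψ.base := congrArg (fun χ : NMap S X => χ.base) h
  refine ext_res hb fun (V : Opens X.carrier) a => ?_
  refine DFunLike.congr_fun (FibreAlg.algHom_ext (f := φ.pull V)
    (g := (S.res _).comp (ψ.pull V)) (fun a => ?_) ?_) a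
  · exact pull_congr h V a
  · rw [AlgHom.comp_apply, pull_tau_eq, pull_tau_eq, h', S.res_res]

end NMap

open NMap

/-- A map to `X × ℝ[n]` is an NQ-map if its components intertwine the vector fields. -/
theorem isNQMap_fibre {S X : NQManifold.{u}} {n : ℕ} {hn : 1 ≤ n} {η : X.fn ⊤}
    {hη : η ∈ X.deg ⊤ (n + 1)} {hQ : X.Q ⊤ η = 0}
    (φ : NMap S.toNManifold (X.fibre hn η hη hQ).toNManifold)
    (h : IsNQMap (X := S) (Y := X) ((fibreProj X.toNManifold hn).comp φ))
    (h' : S.Q ⊤ (φ.pullTop (W := ⊤) (fun _ => trivial) (fibreTau X.toNManifold hn))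
      = ((fibreProj X.toNManifold hn).comp φ).pullTop (W := ⊤) (fun _ => trivial) η) :
    IsNQMap (X := S) (Y := X.fibre hn η hη hQ) φ := by
  intro (V : Opens X.carrier) (a : X.FibreFn n V)
  -- Both sides are derivations along `φ.pull V`, so they agree on a subalgebra; the hypotheses are
  -- agreement on its generators.
  let A : Subalgebra ℝ (X.FibreFn n V) :=
    { carrier := {a | φ.pull V (fibreQ n (X.res le_top η : X.fn V) a) = S.Q _ (φ.pull V a)}
      mul_mem' := fun {a b} ha hb => by
        have e := pull_sgn φ 1 (V := V) a
        have e2 : fibreInv n X V a = (X.fibre hn η hη hQ).sgn 1 V a := by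
          refine DFunLike.congr_fun (f := fibreInv n X V) (GradedSpace.algHom_ext
            (X := (X.fibre hn η hη hQ).toGradedSpace) fun k a ha => ?_) a
          rw [sgn_of_mem ha, one_mul]; exact fibreInv_of_mem ha
        rw [Set.mem_ofPred_eq] at ha hb ⊢
        rw [fibreQ_mul (X.res_mem le_top hη), map_add, map_mul, map_mul, map_mul, ha, hb,
          Q_mul_sgn, e2]
        congr 2
        exact e.symm
      add_mem' := fun {a b} ha hb => by
        rw [Set.mem_ofPred_eq] at ha hb ⊢
        rw [map_add, map_add, map_add, map_add, ha, hb]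
      algebraMap_mem' := fun r => by
        rw [Set.mem_ofPred_eq, Algebra.algebraMap_eq_smul_one, map_smul, map_smul, map_smul,
          map_smul, map_one (φ.pull V), Q_one, ← map_one (emb n (X.sgn n V)), fibreQ_emb, Q_one,
          map_zero, map_zero] }
  refine mem_of_generators A (fun a => ?_) ?_ a
  · show φ.pull V (fibreQ n _ (emb n _ a)) = S.Q _ (φ.pull V (emb n _ a))
    rw [fibreQ_emb]
    exact h V a
  · show φ.pull V (fibreQ n _ (tau n _)) = S.Q _ (φ.pull V (tau n _))
    rw [fibreQ_tau, pull_tau_eq, S.Q_res, h']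
    refine Eq.trans ?_ (S.res_res _ _ _).symm
    exact ((fibreProj X.toNManifold hn).comp φ).pull_res le_top η

end NQ

end
-- Trivializations: restriction, change of coordinate, locality.
noncomputable section

namespace NQ

open GradedSpace FibreAlg NManifold NMap

namespace NMap

variable {S X : NManifold.{u}}

/-- A map with image in an open subset, as a map to the part over this subset. -/
def factor {U : Opens X.carrier} (φ : NMap S X) (h : ∀ s, φ.base s ∈ U) :
    NMap S (X.restrict U) where
  base := ⟨fun s => ⟨φ.base s, h s⟩, by fun_prop⟩
  pull W := (S.res (show Opens.comap ⟨fun s => (⟨φ.base s, h s⟩ : U), by fun_prop⟩ W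
    ≤ Opens.comap φ.base (img W) from fun s hs => mem_img.2 ⟨h s, hs⟩)).comp (φ.pull (img W))
  pull_mem ha := S.res_mem _ (φ.pull_mem ha)
  pull_res hVW a := by
    refine (congrArg (S.res _) (φ.pull_res (img_mono hVW) a)).trans ?_
    exact (S.res_res _ _ _).trans (S.res_res _ _ _).symm

theorem incl_comp_factor {U : Opens X.carrier} (φ : NMap S X) (h : ∀ s, φ.base s ∈ U) :
    (incl U).comp (φ.factor h) = φ :=
  ext_res rfl fun V a => by
    refine (congrArg (S.res _) (φ.pull_res _ a)).trans ?_
    exact S.res_res _ _ _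

theorem incl_mem {U : Opens X.carrier} (x : (X.restrict U).carrier) : (incl U).base x ∈ U := x.2

/-- A section is constructed as a map from an open submanifold. This turns functions obtained by
pulling back along it into functions on `U` itself. -/
theorem exists_pullTop_incl {U : Opens X.carrier} {k : ℕ} {a : (X.restrict U).fn ⊤}
    (ha : a ∈ (X.restrict U).deg ⊤ k) :
    ∃ b ∈ X.deg U k, (incl U).pullTop incl_mem b = a := by
  have hU : U ≤ img (⊤ : Opens U) := fun x hx => mem_img.2 ⟨hx, trivial⟩
  refine ⟨X.res hU a, X.res_mem _ ha, ?_⟩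
  refine (X.res_res _ _ _).trans ((X.res_res _ _ _).trans (X.res_self _))

theorem pullTop_Q {S X : NQManifold.{u}} {φ : NMap S.toNManifold X.toNManifold} (hφ : IsNQMap φ)
    {W : Opens X.carrier} (h : ∀ s, φ.base s ∈ W) (a : X.fn W) :
    φ.pullTop h (X.Q W a) = S.Q ⊤ (φ.pullTop h a) :=
  (congrArg (S.res _) (hφ W a)).trans (S.Q_res _ _).symm

end NMap

namespace RnSpace

variable {n : ℕ} {B : NQManifold.{u}} {P : RnSpace n B} {U V : Opens B.carrier}
  {ξ : P.total.fn (P.over U)}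

theorem over_mono (P : RnSpace n B) (h : V ≤ U) : P.over V ≤ P.over U :=
  Opens.comap_mono P.proj.base h

/-- The pullback of functions on `U`. -/
def pullOver (P : RnSpace n B) (U : Opens B.carrier) : B.fn U →ₐ[ℝ] P.total.fn (P.over U) :=
  P.proj.pull U

theorem pullOver_mem {k : ℕ} {a : B.fn U} (ha : a ∈ B.deg U k) :
    P.pullOver U a ∈ P.total.deg (P.over U) k := P.proj.pull_mem ha

theorem pullOver_res (h : V ≤ U) (a : B.fn U) :
    P.pullOver V (B.res h a) = P.total.res (P.over_mono h) (P.pullOver U a) := P.proj.pull_res h a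

theorem base_eq {S : NManifold.{u}} {φ : NMap S P.total.toNManifold}
    {φ₀ : NMap S B.toNManifold} (h : P.proj.comp φ = φ₀) (s : S.carrier) :
    P.proj.base (φ.base s) = φ₀.base s :=
  congrArg (fun χ : NMap S B.toNManifold => χ.base s) h

namespace IsTriv

theorem exists_lift (hξ : P.IsTriv U ξ) {S : NManifold.{u}} (φ₀ : NMap S B.toNManifold)
    (h : ∀ s, φ₀.base s ∈ U) (f : MapToR n S) :
    ∃ φ : NMap S P.total.toNManifold, P.proj.comp φ = φ₀ ∧
      ∀ h : ∀ s, φ.base s ∈ P.over U, φ.pullTop h ξ = f := by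
  obtain ⟨φ, ⟨h1, h2, h3⟩, -⟩ := hξ.bijective S φ₀ h f
  exact ⟨φ, h1, fun _ => h3⟩

theorem hom_ext (hξ : P.IsTriv U ξ) {S : NManifold.{u}} {φ ψ : NMap S P.total.toNManifold}
    (h : P.proj.comp φ = P.proj.comp ψ) (hφ : ∀ s, φ.base s ∈ P.over U)
    (hψ : ∀ s, ψ.base s ∈ P.over U) (h' : φ.pullTop hφ ξ = ψ.pullTop hψ ξ) : φ = ψ :=
  (hξ.bijective S (P.proj.comp ψ) hψ ⟨ψ.pullTop hψ ξ, ψ.pullTop_mem hψ hξ.mem⟩).unique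
    ⟨h, hφ, h'⟩ ⟨rfl, hψ, rfl⟩

theorem over_act (P : RnSpace n B) {S : NManifold.{u}} (φ : NMap S P.total.toNManifold)
    (f : MapToR n S) (h : ∀ s, φ.base s ∈ P.over U) (s : S.carrier) :
    (P.act f φ).base s ∈ P.over U := by
  show P.proj.base ((P.act f φ).base s) ∈ U
  rw [base_eq (P.proj_act f φ) s]
  exact h s

/-- This is the converse of `exists_lift` and `hom_ext`. That a lift lands over `U` follows from its
projection and need not be supplied. -/
theorem of_lift {ξ : P.total.fn (P.over U)} (hm : ξ ∈ P.total.deg (P.over U) n)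
    (he : ∀ (S : NManifold.{u}) (φ : NMap S P.total.toNManifold) (f : MapToR n S)
      (h : ∀ s, φ.base s ∈ P.over U) (h' : ∀ s, (P.act f φ).base s ∈ P.over U),
      (P.act f φ).pullTop h' ξ = f + φ.pullTop h ξ)
    (h1 : ∀ (S : NManifold.{u}) (φ₀ : NMap S B.toNManifold), (∀ s, φ₀.base s ∈ U) →
      ∀ f : MapToR n S, ∃ φ : NMap S P.total.toNManifold, P.proj.comp φ = φ₀ ∧
        ∀ h : ∀ s, φ.base s ∈ P.over U, φ.pullTop h ξ = f)
    (h2 : ∀ (S : NManifold.{u}) (φ ψ : NMap S P.total.toNManifold),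
      P.proj.comp φ = P.proj.comp ψ → ∀ (hφ : ∀ s, φ.base s ∈ P.over U)
      (hψ : ∀ s, ψ.base s ∈ P.over U), φ.pullTop hφ ξ = ψ.pullTop hψ ξ → φ = ψ) :
    P.IsTriv U ξ where
  mem := hm
  equivariant := he
  bijective S φ₀ h f := by
    obtain ⟨φ, hφ, hφ'⟩ := h1 S φ₀ h f
    have hU : ∀ s, φ.base s ∈ P.over U := fun s => by
      show P.proj.base (φ.base s) ∈ U
      rw [base_eq hφ]; exact h s
    refine ⟨φ, ⟨hφ, hU, hφ' hU⟩, ?_⟩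
    rintro ψ ⟨hψ, hV, hψ'⟩
    exact h2 S ψ φ (hψ.trans hφ.symm) hV hU (hψ'.trans (hφ' hU).symm)

/-- Restriction of trivializations. -/
theorem res (hξ : P.IsTriv U ξ) (hVU : V ≤ U) :
    P.IsTriv V (P.total.res (P.over_mono hVU) ξ) := by
  refine of_lift (P.total.res_mem _ hξ.mem) ?_ ?_ ?_
  · intro S φ f h h'
    rw [pullTop_res, pullTop_res]
    exact hξ.equivariant S φ f _ _
  · intro S φ₀ h f
    obtain ⟨φ, h1, h2⟩ := hξ.exists_lift φ₀ (fun s => hVU (h s)) f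
    refine ⟨φ, h1, fun h => ?_⟩
    rw [pullTop_res]
    exact h2 _
  · intro S φ ψ h hφ hψ h'
    rw [pullTop_res, pullTop_res] at h'
    exact hξ.hom_ext h _ _ h'

theorem pullTop_pull {S : NManifold.{u}} (φ : NMap S P.total.toNManifold)
    (h : ∀ s, φ.base s ∈ P.over U) (a : B.fn U) :
    φ.pullTop h (P.pullOver U a) = (P.proj.comp φ).pullTop h a := rfl

/-- Change of trivialization. -/
theorem add (hξ : P.IsTriv U ξ) {α : B.fn U} (hα : α ∈ B.deg U n) :
    P.IsTriv U (ξ + P.pullOver U α) := by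
  refine of_lift (add_mem hξ.mem (pullOver_mem hα)) ?_ ?_ ?_
  · intro S φ f h h'
    rw [map_add, map_add, hξ.equivariant S φ f h h', pullTop_pull, pullTop_pull,
      pullTop_congr (P.proj_act f φ) h' h, add_assoc]
  · intro S φ₀ h f
    -- The new coordinate takes the value `f` where the old one takes `f - φ₀^*α`.
    obtain ⟨φ, h1, h2⟩ := hξ.exists_lift φ₀ h (f - ⟨φ₀.pullTop h α, φ₀.pullTop_mem h hα⟩)
    refine ⟨φ, h1, fun h' => ?_⟩
    rw [map_add, h2, pullTop_pull, pullTop_congr h1 h' h]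
    exact sub_add_cancel _ _
  · intro S φ ψ h hφ hψ h'
    rw [map_add, map_add, pullTop_pull, pullTop_pull, pullTop_congr h hφ hψ, add_left_inj] at h'
    exact hξ.hom_ext h _ _ h'

/-- The zero section of a trivialization. -/
theorem exists_section (hξ : P.IsTriv U ξ) :
    ∃ σ : NMap (B.toNManifold.restrict U) P.total.toNManifold,
      P.proj.comp σ = incl U ∧ ∀ h : ∀ s, σ.base s ∈ P.over U, σ.pullTop h ξ = 0 :=
  hξ.exists_lift (incl U) (fun s => s.2) 0

/-- The zero section `σ` satisfies `π ∘ σ = incl U`, so `σ^*` recovers a function from its pullback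
`π^*a`. -/
theorem pull_injective (hξ : P.IsTriv U ξ) : Function.Injective (P.pullOver U) := by
  intro a b hab
  obtain ⟨σ, h1, -⟩ := hξ.exists_section
  have hU : ∀ s, σ.base s ∈ P.over U := fun s => by
    show P.proj.base (σ.base s) ∈ U
    rw [base_eq h1]; exact s.2
  refine pullTop_incl_injective ?_
  have h2 : ∀ a, (incl U).pullTop incl_mem a = σ.pullTop hU (P.pullOver U a) := fun a =>
    (pullTop_congr h1 hU incl_mem a).symm.trans (pullTop_pull σ hU a).symm
  exact (h2 a).trans ((congrArg _ hab).trans (h2 b).symm)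

/-- Two trivializations differ by a function on the base. -/
theorem exists_eq_add (hξ : P.IsTriv U ξ) {ξ' : P.total.fn (P.over U)} (hξ' : P.IsTriv U ξ') :
    ∃ α ∈ B.deg U n, ξ' = ξ + P.pullOver U α := by
  obtain ⟨σ, h1, h2⟩ := hξ.exists_section
  have hU : ∀ s, σ.base s ∈ P.over U := fun s => by
    show P.proj.base (σ.base s) ∈ U
    rw [base_eq h1]; exact s.2
  -- The witness is `ξ'` along the zero section of `ξ`.
  obtain ⟨α, hα, hασ⟩ := exists_pullTop_incl (X := B.toNManifold) (σ.pullTop_mem hU hξ'.mem)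
  refine ⟨α, hα, pullTop_incl_injective ?_⟩
  -- The inclusion `j` is the universal point of the bundle over `U`, and `p` is its projection.
  -- With `f = ξ(j)`, translating `σ ∘ p` by `f` gives `j` back, as projection and coordinate agree.
  -- Evaluating `ξ'` on both sides by equivariance gives the formula.
  let j := incl (X := P.total.toNManifold) (P.over U)
  have hj : ∀ s, j.base s ∈ P.over U := fun s => s.2
  let p := (P.proj.comp j).factor (U := U) hj
  have hp : (incl U).comp p = P.proj.comp j := incl_comp_factor _ _
  let f : MapToR n (P.total.toNManifold.restrict (P.over U)) :=
    ⟨j.pullTop hj ξ, j.pullTop_mem hj hξ.mem⟩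
  have hζ : P.proj.comp (σ.comp p) = P.proj.comp j := by
    rw [← comp_assoc, h1, hp]
  have hζU : ∀ s, (σ.comp p).base s ∈ P.over U := fun s => hU _
  have hact := over_act P (σ.comp p) f hζU
  have hjeq : P.act f (σ.comp p) = j := by
    refine hξ.hom_ext ((P.proj_act _ _).trans hζ) hact hj ?_
    rw [hξ.equivariant _ _ f hζU hact, pullTop_comp σ p hU, h2 hU, map_zero, add_zero]
  show j.pullTop hj ξ' = j.pullTop hj (ξ + P.pullOver U α)
  rw [← pullTop_congr hjeq hact hj, hξ'.equivariant _ _ f hζU hact, pullTop_comp σ p hU, ← hασ,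
    ← pullTop_comp (incl U) p incl_mem (fun s => hj s), pullTop_congr hp (fun s => hj s) hj,
    map_add]
  rfl

/-- Trivializations are local on the base. -/
theorem of_local {ι : Type u} {U : ι → Opens B.carrier} (hc : ∀ x, ∃ i, x ∈ U i)
    {ξ : P.total.fn (P.over ⊤)} (hm : ξ ∈ P.total.deg (P.over ⊤) n)
    (h : ∀ i, P.IsTriv (U i) (P.total.res (P.over_mono le_top) ξ)) :
    P.IsTriv ⊤ ξ := by
  have htop : ∀ {S : NManifold.{u}} (φ : NMap S P.total.toNManifold) (s : S.carrier),
    φ.base s ∈ P.over ⊤ := fun _ _ => trivial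
  -- Local uniqueness: a map lying over a single `U i` is determined by its projection and the value
  -- of `ξ`.
  have hext : ∀ {S : NManifold.{u}} {i : ι} {φ ψ : NMap S P.total.toNManifold},
      P.proj.comp φ = P.proj.comp ψ → (∀ s, φ.base s ∈ P.over (U i)) →
      φ.pullTop (htop φ) ξ = ψ.pullTop (htop ψ) ξ → φ = ψ := by
    intro S i φ ψ hφψ hφ h'
    have hψ : ∀ s, ψ.base s ∈ P.over (U i) := fun s => by
      show P.proj.base (ψ.base s) ∈ U i
      have e : P.proj.base (φ.base s) = P.proj.base (ψ.base s) := base_eq hφψ s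
      rw [← e]; exact hφ s
    refine (h i).hom_ext hφψ hφ hψ ?_
    rw [pullTop_res, pullTop_res]
    exact h'
  refine of_lift hm ?_ ?_ ?_
  · intro S φ f h1 h2
    -- Equivariance is tested on the preimages of the `U i` in `S`; naturality of the action allows
    -- restricting to them.
    refine eq_of_pullTop_incl (U := fun i => Opens.comap (P.proj.comp φ).base (U i))
      (fun x => hc _) fun i => ?_
    let j := incl (Opens.comap (P.proj.comp φ).base (U i))
    have hφ : ∀ s, (φ.comp j).base s ∈ P.over (U i) := fun s => s.2
    have e := (h i).equivariant _ (φ.comp j) (f.comp j) hφ (over_act P _ _ hφ)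
    rw [pullTop_res, pullTop_res] at e
    rw [map_add, ← pullTop_comp _ j h2 (htop _), ← pullTop_comp _ j h1 (htop _),
      pullTop_congr (P.act_natural j f φ) (htop _) (htop _)]
    exact e
  · intro S φ₀ h0 f
    let W : ι → Opens S.carrier := fun i => Opens.comap φ₀.base (U i)
    have hW : ∀ x, ∃ i, x ∈ W i := fun x => hc _
    have hex : ∀ i, ∃ φ : NMap (S.restrict (W i)) P.total.toNManifold,
        P.proj.comp φ = φ₀.comp (incl (W i)) ∧
        φ.pullTop (htop φ) ξ = (f.comp (incl (W i))).1 := by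
      intro i
      obtain ⟨φ, h1, h2⟩ := (h i).exists_lift (φ₀.comp (incl (W i))) (fun s => s.2)
        (f.comp (incl (W i)))
      have hφ : ∀ s, φ.base s ∈ P.over (U i) := fun s => by
        show P.proj.base (φ.base s) ∈ U i
        rw [base_eq h1]; exact s.2
      refine ⟨φ, h1, ?_⟩
      rw [← h2 hφ, pullTop_res]
    choose φ hφ hφ' using hex
    have hincl : ∀ i j, (incl (W i)).comp (inclLE (inf_le_left : W i ⊓ W j ≤ W i))
        = (incl (W j)).comp (inclLE (inf_le_right : W i ⊓ W j ≤ W j)) := fun i j =>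
      ext_res rfl fun V a => by
        refine (S.res_res _ _ _).trans (Eq.symm ?_)
        exact (congrArg _ (S.res_res _ _ a)).trans (S.res_res _ _ _)
    -- On overlaps the local lifts have the same projection and the same coordinate, both being
    -- restrictions of `φ₀` and `f`; local uniqueness makes them agree.
    obtain ⟨ψ, hψ⟩ := exists_glue hW φ fun i j => by
      refine hext (i := i) ?_ (fun s => ?_) ?_
      · rw [← comp_assoc, ← comp_assoc, hφ, hφ, comp_assoc, comp_assoc, hincl]
      · show P.proj.base ((φ i).base _) ∈ U i
        rw [base_eq (hφ i)]
        exact s.2.1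
      · rw [pullTop_comp _ _ (htop _), pullTop_comp _ _ (htop _), hφ', hφ']
        have e : ∀ k (χ : NMap (S.restrict (W i ⊓ W j)) (S.restrict (W k))),
            χ.pullTop (W := ⊤) (fun _ => trivial) (f.comp (incl (W k))).1
            = ((incl (W k)).comp χ).pullTop (W := ⊤) (fun _ => trivial) f.1 := fun k χ =>
          (pullTop_comp (W := ⊤) (incl (W k)) χ (fun _ => trivial) (fun _ => trivial) f.1).symm
        rw [e, e, hincl]
    refine ⟨ψ, ?_, fun hh => ?_⟩
    · refine ext_local hW fun i => ?_
      rw [comp_assoc, hψ, hφ]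
    · refine eq_of_pullTop_incl hW fun i => ?_
      rw [← pullTop_comp ψ _ hh (htop _), pullTop_congr (hψ i) (htop _) (htop _), hφ']
      rfl
  · intro S φ ψ hφψ h1 h2 h'
    refine ext_local (U := fun i => Opens.comap (P.proj.comp φ).base (U i)) (fun x => hc _)
      fun i => ?_
    refine hext (i := i) ?_ (fun s => s.2) ?_
    · rw [← comp_assoc, ← comp_assoc, hφψ]
    · rw [pullTop_comp _ _ h1, pullTop_comp _ _ h2, h']

end IsTriv

end RnSpace

end NQ

end
-- The product bundle with vertical part `η`.
noncomputable section

namespace NQ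

open GradedSpace FibreAlg NManifold NMap

section fibreBundle

variable {n : ℕ} (hn : 1 ≤ n)

theorem fibreTau_mem (X : NManifold.{u}) :
    fibreTau X hn ∈ (X.fibre hn).deg ⊤ n := tau_mem

variable {hn} in
/-- The component in `ℝ[n]` of a map to `X × ℝ[n]`. -/
def NMap.fibreSnd {S X : NManifold.{u}} (φ : NMap S (X.fibre hn)) : MapToR n S :=
  ⟨φ.pullTop (W := ⊤) (fun _ => trivial) (fibreTau X hn), φ.pullTop_mem _ (fibreTau_mem hn X)⟩

variable {hn} in
theorem NMap.fibreSnd_comp {S T X : NManifold.{u}} (φ : NMap S (X.fibre hn)) (ψ : NMap T S) :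
    (φ.comp ψ).fibreSnd = φ.fibreSnd.comp ψ :=
  Subtype.ext (pullTop_comp (W := ⊤) φ ψ (fun _ => trivial) (fun _ => trivial) _)

theorem NMap.fibreSnd_fibrePair {S X : NManifold.{u}} (φ : NMap S X) (f : MapToR n S) :
    (fibrePair hn φ f).fibreSnd = f := Subtype.ext (fibrePair_tau φ f)

variable {hn} in
theorem NMap.fibre_hom_ext {S X : NManifold.{u}} {φ ψ : NMap S (X.fibre hn)}
    (h : (fibreProj X hn).comp φ = (fibreProj X hn).comp ψ) (h' : φ.fibreSnd = ψ.fibreSnd) :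
    φ = ψ := fibre_ext h (congrArg Subtype.val h')

theorem MapToR.comp_add {S T : NManifold.{u}} (f g : MapToR n S) (ψ : NMap T S) :
    (f + g).comp ψ = f.comp ψ + g.comp ψ := Subtype.ext (map_add _ _ _)

variable (B : NQManifold.{u}) (η : B.fn ⊤) (hη : η ∈ B.deg ⊤ (n + 1)) (hQ : B.Q ⊤ η = 0)

theorem fibreProj_nq : IsNQMap (X := B.fibre hn η hη hQ) (Y := B) (fibreProj B.toNManifold hn) :=
  fun V a => (fibreQ_emb (B.res le_top η : B.fn V) a).symm

/-- The product `B × ℝ[n]` with the vector field `Q + η ∂/∂τ`, as a space with an action. -/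
def fibreRnSpace : RnSpace n B where
  total := B.fibre hn η hη hQ
  proj := fibreProj B.toNManifold hn
  proj_nq := fibreProj_nq hn B η hη hQ
  act f φ := fibrePair hn ((fibreProj B.toNManifold hn).comp φ) (f + NMap.fibreSnd φ)
  act_natural ψ f φ := by
    refine fibre_hom_ext ?_ ?_
    · rw [← comp_assoc, fibreProj_comp_fibrePair, fibreProj_comp_fibrePair, comp_assoc]
    · rw [fibreSnd_comp, fibreSnd_fibrePair, fibreSnd_fibrePair, MapToR.comp_add, fibreSnd_comp]
  act_zero φ := by
    refine fibre_hom_ext ?_ ?_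
    · rw [fibreProj_comp_fibrePair]
    · rw [fibreSnd_fibrePair, zero_add]
  act_add f g φ := by
    refine fibre_hom_ext ?_ ?_
    · rw [fibreProj_comp_fibrePair, fibreProj_comp_fibrePair, fibreProj_comp_fibrePair]
    · rw [fibreSnd_fibrePair, fibreSnd_fibrePair, fibreSnd_fibrePair, add_assoc]
  act_nq {S} f φ hf hφ := by
    have h1 : IsNQMap (X := S) (Y := B) ((fibreProj B.toNManifold hn).comp φ) :=
      (fibreProj_nq hn B η hη hQ).comp hφ
    refine isNQMap_fibre (hη := hη) (hQ := hQ) _ ?_ ?_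
    · rw [fibreProj_comp_fibrePair]; exact h1
    · rw [fibrePair_tau, fibreProj_comp_fibrePair]
      show S.Q ⊤ (f.1 + (NMap.fibreSnd φ).1) = _
      rw [map_add, hf, zero_add]
      refine (pullTop_Q hφ (W := (⊤ : Opens B.carrier)) (fun _ => trivial) _).symm.trans ?_
      -- Here `Qτ = π^*η`. Adding `f` with `Qf = 0` does not affect the condition that the fibre
      -- component has to satisfy.
      have e : (B.fibre hn η hη hQ).Q ⊤ (fibreTau B.toNManifold hn)
          = (fibreProj B.toNManifold hn).pull ⊤ η :=
        (fibreQ_tau (B.res le_top η : B.fn ⊤)).trans (congrArg _ (B.res_self η))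
      exact congrArg _ e
  proj_act f φ := fibreProj_comp_fibrePair _ _

/-- The fibre coordinate of `B × ℝ[n]`. -/
def fibreCoord : (fibreRnSpace hn B η hη hQ).total.fn ((fibreRnSpace hn B η hη hQ).over ⊤) :=
  fibreTau B.toNManifold hn

theorem fibre_isTriv : (fibreRnSpace hn B η hη hQ).IsTriv ⊤ (fibreCoord hn B η hη hQ) := by
  refine RnSpace.IsTriv.of_lift (fibreTau_mem hn B.toNManifold) ?_ ?_ ?_
  · intro S φ f h h'
    exact fibrePair_tau _ _
  · intro S φ₀ h f
    exact ⟨fibrePair hn φ₀ f, fibreProj_comp_fibrePair _ _, fun h => fibrePair_tau _ _⟩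
  · intro S φ ψ h hφ hψ h'
    exact fibre_ext h h'

theorem fibre_isVerticalPart :
    (fibreRnSpace hn B η hη hQ).IsVerticalPart (fibreCoord hn B η hη hQ) η :=
  (fibreQ_tau (B.res le_top η : B.fn ⊤)).trans (congrArg _ (B.res_self η))

/-- The product `B × ℝ[n]` with the vector field `Q + η ∂/∂τ`, as a principal bundle. -/
def fibreBundle : PrincipalBundle n B where
  toRnSpace := fibreRnSpace hn B η hη hQ
  locally_trivial _ := ⟨⊤, trivial, _, fibre_isTriv hn B η hη hQ⟩

end fibreBundle

/-! ### The vertical part of `Q` and the comparison with the product. -/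

namespace RnSpace

variable {n : ℕ} {B : NQManifold.{u}} {P : RnSpace n B} {ξ : P.total.fn (P.over ⊤)}

theorem mem_over_top (P : RnSpace n B) {S : NManifold.{u}} (φ : NMap S P.total.toNManifold)
    (s : S.carrier) : φ.base s ∈ P.over ⊤ := trivial

/-- Pullback of functions on the total space along a map. -/
def pullTotal (P : RnSpace n B) {S : NManifold.{u}} (φ : NMap S P.total.toNManifold) :
    P.total.fn (P.over ⊤) →ₐ[ℝ] S.fn ⊤ := φ.pullTop (P.mem_over_top φ)

theorem pullTotal_comp {S T : NManifold.{u}} (φ : NMap S P.total.toNManifold) (ψ : NMap T S)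
    (a : P.total.fn (P.over ⊤)) : P.pullTotal (φ.comp ψ) a
      = ψ.pullTop (W := ⊤) (fun _ => trivial) (P.pullTotal φ a) := pullTop_comp _ _ _ _ _

theorem pullTotal_id (a : P.total.fn (P.over ⊤)) : P.pullTotal (NMap.id _) a = a :=
  P.total.res_self a

theorem pullTotal_pullOver {S : NManifold.{u}} (φ : NMap S P.total.toNManifold) (a : B.fn ⊤) :
    P.pullTotal φ (P.pullOver ⊤ a) = (P.proj.comp φ).pullTop (W := ⊤) (fun _ => trivial) a := rfl

theorem pullTotal_Q {S : NQManifold.{u}} {φ : NMap S.toNManifold P.total.toNManifold}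
    (hφ : IsNQMap φ) (a : P.total.fn (P.over ⊤)) :
    P.pullTotal φ (P.total.Q _ a) = S.Q ⊤ (P.pullTotal φ a) := pullTop_Q hφ _ a

theorem proj_pullTop (a : B.fn ⊤) :
    P.proj.pullTop (W := ⊤) (fun _ => trivial) a = P.pullOver ⊤ a := P.total.res_self _

theorem pullOver_Q {U : Opens B.carrier} (a : B.fn U) :
    P.pullOver U (B.Q U a) = P.total.Q _ (P.pullOver U a) := P.proj_nq U a

namespace IsTriv

theorem hom_ext_top (hξ : P.IsTriv ⊤ ξ) {S : NManifold.{u}} {φ ψ : NMap S P.total.toNManifold}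
    (h : P.proj.comp φ = P.proj.comp ψ) (h' : P.pullTotal φ ξ = P.pullTotal ψ ξ) : φ = ψ :=
  hξ.hom_ext h _ _ h'

theorem exists_lift_top (hξ : P.IsTriv ⊤ ξ) {S : NManifold.{u}} (φ₀ : NMap S B.toNManifold)
    (f : MapToR n S) :
    ∃ φ : NMap S P.total.toNManifold, P.proj.comp φ = φ₀ ∧ P.pullTotal φ ξ = f := by
  obtain ⟨φ, h1, h2⟩ := hξ.exists_lift φ₀ (fun _ => trivial) f
  exact ⟨φ, h1, h2 _⟩

theorem pullTotal_act (hξ : P.IsTriv ⊤ ξ) {S : NManifold.{u}} (φ : NMap S P.total.toNManifold)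
    (f : MapToR n S) : P.pullTotal (P.act f φ) ξ = f + P.pullTotal φ ξ :=
  hξ.equivariant S φ f _ _

/-- The component in `ℝ[n]` of a trivialization. -/
def toMap (hξ : P.IsTriv ⊤ ξ) : MapToR n P.total.toNManifold := ⟨ξ, hξ.mem⟩

theorem toMap_comp (hξ : P.IsTriv ⊤ ξ) {S : NManifold.{u}} (φ : NMap S P.total.toNManifold) :
    (hξ.toMap.comp φ).1 = P.pullTotal φ ξ := rfl

/-- The vector field has a vertical part in each trivialization. -/
theorem exists_verticalPart (hn : 1 ≤ n) (hξ : P.IsTriv ⊤ ξ) :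
    ∃ η ∈ B.deg ⊤ (n + 1), B.Q ⊤ η = 0 ∧ P.IsVerticalPart ξ η := by
  -- The form `η` will be the restriction of `Qξ` to the zero section `σ`.
  obtain ⟨σ, hσ, hσξ⟩ := hξ.exists_lift_top (NMap.id B.toNManifold) 0
  have hm : P.pullTotal σ (P.total.Q _ ξ) ∈ B.deg ⊤ (n + 1) :=
    pullTop_mem _ _ (P.total.Q_mem hξ.mem)
  have hv : P.IsVerticalPart ξ (P.pullTotal σ (P.total.Q _ ξ)) := by
    -- On `X = P × ℝ[n]` with the product vector field, translating the point `pr` by `τ` is the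
    -- action map itself, an NQ-map since `Qτ = 0`.
    let X := P.total.fibre hn 0 (zero_mem _) (map_zero _)
    let pr : NMap X.toNManifold P.total.toNManifold := fibreProj P.total.toNManifold hn
    have hpr : IsNQMap (X := X) (Y := P.total) pr := fibreProj_nq hn P.total 0 _ _
    let τ : MapToR n X.toNManifold := ⟨fibreTau P.total.toNManifold hn, fibreTau_mem hn _⟩
    have hτ : X.Q ⊤ τ.1 = 0 := by
      refine (fibreQ_tau (P.total.res le_top 0 : P.total.fn ⊤)).trans ?_
      rw [map_zero, map_zero]
    have hψ : IsNQMap (X := X) (Y := P.total) (P.act τ pr) := P.act_nq τ pr hτ hpr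
    -- Invariance of `Qξ`: along the action map it becomes `Q(τ + pr^*ξ) = pr^*(Qξ)`.
    have h1 : P.pullTotal (P.act τ pr) (P.total.Q _ ξ) = P.pullTotal pr (P.total.Q _ ξ) := by
      rw [pullTotal_Q hψ, pullTotal_Q hpr, hξ.pullTotal_act, map_add, hτ, zero_add]
    -- The map `κ = (σ ∘ π, ξ)` is a section of the action map, so pulling the invariance back along
    -- `κ` gives `Qξ = π^*σ^*(Qξ)`. Only functions are pulled back, so `κ` may be a mere N-map.
    let κ : NMap P.total.toNManifold X.toNManifold := fibrePair hn (σ.comp P.proj) hξ.toMap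
    have hκ : pr.comp κ = σ.comp P.proj := fibreProj_comp_fibrePair _ _
    have hκτ : τ.comp κ = hξ.toMap := fibreSnd_fibrePair hn _ _
    have h2 : (P.act τ pr).comp κ = NMap.id _ := by
      rw [P.act_natural, hκ, hκτ]
      refine hξ.hom_ext_top ?_ ?_
      · rw [P.proj_act, ← comp_assoc, hσ]; rfl
      · have hσξ' : P.pullTotal σ ξ = 0 := hσξ
        rw [hξ.pullTotal_act, pullTotal_comp, hσξ', pullTotal_id, map_zero, add_zero]
        rfl
    have h3 : P.total.Q _ ξ = P.pullTotal (σ.comp P.proj) (P.total.Q _ ξ) := by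
      rw [← hκ, pullTotal_comp, ← h1, ← pullTotal_comp, h2, pullTotal_id]
    rw [pullTotal_comp, proj_pullTop] at h3
    exact h3
  -- Closedness: `π^*(Qη) = Q(Qξ) = 0`, and `π^*` is injective.
  refine ⟨_, hm, hξ.pull_injective ?_, hv⟩
  rw [pullOver_Q, map_zero]
  exact (congrArg _ hv).symm.trans (P.total.Q_Q ξ)

theorem verticalPart_unique (hξ : P.IsTriv ⊤ ξ) {η η' : B.fn ⊤} (h : P.IsVerticalPart ξ η)
    (h' : P.IsVerticalPart ξ η') : η = η' := hξ.pull_injective (h.symm.trans h')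

theorem verticalPart_add {η α : B.fn ⊤} (h : P.IsVerticalPart ξ η) :
    P.IsVerticalPart (ξ + P.pullOver ⊤ α) (η + B.Q ⊤ α) := by
  have e : P.total.Q _ (ξ + P.pullOver ⊤ α) = P.pullOver ⊤ (η + B.Q ⊤ α) := by
    rw [map_add, map_add, pullOver_Q]
    exact congrArg (· + _) h
  exact e

end IsTriv

end RnSpace

open RnSpace

theorem NMap.pull_injective {X Y : NManifold.{u}} {κ : NMap X Y} {θ : NMap Y X}
    (h : κ.comp θ = NMap.id Y) (V : Opens Y.carrier) : Function.Injective (κ.pull V) := by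
  intro a b hab
  have e : ∀ a, a = _ := pull_congr h.symm V
  refine (e a).trans (Eq.trans ?_ (e b).symm)
  exact congrArg (fun c => Y.res _ (θ.pull _ c)) hab

/-- The inverse of an NQ-map is an NQ-map. -/
theorem IsNQMap.of_inverse {X Y : NQManifold.{u}} {κ : NMap X.toNManifold Y.toNManifold}
    {θ : NMap Y.toNManifold X.toNManifold} (hκ : IsNQMap κ) (h1 : θ.comp κ = NMap.id _)
    (h2 : κ.comp θ = NMap.id _) : IsNQMap θ := by
  intro V a
  -- Since `κ^*` is injective, the identity may be checked after applying it; there `κ^*θ^*` is the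
  -- identity and `κ^*` commutes with `Q`.
  refine NMap.pull_injective h2 _ ?_
  have e1 := pull_congr h1 V (X.Q V a)
  have e2 := pull_congr h1 V a
  refine e1.trans (Eq.trans ?_ (hκ (Opens.comap θ.base V) (θ.pull V a)).symm)
  refine Eq.trans ?_ (congrArg (X.Q _) e2.symm)
  exact (X.Q_res _ _).symm

/-- A trivialization with vertical part `η` identifies a bundle with the product. -/
theorem nonempty_bundleIso {n : ℕ} (hn : 1 ≤ n) {B : NQManifold.{u}} (P : PrincipalBundle n B)
    {ξ : P.total.fn (P.over ⊤)} (hξ : P.IsTriv ⊤ ξ) {η : B.fn ⊤} (hη : η ∈ B.deg ⊤ (n + 1))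
    (hQ : B.Q ⊤ η = 0) (hv : P.IsVerticalPart ξ η) :
    Nonempty (BundleIso P (fibreBundle hn B η hη hQ)) := by
  let κ : NMap P.total.toNManifold (B.fibre hn η hη hQ).toNManifold :=
    fibrePair hn P.proj hξ.toMap
  have hκ : (fibreProj B.toNManifold hn).comp κ = P.proj := fibreProj_comp_fibrePair _ _
  have hκτ : NMap.fibreSnd κ = hξ.toMap := fibreSnd_fibrePair hn _ _
  have hnq : IsNQMap (X := P.total) (Y := B.fibre hn η hη hQ) κ := by
    refine isNQMap_fibre (hη := hη) (hQ := hQ) κ ?_ ?_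
    · rw [hκ]; exact P.proj_nq
    · have e : κ.pullTop (W := ⊤) (fun _ => trivial) (fibreTau B.toNManifold hn) = ξ :=
        congrArg Subtype.val hκτ
      rw [e, hκ]
      exact hv.trans (proj_pullTop η).symm
  -- The inverse sends a point of the product to the point of `P` with the same projection and with
  -- `ξ` equal to `τ`.
  obtain ⟨θ, hθ, hθξ⟩ := hξ.exists_lift_top (fibreProj B.toNManifold hn)
    ⟨fibreTau B.toNManifold hn, fibreTau_mem hn _⟩
  have h1 : θ.comp κ = NMap.id _ := by
    refine hξ.hom_ext_top ?_ ?_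
    · rw [← comp_assoc, hθ, hκ]; rfl
    · rw [pullTotal_comp, hθξ, pullTotal_id]
      exact congrArg Subtype.val hκτ
  have h2 : κ.comp θ = NMap.id _ := by
    refine fibre_hom_ext ?_ ?_
    · rw [← comp_assoc, hκ, hθ]; rfl
    · rw [fibreSnd_comp, hκτ]
      refine Subtype.ext ?_
      rw [hξ.toMap_comp, hθξ]
      exact ((B.toNManifold.fibre hn).res_self _).symm
  have hact : ∀ {S : NManifold.{u}} (f : MapToR n S) (φ : NMap S P.total.toNManifold),
      κ.comp (P.act f φ) = fibrePair hn ((fibreProj B.toNManifold hn).comp (κ.comp φ))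
        (f + NMap.fibreSnd (κ.comp φ)) := by
    intro S f φ
    refine fibre_hom_ext ?_ ?_
    · rw [fibreProj_comp_fibrePair, ← comp_assoc, ← comp_assoc, hκ, P.proj_act]
    · rw [fibreSnd_fibrePair, fibreSnd_comp, fibreSnd_comp, hκτ]
      exact Subtype.ext (hξ.pullTotal_act φ f)
  exact ⟨{
    hom := κ
    inv := θ
    hom_inv := h1
    inv_hom := h2
    hom_nq := hnq
    inv_nq := hnq.of_inverse h1 h2
    over_base := hκ
    equivariant := fun f φ => hact f φ }⟩

/-- Trivializations are carried over by isomorphisms. -/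
theorem BundleIso.isTriv {n : ℕ} {B : NQManifold.{u}} {P P' : PrincipalBundle n B}
    (e : BundleIso P P') {ξ : P'.total.fn (P'.over ⊤)} (hξ : P'.IsTriv ⊤ ξ) :
    P.IsTriv ⊤ (P'.pullTotal e.hom ξ) := by
  have hcomp : ∀ {S : NManifold.{u}} (φ : NMap S P.total.toNManifold),
      P.pullTotal φ (P'.pullTotal e.hom ξ) = P'.pullTotal (e.hom.comp φ) ξ := fun φ =>
    (pullTotal_comp _ _ _).symm
  have hproj : P.proj.comp e.inv = P'.proj := by
    rw [← e.over_base, comp_assoc, e.inv_hom]; rfl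
  refine IsTriv.of_lift (pullTop_mem _ _ hξ.mem) ?_ ?_ ?_
  · intro S φ f h h'
    show P.pullTotal (P.act f φ) _ = f + P.pullTotal φ _
    rw [hcomp, hcomp, e.equivariant, hξ.pullTotal_act]
  · intro S φ₀ h f
    obtain ⟨φ, h1, h2⟩ := hξ.exists_lift_top φ₀ f
    refine ⟨e.inv.comp φ, ?_, fun h => ?_⟩
    · rw [← comp_assoc, hproj, h1]
    · refine (hcomp _).trans ?_
      rw [← comp_assoc, e.inv_hom]
      exact h2
  · intro S φ ψ h hφ hψ h'
    have h1 : e.hom.comp φ = e.hom.comp ψ := by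
      refine hξ.hom_ext_top ?_ ?_
      · rw [← comp_assoc, ← comp_assoc, e.over_base, h]
      · rw [← hcomp, ← hcomp]; exact h'
    have h2 := congrArg (fun χ => e.inv.comp χ) h1
    simp only [← comp_assoc, e.hom_inv] at h2
    exact h2

/-- Pulling `Qξ = π'^*η` back along the isomorphism keeps `η`, because it commutes with `Q` and with
the projections. -/
theorem BundleIso.isVerticalPart {n : ℕ} {B : NQManifold.{u}} {P P' : PrincipalBundle n B}
    (e : BundleIso P P') {ξ : P'.total.fn (P'.over ⊤)} {η : B.fn ⊤}
    (h : P'.IsVerticalPart ξ η) : P.IsVerticalPart (P'.pullTotal e.hom ξ) η := by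
  have h1 : P.total.Q ⊤ (P'.pullTotal e.hom ξ) = P'.pullTotal e.hom (P'.pullOver ⊤ η) :=
    (pullTotal_Q e.hom_nq ξ).symm.trans (congrArg _ h)
  rw [pullTotal_pullOver, pullTop_congr (W := ⊤) e.over_base (fun _ => trivial)
    (fun _ => trivial)] at h1
  exact h1.trans (proj_pullTop η)

end NQ

end
-- Existence of N-trivializations: Čech cocycles of forms.
noncomputable section

namespace NQ

open GradedSpace NManifold NMap

/-- A principal bundle is trivial if Čech cocycles of degree `n` on the base are coboundaries. -/
theorem PrincipalBundle.exists_isTriv {n : ℕ} {B : NQManifold.{u}} (P : PrincipalBundle n B)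
    (hB : ∀ U : B.carrier → Opens B.carrier, (∀ x, x ∈ U x) → ∀ α : ∀ i j, B.fn (U i ⊓ U j),
      (∀ i j, α i j ∈ B.deg _ n) →
      (∀ i j k, B.res (show U i ⊓ U j ⊓ U k ≤ U i ⊓ U j from inf_le_left) (α i j)
        + B.res (show U i ⊓ U j ⊓ U k ≤ U j ⊓ U k from inf_le_inf_right _ inf_le_right) (α j k)
        = B.res (show U i ⊓ U j ⊓ U k ≤ U i ⊓ U k from inf_le_inf_right _ inf_le_left) (α i k)) →
      ∃ β : ∀ j, B.fn (U j), (∀ j, β j ∈ B.deg _ n) ∧ ∀ j k,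
        B.res (inf_le_right : U j ⊓ U k ≤ U k) (β k)
          = B.res (inf_le_left : U j ⊓ U k ≤ U j) (β j) + α j k) :
    ∃ ξ, P.IsTriv ⊤ ξ := by
  choose U hU ξ hξ using P.locally_trivial
  -- The cocycle is fixed by `ξ_i = ξ_j + π^*α_ij` on overlaps.
  have hex : ∀ i j, ∃ α ∈ B.deg (U i ⊓ U j) n,
      P.total.res (P.over_mono inf_le_left) (ξ i)
        = P.total.res (P.over_mono inf_le_right) (ξ j) + P.pullOver (U i ⊓ U j) α := fun i j =>
    ((hξ j).res inf_le_right).exists_eq_add ((hξ i).res inf_le_left)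
  choose α hα hαξ using hex
  have hres : ∀ i j (V : Opens B.carrier) (hV : V ≤ U i ⊓ U j),
      P.pullOver V (B.res hV (α i j)) = P.total.res (P.over_mono (hV.trans inf_le_left)) (ξ i)
        - P.total.res (P.over_mono (hV.trans inf_le_right)) (ξ j) := by
    intro i j V hV
    have h := congrArg (P.total.res (P.over_mono hV)) (hαξ i j)
    rw [map_add, P.total.res_res, P.total.res_res, ← RnSpace.pullOver_res] at h
    rw [h, add_sub_cancel_left]
  -- The cocycle identity is verified after the injective `π^*`, where it is a telescoping sum of
  -- differences of the `ξ_i`. As `β_k = β_j + α_jk`, the functions `ξ_j + π^*β_j` agree on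
  -- overlaps.
  obtain ⟨β, hβ, hβα⟩ := hB U hU α hα fun i j k => by
    refine ((hξ i).res (inf_le_left.trans inf_le_left : U i ⊓ U j ⊓ U k ≤ U i)).pull_injective ?_
    show P.pullOver _ _ = P.pullOver _ _
    rw [map_add, hres, hres, hres]
    exact sub_add_sub_cancel _ _ _
  have hcomp : ∀ j k (W : Opens P.total.carrier) (hj : W ≤ P.over (U j)) (hk : W ≤ P.over (U k)),
      P.total.res hj (ξ j + P.pullOver (U j) (β j))
        = P.total.res hk (ξ k + P.pullOver (U k) (β k)) := by
    intro j k W hj hk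
    have hW : W ≤ P.over (U j ⊓ U k) := le_inf hj hk
    have h1 : P.total.res (P.over_mono inf_le_left : P.over (U j ⊓ U k) ≤ P.over (U j))
          (ξ j + P.pullOver (U j) (β j))
        = P.total.res (P.over_mono inf_le_right) (ξ k + P.pullOver (U k) (β k)) := by
      rw [map_add, map_add, ← RnSpace.pullOver_res (inf_le_left : U j ⊓ U k ≤ U j),
        ← RnSpace.pullOver_res (inf_le_right : U j ⊓ U k ≤ U k), hαξ j k, hβα j k, map_add]
      abel
    have h2 := congrArg (P.total.res hW) h1
    rwa [P.total.res_res, P.total.res_res] at h2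
  obtain ⟨ζ, ⟨hζ, hζU⟩, -⟩ := P.total.glue n (P.over ⊤) (fun i => P.over (U i))
    (fun i => P.over_mono le_top) (fun x _ => ⟨P.proj.base x, hU _⟩)
    (fun i => ξ i + P.pullOver (U i) (β i))
    (fun i => add_mem (hξ i).mem (RnSpace.pullOver_mem (hβ i))) hcomp
  refine ⟨ζ, RnSpace.IsTriv.of_local (U := U) (fun x => ⟨x, hU x⟩) hζ fun i => ?_⟩
  rw [hζU i]
  exact (hξ i).add (hβ i)

section forms

variable (m : ℕ) {M : Type u} [TopologicalSpace M] [ChartedSpace (EuclideanSpace ℝ (Fin m)) M]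

/-- A smooth function times a form, extended by zero outside the support of the function. -/
theorem smul_extZero_mem {ρ : M → ℝ} (hρ : ContMDiff (𝓡 m) 𝓘(ℝ, ℝ) ∞ ρ) {U V : Opens M}
    (hs : tsupport ρ ⊆ U) (w : Form m (U ⊓ V)) {x : M} (hx : x ∈ V) :
    ∃ W : Opens M, W ≤ V ∧ x ∈ W ∧ (fun y : W => ρ y • extZero w.1 y.1) ∈ formGen m W := by
  -- On the support, `x` lies in `U ⊓ V` and the product is that of a smooth function and a form;
  -- off the support it vanishes near `x`.
  by_cases hxs : x ∈ tsupport ρ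
  · obtain ⟨W, hW, hxW, hw⟩ := w.2 x ⟨hs hxs, hx⟩
    refine ⟨W, hW.trans inf_le_right, hxW, ?_⟩
    have h1 : (fun y : W => ρ y • extZero w.1 y.1)
        = (fun y : W => algebraMap ℝ (Lam m) (ρ y)) * restr hW w.1 := by
      ext y
      rw [extZero_of_mem w.1 (hW y.2), Algebra.smul_def]
      rfl
    rw [h1]
    exact mul_mem (Algebra.subset_adjoin ⟨ρ, hρ.contMDiffOn, Or.inl rfl⟩) hw
  · refine ⟨V ⊓ ⟨(tsupport ρ)ᶜ, (isClosed_tsupport ρ).isOpen_compl⟩, inf_le_left, ⟨hx, hxs⟩, ?_⟩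
    have h1 : (fun y : (V ⊓ ⟨(tsupport ρ)ᶜ, (isClosed_tsupport ρ).isOpen_compl⟩ : Opens M) =>
        ρ y • extZero w.1 y.1) = 0 := by
      ext y
      have : ρ y = 0 := by
        by_contra h
        exact y.2.2 (subset_tsupport ρ h)
      rw [this, zero_smul]
      rfl
    rw [h1]
    exact zero_mem _

variable [IsManifold (𝓡 m) ∞ M] [T2Space M] [SecondCountableTopology M]

/-- Čech cocycles of differential forms are coboundaries. -/
theorem form_cech (n : ℕ) (U : M → Opens M) (hU : ∀ x, x ∈ U x)
    (α : ∀ i j, Form m (U i ⊓ U j)) (hα : ∀ i j, α i j ∈ formDeg m _ n)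
    (hc : ∀ i j k, formRes m (show U i ⊓ U j ⊓ U k ≤ U i ⊓ U j from inf_le_left) (α i j)
      + formRes m (show U i ⊓ U j ⊓ U k ≤ U j ⊓ U k from inf_le_inf_right _ inf_le_right) (α j k)
      = formRes m (show U i ⊓ U j ⊓ U k ≤ U i ⊓ U k from inf_le_inf_right _ inf_le_left)
        (α i k)) :
    ∃ β : ∀ j, Form m (U j), (∀ j, β j ∈ formDeg m _ n) ∧ ∀ j k,
      formRes m (inf_le_right : U j ⊓ U k ≤ U k) (β k)
        = formRes m (inf_le_left : U j ⊓ U k ≤ U j) (β j) + α j k := by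
  have : LocallyCompactSpace M := ChartedSpace.locallyCompactSpace (EuclideanSpace ℝ (Fin m)) M
  obtain ⟨ρ, hρ⟩ := SmoothPartitionOfUnity.exists_isSubordinate (𝓡 m) (isClosed_univ (X := M))
    (fun i => (U i : Set M)) (fun i => (U i).2) (fun x _ => Set.mem_iUnion.2 ⟨x, hU x⟩)
  have hfin : ∀ x, (Function.support fun i => ρ i x).Finite := fun x =>
    ρ.locallyFinite.point_finite x
  have hfin' : ∀ j x, (Function.support fun i => ρ i x • extZero (α i j).1 x).Finite := fun j x =>
    (hfin x).subset fun i hi h => hi (by simp only at h ⊢; rw [h, zero_smul])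
  -- The usual homotopy: `β_j = Σ_i ρ_i α_ij`.
  let b : ∀ j, U j → Lam m := fun j x => ∑ᶠ i, ρ i x.1 • extZero (α i j).1 x.1
  have hb : ∀ j, b j ∈ Form m (U j) := by
    intro j x hx
    -- Near `x` only finitely many `ρ_i` are nonzero, so the neighbourhoods on which the single
    -- terms are generated by functions and differentials can be intersected.
    obtain ⟨N, hN, hNfin⟩ := ρ.locallyFinite x
    choose W hWj hxW hW using fun i =>
      smul_extZero_mem m (ρ i).contMDiff (hρ i) (α i j) hx
    have hNo : x ∈ interior N := mem_interior_iff_mem_nhds.2 hN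
    let F := hNfin.toFinset
    let V : Opens M := U j ⊓ ⟨interior N, isOpen_interior⟩ ⊓ F.inf W
    have hxF : x ∈ F.inf W := by
      rw [← SetLike.mem_coe, Opens.coe_finset_inf, Finset.inf_eq_iInf]
      simp only [Set.iInf_eq_iInter, Set.mem_iInter]
      exact fun i _ => hxW i
    refine ⟨V, inf_le_left.trans inf_le_left, ⟨⟨hx, hNo⟩, hxF⟩, ?_⟩
    have h1 : restr (inf_le_left.trans inf_le_left : V ≤ U j) (b j)
        = ∑ i ∈ F, fun y : V => ρ i y.1 • extZero (α i j).1 y.1 := by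
      ext y
      rw [Finset.sum_apply]
      refine finsum_eq_sum_of_support_subset _ fun i hi => ?_
      rw [Finset.mem_coe, Set.Finite.mem_toFinset]
      refine ⟨y.1, fun h => hi ?_, interior_subset y.2.1.2⟩
      simp only
      rw [h, zero_smul]
    rw [h1]
    refine sum_mem fun i hi => ?_
    have hVW : V ≤ W i := inf_le_right.trans (Finset.inf_le hi)
    exact restr_formGen m hVW (hW i)
  refine ⟨fun j => ⟨b j, hb j⟩, fun j x => ?_, fun j k => Subtype.ext (funext fun x => ?_)⟩
  · refine finsum_induction (fun a => a ∈ ⋀[ℝ]^n (Cot m)) (zero_mem _)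
      (fun _ _ => add_mem) fun i => Submodule.smul_mem _ _ ?_
    by_cases h : x.1 ∈ U i ⊓ U j
    · rw [extZero_of_mem _ h]; exact hα i j _
    · rw [extZero, dif_neg h]; exact zero_mem _
  · show (∑ᶠ i, ρ i x.1 • extZero (α i k).1 x.1)
      = (∑ᶠ i, ρ i x.1 • extZero (α i j).1 x.1) + (α j k).1 x
    -- Since `Σ_i ρ_i = 1`, the claim reduces termwise to the cocycle identity `α_ik = α_ij + α_jk`,
    -- needed only where `ρ_i ≠ 0`, hence on `U i`.
    have h1 : (α j k).1 x = ∑ᶠ i, ρ i x.1 • (α j k).1 x := by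
      rw [← finsum_smul, ρ.sum_eq_one (Set.mem_univ _), one_smul]
    rw [h1, ← finsum_add_distrib (hfin' j x.1)
      ((hfin x.1).subset fun i hi h => hi (by simp only at h ⊢; rw [h, zero_smul]))]
    refine finsum_congr fun i => ?_
    by_cases hi : ρ i x.1 = 0
    · rw [hi, zero_smul, zero_smul, zero_smul, add_zero]
    have hxi : x.1 ∈ U i := hρ i (subset_tsupport _ hi)
    rw [← smul_add, extZero_of_mem _ (⟨hxi, x.2.2⟩ : x.1 ∈ U i ⊓ U k),
      extZero_of_mem _ (⟨hxi, x.2.1⟩ : x.1 ∈ U i ⊓ U j)]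
    have h2 := congrFun (congrArg Subtype.val (hc i j k)) ⟨x.1, ⟨hxi, x.2.1⟩, x.2.2⟩
    exact congrArg (ρ i x.1 • ·) h2.symm

end forms

end NQ

end

/-! ### The classification. -/

theorem mainTheorem1 (n m : ℕ) (hn : 1 ≤ n) (M : Type u) [TopologicalSpace M]
    [ChartedSpace (EuclideanSpace ℝ (Fin m)) M] [IsManifold (𝓡 m) ∞ M]
    [T2Space M] [SecondCountableTopology M] :
    -- N-trivializations and the vertical part of `Q`
    (∀ P : NQ.PrincipalBundle n (NQ.T1 m M),
      (∃ ξ, P.IsTriv ⊤ ξ) ∧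
      (∀ ξ, P.IsTriv ⊤ ξ →
        ∃! η, η ∈ NQ.closedForms m M (n + 1) ∧ P.IsVerticalPart ξ η) ∧
      (∀ ξ, P.IsTriv ⊤ ξ → ∀ ξ',
        (P.IsTriv ⊤ ξ' ↔ ∃! α, α ∈ NQ.Forms m M n ∧ ξ' = ξ + P.pullBase α)) ∧
      (∀ ξ η, P.IsTriv ⊤ ξ → P.IsVerticalPart ξ η → ∀ α ∈ NQ.Forms m M n,
        P.IsVerticalPart (ξ + P.pullBase α) (η + (NQ.T1 m M).Q ⊤ α))) ∧
    -- the classification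
    ∃ c : Quotient (NQ.bundleSetoid n (NQ.T1 m M)) → NQ.HDR m M (n + 1),
      Function.Bijective c ∧
      ∀ (P : NQ.PrincipalBundle n (NQ.T1 m M)) (ξ) (η)
        (hη : η ∈ NQ.closedForms m M (n + 1)),
        P.IsTriv ⊤ ξ → P.IsVerticalPart ξ η → c ⟦P⟧ = NQ.HDR.mk η hη := by
  have hT : ∀ P : NQ.PrincipalBundle n (NQ.T1 m M), ∃ ξ, P.IsTriv ⊤ ξ := fun P =>
    P.exists_isTriv (NQ.form_cech m (M := M) n)
  have hV : ∀ (P : NQ.PrincipalBundle n (NQ.T1 m M)) ξ, P.IsTriv ⊤ ξ →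
      ∃! η, η ∈ NQ.closedForms m M (n + 1) ∧ P.IsVerticalPart ξ η := by
    intro P ξ hξ
    obtain ⟨η, h1, h2, h3⟩ := hξ.exists_verticalPart hn
    exact ⟨η, ⟨⟨h1, h2⟩, h3⟩, fun η' h => hξ.verticalPart_unique h.2 h3⟩
  refine ⟨fun P => ⟨hT P, hV P, fun ξ hξ ξ' => ⟨fun hξ' => ?_, ?_⟩,
    fun ξ η _ h α _ => NQ.RnSpace.IsTriv.verticalPart_add h⟩, ?_⟩
  · obtain ⟨α, hα, h⟩ := hξ.exists_eq_add hξ'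
    exact ⟨α, ⟨hα, h⟩, fun α' h' => hξ.pull_injective (add_left_cancel (h'.2.symm.trans h))⟩
  · rintro ⟨α, ⟨hα, rfl⟩, -⟩
    exact hξ.add hα
  choose ξ hξ using hT
  choose η hη _ using fun P => hV P (ξ P) (hξ P)
  have hmk : ∀ {a b : (NQ.T1 m M).fn ⊤} (ha : a ∈ NQ.closedForms m M (n + 1))
      (hb : b ∈ NQ.closedForms m M (n + 1)), NQ.HDR.mk a ha = NQ.HDR.mk b hb ↔
        ∃ α ∈ NQ.Forms m M n, (NQ.T1 m M).Q ⊤ α = a - b := fun {a b} ha hb =>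
    (Submodule.Quotient.eq _).trans Submodule.mem_map
  -- The class is independent of the coordinate: two coordinates differ by some `π^*α`, so their
  -- vertical parts differ by `dα`. Isomorphism invariance and surjectivity reduce to this.
  have hclass : ∀ (P : NQ.PrincipalBundle n (NQ.T1 m M)) ζ θ ζ' θ'
      (hθ : θ ∈ NQ.closedForms m M (n + 1)) (hθ' : θ' ∈ NQ.closedForms m M (n + 1)),
      P.IsTriv ⊤ ζ → P.IsVerticalPart ζ θ → P.IsTriv ⊤ ζ' → P.IsVerticalPart ζ' θ' →
      NQ.HDR.mk θ hθ = NQ.HDR.mk θ' hθ' := by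
    intro P ζ θ ζ' θ' hθ hθ' h1 h2 h3 h4
    obtain ⟨α, hα, rfl⟩ := h3.exists_eq_add h1
    refine (hmk hθ hθ').2 ⟨α, hα, ?_⟩
    rw [h1.verticalPart_unique h2 (NQ.RnSpace.IsTriv.verticalPart_add h4), add_sub_cancel_left]
  refine ⟨Quotient.lift (fun P => NQ.HDR.mk (η P) (hη P).1) ?_, ⟨?_, ?_⟩, ?_⟩
  · rintro P P' ⟨e⟩
    exact hclass P _ _ _ _ _ _ (hξ P) (hη P).2 (e.isTriv (hξ P')) (e.isVerticalPart (hη P').2)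
  · intro q q'
    refine Quotient.inductionOn₂ q q' fun P P' h => ?_
    obtain ⟨α, hα, h⟩ := (hmk _ _).1 (show NQ.HDR.mk (η P) (hη P).1 = NQ.HDR.mk (η P') _ from h)
    -- Since `dα = η P - η P'`, changing the coordinate of `P'` by `α` gives it the vertical part `η
    -- P`; both bundles are then isomorphic to the same product.
    have h1 := (hξ P').add hα
    have h2 : P'.IsVerticalPart (ξ P' + P'.pullOver ⊤ α) (η P) := by
      have := NQ.RnSpace.IsTriv.verticalPart_add (α := α) (hη P').2
      rwa [h, add_sub_cancel] at this
    have e1 := NQ.nonempty_bundleIso hn P (hξ P) (hη P).1.1 (hη P).1.2 (hη P).2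
    have e2 := NQ.nonempty_bundleIso hn P' h1 (hη P).1.1 (hη P).1.2 h2
    exact Quotient.sound ((NQ.bundleSetoid n (NQ.T1 m M)).trans e1
      ((NQ.bundleSetoid n (NQ.T1 m M)).symm e2))
  · intro q
    obtain ⟨⟨θ, hθ⟩, rfl⟩ := Submodule.Quotient.mk_surjective _ q
    exact ⟨⟦NQ.fibreBundle hn (NQ.T1 m M) θ hθ.1 hθ.2⟧,
      hclass _ _ _ _ _ _ _ (hξ _) (hη _).2 (NQ.fibre_isTriv hn _ θ hθ.1 hθ.2)
        (NQ.fibre_isVerticalPart hn _ θ hθ.1 hθ.2)⟩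
  · intro P ζ θ hθ h1 h2
    exact hclass P _ _ _ _ _ _ (hξ P) (hη P).2 h1 h2
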